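/- **Setting.** Work over the field $\mathbb C(t)$, with variables $\mathbf x=(x_1,x_2,\dots)$, $\mathbf y=(y_1,y_2,\dots)$. For a sequence $\mathbf a=(a_1,a_2,\dots)$ of pairwise commuting elements of a $\mathbb C(t)$-algebra define $q_n(\mathbf a)$ by $$\sum_{n\ge 0} q_n(\mathbf a)z^n=\exp\Big(\sum_{n\ge1}(1-t^n)a_nz^n\Big),\qquad q_n=0\ (n<0),\qquad H_n(\mathbf a,z)=\sum_{k=0}^n z^kq_k(\mathbf a).$$ Let $\mathbf x-\tilde\partial_{\mathbf y}$ and $\mathbf y-\tilde\partial_{\mathbf x}$ be the sequences of operators $x_n-\frac1n\frac{\partial}{\partial y_n}$ and $y_n-\frac1n\frac{\partial}{\partial x_n}$ on $\mathbb C(t)[\mathbf x,\mathbf y]$. For partitions $\lambda=(\lambda_1,\dots,\lambda_l)$, $\mu=(\mu_1,\dots,\mu_{l'})$ the coupled Hall-Littlewood function is $$Q_{[\lambda,\mu]}=\prod_{i<j}\frac{1-R_{\lambda_i\lambda_j}}{1-tR_{\lambda_i\lambda_j}}\prod_{a<b}\frac{1-R_{\mu_a\mu_b}}{1-tR_{\mu_a\mu_b}}\prod_{i,a}\frac{(1-D_{\lambda_i\mu_a})(1-t^2D_{\lambda_i\mu_a})}{(1-tD_{\lambda_i\mu_a})^2}\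 \prod_i q_{\lambda_i}(\mathbf x)\prod_a q_{\mu_a}(\mathbf y),$$ where the operators act on indices: $R_{\lambda_i\lambda_j}$ replaces $(\lambda_i,\lambda_j)$ by $(\lambda_i+1,\lambda_j-1)$, similarly $R_{\mu_a\mu_b}$, and $D_{\lambda_i\mu_a}$ replaces $(\lambda_i,\mu_a)$ by $(\lambda_i-1,\mu_a-1)$; all fractions are expanded as power series in these operators. Let $M_1,M_2$ be positive integers. Let $\mathcal F=\bigotimes_{i=0}^{M_1}\mathcal F^{(1)}_i\otimes\bigotimes_{i=0}^{M_2}\mathcal F^{(2)}_i$, where each factor is a Fock space with basis $|n\rangle$ ($n\ge0$) and operators $B^\dagger|n\rangle=|n+1\rangle$, $B|n\rangle=\frac{1-q^n}{1-q}|n-1\rangle$ (so $B|0\rangle=0$), with $q=t$. For $j=1,2$ and a nonzero scalar $u$ put $$T_j(u)=L^{(j)}_{M_j}(u)\cdots L^{(j)}_0(u),\qquad L^{(j)}_i(u)=\begin{pmatrix}u^{-1}&B_i^{(j)\dagger}\\(1-q)B_i^{(j)}&u\end{pmatrix},$$ let $B_j(u)$ be the upper right entry of $T_j(u)$, and define $\tilde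 B_j(u)$ by $B_j(u)=u^{-M_j}\tilde B_j(u)$. Let $\jmath:\mathcal F\to\mathbb C(t)[\mathbf x,\mathbf y]$ be the linear map $$\jmath\Big(\bigotimes_{i=0}^{M_1}|n_i\rangle^{(1)}_i\otimes\bigotimes_{i=0}^{M_2}|m_i\rangle^{(2)}_i\Big)=Q_{[\lambda,\mu]},\qquad \lambda=1^{n_1}2^{n_2}\cdots,\quad \mu=1^{m_1}2^{m_2}\cdots.$$ Let $\mathbb C(t)_{M_1,M_2}[\mathbf x,\mathbf y]$ be the span of the $Q_{[\lambda,\mu]}$ for which $\lambda$ has at most $M_1$ columns and $\mu$ at most $M_2$ columns. **Proposition.** The image of $\jmath$ is $\mathbb C(t)_{M_1,M_2}[\mathbf x,\mathbf y]$. The span of the remaining $Q_{[\lambda,\mu]}$ is a complement of $\mathbb C(t)_{M_1,M_2}[\mathbf x,\mathbf y]$ in $\mathbb C(t)[\mathbf x,\mathbf y]$; let $\pi$ be the projection of $\mathbb C(t)[\mathbf x,\mathbf y]$ onto $\mathbb C(t)_{M_1,M_2}[\mathbf x,\mathbf y]$ along this complement. Then in the space $\mathbb C(t)_{M_1,M_2}[\mathbf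 x,\mathbf y]$ one has $\tilde B_1(u)=H_{M_1}(\mathbf x-\tilde\partial_{\mathbf y},u^2)$ and $\tilde B_2(u)=H_{M_2}(\mathbf y-\tilde\partial_{\mathbf x},u^2)$, that is, for every nonzero $u\in\mathbb C(t)$ and every $v\in\mathcal F$, $$\jmath\big(\tilde B_1(u)v\big)=\pi\,H_{M_1}(\mathbf x-\tilde\partial_{\mathbf y},u^2)\,\jmath(v),\qquad \jmath\big(\tilde B_2(u)v\big)=\pi\,H_{M_2}(\mathbf y-\tilde\partial_{\mathbf x},u^2)\,\jmath(v).$$ -/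

import Mathlib

open scoped TensorProduct

noncomputable section

namespace CoupledHL

/-- The ground field `ℂ(t)`. -/
abbrev K : Type := RatFunc ℂ

/-- The indeterminate `t` of `ℂ(t)`; it is also the deformation parameter `q` of the
`q`-boson algebra. -/
def t : K := RatFunc.X

/-- The polynomial algebra `ℂ(t)[𝐱, 𝐲]` in `𝐱 = (x₁, x₂, …)` and `𝐲 = (y₁, y₂, …)`:
`Sum.inl n` indexes `xₙ` and `Sum.inr n` indexes `yₙ`. -/
abbrev Poly : Type := MvPolynomial (ℕ+ ⊕ ℕ+) K

/-- The sequence of polynomials `𝐱 = (x₁, x₂, …)`. -/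
def xVar (n : ℕ+) : Poly := MvPolynomial.X (Sum.inl n)

/-- The sequence of polynomials `𝐲 = (y₁, y₂, …)`. -/
def yVar (n : ℕ+) : Poly := MvPolynomial.X (Sum.inr n)

/-! ### The functions `qₙ` and the truncated generating function `Hₙ` -/

section QFunctions

variable {A : Type*} [Ring A] [Algebra K A]

/-- `ξ_t(a, z) = ∑_{n ≥ 1} (1 - tⁿ) aₙ zⁿ`, for a sequence `a = (a₁, a₂, …)` in a `ℂ(t)`-algebra. -/
def xi (a : ℕ+ → A) : PowerSeries A :=
  PowerSeries.mk fun n => if h : 0 < n then (1 - t ^ n) • a ⟨n, h⟩ else 0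

/-- `qₙ(a)`, the coefficient of `zⁿ` in `exp (ξ_t(a, z)) = ∑ₖ ξ_t(a, z)ᵏ / k!`. As `ξ_t(a, z)` has
no constant term, only `k ≤ n` contribute. (It is used for pairwise commuting `aₙ`.) -/
def qFun (a : ℕ+ → A) (n : ℕ) : A :=
  ∑ k ∈ Finset.range (n + 1), ((k.factorial : K)⁻¹) • PowerSeries.coeff n (xi a ^ k)

/-- `qₙ(a)` for integers `n`, with `qₙ(a) = 0` for `n < 0`. -/
def qInt (a : ℕ+ → A) (n : ℤ) : A := if 0 ≤ n then qFun a n.toNat else 0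

/-- `Hₙ(a, z) = ∑_{k=0}^n zᵏ qₖ(a)`. -/
def hTrunc (n : ℕ) (a : ℕ+ → A) (z : K) : A :=
  ∑ k ∈ Finset.range (n + 1), z ^ k • qFun a k

end QFunctions

/-- The operators `xₙ - (1/n) ∂/∂yₙ` on `ℂ(t)[𝐱, 𝐲]`, i.e. the sequence `𝐱 - ∂̃_𝐲`. -/
def xOp (n : ℕ+) : Module.End K Poly :=
  LinearMap.mulLeft K (xVar n) - ((n : K)⁻¹) • (MvPolynomial.pderiv (Sum.inr n)).toLinearMap

/-- The operators `yₙ - (1/n) ∂/∂xₙ` on `ℂ(t)[𝐱, 𝐲]`, i.e. the sequence `𝐲 - ∂̃_𝐱`. -/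
def yOp (n : ℕ+) : Module.End K Poly :=
  LinearMap.mulLeft K (yVar n) - ((n : K)⁻¹) • (MvPolynomial.pderiv (Sum.inl n)).toLinearMap

/-! ### Coupled Hall-Littlewood functions -/

/-- The expansion of `(1 - R) / (1 - t R)` in powers of `R`. -/
def raisingSeries : PowerSeries K :=
  (1 - PowerSeries.X) * (1 - PowerSeries.C t * PowerSeries.X)⁻¹

/-- The expansion of `(1 - D) (1 - t² D) / (1 - t D)²` in powers of `D`. -/
def couplingSeries : PowerSeries K :=
  (1 - PowerSeries.X) * (1 - PowerSeries.C t * PowerSeries.X)⁻¹ *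
    ((1 - PowerSeries.C (t ^ 2) * PowerSeries.X) * (1 - PowerSeries.C t * PowerSeries.X)⁻¹)

/-- Pairs `i < j` of row indices. -/
abbrev RowPair (l : ℕ) : Type := {p : Fin l × Fin l // p.1 < p.2}

/-- The effect of `∏_{i<j} R_{ij}^{a_{ij}}` on an integer vector: each `R_{ij}` adds `1` to entry
`i` and subtracts `1` from entry `j`. -/
def raise {l : ℕ} (a : RowPair l → ℕ) (v : Fin l → ℤ) (k : Fin l) : ℤ :=
  v k + ∑ p : RowPair l, (if p.1.1 = k then (a p : ℤ) else 0)
    - ∑ p : RowPair l, (if p.1.2 = k then (a p : ℤ) else 0)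

/-- The term of the product of raising operators belonging to
`∏_{i<j} R_{λᵢλⱼ}^{a_{ij}} ∏_{i<j} R_{μᵢμⱼ}^{b_{ij}} ∏_{i,j} D_{λᵢμⱼ}^{d_{ij}}`, applied to
`q_{[λ,μ]}(𝐱, 𝐲) = ∏ᵢ q_{λᵢ}(𝐱) ∏ⱼ q_{μⱼ}(𝐲)`. The operator `D_{λᵢμⱼ}` subtracts `1` from
`λᵢ` and from `μⱼ`. -/
def couplingTerm {l m : ℕ} (v : Fin l → ℤ) (w : Fin m → ℤ)
    (e : (RowPair l → ℕ) × (RowPair m → ℕ) × (Fin l × Fin m → ℕ)) : Poly :=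
  ((∏ p, PowerSeries.coeff (e.1 p) raisingSeries) *
    (∏ p, PowerSeries.coeff (e.2.1 p) raisingSeries) *
    (∏ p, PowerSeries.coeff (e.2.2 p) couplingSeries)) •
  ((∏ i, qInt xVar (raise e.1 v i - ∑ j, (e.2.2 (i, j) : ℤ))) *
    (∏ j, qInt yVar (raise e.2.1 w j - ∑ i, (e.2.2 (i, j) : ℤ))))

theorem sum_raise_ge {l : ℕ} (a : RowPair l → ℕ) (v : Fin l → ℤ) (p : RowPair l) :
    ∑ k ∈ Finset.univ.filter (fun k => p.1.2 ≤ k), raise a v k ≤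
      (∑ k ∈ Finset.univ.filter (fun k => p.1.2 ≤ k), v k) - a p := by
  unfold raise
  rw [Finset.sum_sub_distrib, Finset.sum_add_distrib,
    Finset.sum_comm (s := Finset.univ.filter (fun k => p.1.2 ≤ k)),
    Finset.sum_comm (s := Finset.univ.filter (fun k => p.1.2 ≤ k))]
  simp only [Finset.sum_ite_eq, Finset.mem_filter, Finset.mem_univ, true_and]
  rw [add_sub_assoc, ← Finset.sum_sub_distrib, sub_eq_add_neg]
  gcongr
  rw [← Finset.add_sum_erase _ _ (Finset.mem_univ p)]
  have h1 : ¬ p.1.2 ≤ p.1.1 := not_le.2 p.2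
  have h2 : ∑ r ∈ Finset.univ.erase p, ((if p.1.2 ≤ r.1.1 then (a r : ℤ) else 0) -
      if p.1.2 ≤ r.1.2 then (a r : ℤ) else 0) ≤ 0 := by
    refine Finset.sum_nonpos fun r _ => ?_
    have := r.2
    split_ifs with h3 h4
    · simp
    · exact absurd (h3.trans this.le) h4
    · simp
    · simp
  simp only [h1, if_false, le_refl, if_true]
  linarith

theorem le_of_raise_nonneg {l : ℕ} (a : RowPair l → ℕ) (v c : Fin l → ℤ) (hv : ∀ k, 0 ≤ v k)
    (hc : ∀ k, 0 ≤ c k) (h : ∀ k, 0 ≤ raise a v k - c k) (p : RowPair l) :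
    (a p : ℤ) ≤ ∑ k, v k := by
  have h1 := sum_raise_ge a v p
  have h2 : 0 ≤ ∑ k ∈ Finset.univ.filter (fun k => p.1.2 ≤ k), raise a v k :=
    Finset.sum_nonneg fun k _ => by linarith [h k, hc k]
  have h3 : ∑ k ∈ Finset.univ.filter (fun k => p.1.2 ≤ k), v k ≤ ∑ k, v k :=
    Finset.sum_le_sum_of_subset_of_nonneg (Finset.filter_subset _ _) fun k _ _ => hv k
  linarith

theorem sum_raise {l : ℕ} (a : RowPair l → ℕ) (v : Fin l → ℤ) :
    ∑ k, raise a v k = ∑ k, v k := by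
  unfold raise
  rw [Finset.sum_sub_distrib, Finset.sum_add_distrib]
  have h1 : ∑ k, ∑ p : RowPair l, (if p.1.1 = k then (a p : ℤ) else 0) = ∑ p, (a p : ℤ) := by
    rw [Finset.sum_comm]
    simp
  have h2 : ∑ k, ∑ p : RowPair l, (if p.1.2 = k then (a p : ℤ) else 0) = ∑ p, (a p : ℤ) := by
    rw [Finset.sum_comm]
    simp
  rw [h1, h2]
  ring

theorem finite_support_couplingTerm {l m : ℕ} (v : Fin l → ℤ) (w : Fin m → ℤ)
    (hv : ∀ i, 0 ≤ v i) (hw : ∀ j, 0 ≤ w j) :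
    (Function.support (couplingTerm v w)).Finite := by
  refine ((Set.finite_Iic fun _ => (∑ i, v i).toNat).prod
    ((Set.finite_Iic fun _ => (∑ j, w j).toNat).prod
      (Set.finite_Iic fun _ => (∑ i, v i).toNat))).subset ?_
  rintro ⟨a, b, d⟩ he
  have hx : ∀ i, 0 ≤ raise a v i - ∑ j, (d (i, j) : ℤ) := by
    intro i
    by_contra hi
    exact he (by
      rw [couplingTerm, Finset.prod_eq_zero (Finset.mem_univ i) (if_neg hi)]
      simp)
  have hy : ∀ j, 0 ≤ raise b w j - ∑ i, (d (i, j) : ℤ) := by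
    intro j
    by_contra hj
    exact he (by
      rw [couplingTerm, Finset.prod_eq_zero (Finset.mem_univ j) (if_neg hj)]
      simp)
  have ha := le_of_raise_nonneg a v _ hv (fun i => Finset.sum_nonneg fun j _ => by positivity) hx
  have hb := le_of_raise_nonneg b w _ hw (fun i => Finset.sum_nonneg fun j _ => by positivity) hy
  refine ⟨fun p => ?_, fun p => ?_, fun p => ?_⟩
  · have := ha p
    change a p ≤ (∑ i, v i).toNat
    omega
  · have := hb p
    change b p ≤ (∑ j, w j).toNat
    omega
  · obtain ⟨i, j⟩ := p
    have h1 : (d (i, j) : ℤ) ≤ ∑ j, (d (i, j) : ℤ) :=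
      Finset.single_le_sum (f := fun j => (d (i, j) : ℤ)) (fun _ _ => by positivity)
        (Finset.mem_univ j)
    have h2 : raise a v i - ∑ j, (d (i, j) : ℤ) ≤ ∑ i, (raise a v i - ∑ j, (d (i, j) : ℤ)) :=
      Finset.single_le_sum (f := fun i => raise a v i - ∑ j, (d (i, j) : ℤ)) (fun i _ => hx i)
        (Finset.mem_univ i)
    have h3 : ∑ j, (d (i, j) : ℤ) ≤ ∑ i, ∑ j, (d (i, j) : ℤ) :=
      Finset.single_le_sum (f := fun i => ∑ j, (d (i, j) : ℤ))
        (fun i _ => Finset.sum_nonneg fun j _ => by positivity) (Finset.mem_univ i)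
    have h4 : 0 ≤ ∑ i, (raise a v i - ∑ j, (d (i, j) : ℤ)) := Finset.sum_nonneg fun i _ => hx i
    rw [Finset.sum_sub_distrib, sum_raise] at h4
    change d (i, j) ≤ (∑ i, v i).toNat
    omega

/-- The coupled Hall-Littlewood function
`Q_{[λ,μ]}(𝐱, 𝐲) = ∏_{i<j} (1 - R_{λᵢλⱼ})/(1 - t R_{λᵢλⱼ}) ∏_{i<j} (1 - R_{μᵢμⱼ})/(1 - t R_{μᵢμⱼ})
  ∏_{i,j} (1 - D_{λᵢμⱼ})(1 - t² D_{λᵢμⱼ})/(1 - t D_{λᵢμⱼ})² q_{[λ,μ]}(𝐱, 𝐲)`.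
Only finitely many terms are nonzero, see `finite_support_couplingTerm`. -/
def coupledQ (lam mu : YoungDiagram) : Poly :=
  ∑ᶠ e, couplingTerm (fun i : Fin (lam.colLen 0) => (lam.rowLen i : ℤ))
    (fun j : Fin (mu.colLen 0) => (mu.rowLen j : ℤ)) e

/-- The subspace `ℂ(t)_{M₁,M₂}[𝐱, 𝐲]` spanned by the `Q_{[λ,μ]}` where `λ` has at most `M₁` and
`μ` at most `M₂` columns. -/
def boxSpace (M₁ M₂ : ℕ) : Submodule K Poly :=
  Submodule.span K {f | ∃ lam mu : YoungDiagram,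
    (lam.rowLen 0 ≤ M₁ ∧ mu.rowLen 0 ≤ M₂) ∧ f = coupledQ lam mu}

/-- The subspace spanned by all the other `Q_{[λ,μ]}`. -/
def tailSpace (M₁ M₂ : ℕ) : Submodule K Poly :=
  Submodule.span K {f | ∃ lam mu : YoungDiagram,
    ¬ (lam.rowLen 0 ≤ M₁ ∧ mu.rowLen 0 ≤ M₂) ∧ f = coupledQ lam mu}

/-! ### The two-site generalized `q`-boson model -/

/-- The Fock space of the `q`-boson algebra; `Finsupp.single n 1` is the state `|n⟩`. -/
abbrev Fock : Type := ℕ →₀ K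

/-- `B† |n⟩ = |n + 1⟩`. -/
def fockCreate : Module.End K Fock :=
  Finsupp.linearCombination K fun n => Finsupp.single (n + 1) (1 : K)

/-- `B |n⟩ = [n] |n - 1⟩` with `[n] = (1 - qⁿ) / (1 - q)`, `q = t`; in particular `B |0⟩ = 0`. -/
def fockAnnihilate : Module.End K Fock :=
  Finsupp.linearCombination K fun n => Finsupp.single (n - 1) ((1 - t ^ n) / (1 - t))

/-- The tensor product of `M + 1` copies of the Fock space, with sites `0, …, M`. -/
abbrev FockChain (M : ℕ) : Type := ⨂[K] _ : Fin (M + 1), Fock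

/-- The operator acting as `f` at site `i` and identically at the other sites. -/
def siteOp {M : ℕ} (i : Fin (M + 1)) (f : Module.End K Fock) : Module.End K (FockChain M) :=
  PiTensorProduct.map (Function.update (fun _ => LinearMap.id) i f)

/-- The state space `ℱ = ℱ⁽¹⁾ ⊗ ℱ⁽²⁾` of the two-site generalized model. -/
abbrev TwoSite (M₁ M₂ : ℕ) : Type := FockChain M₁ ⊗[K] FockChain M₂

/-- The `L`-matrix `((u⁻¹, B†), ((1 - q) B, u))`, `q = t`, with entries in an algebra of
operators. -/
def lMatrix {A : Type*} [Semiring A] [Algebra K A] (u : K) (Bdag B : A) : Matrix (Fin 2) (Fin 2) A :=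
  !![algebraMap K A u⁻¹, Bdag; (1 - t) • B, algebraMap K A u]

/-- `T₁(u) = L⁽¹⁾_{M₁}(u) ⋯ L⁽¹⁾₀(u)`, acting on the first tensor factor. -/
def monodromy₁ (M₁ M₂ : ℕ) (u : K) : Matrix (Fin 2) (Fin 2) (Module.End K (TwoSite M₁ M₂)) :=
  ((List.finRange (M₁ + 1)).reverse.map fun i =>
    lMatrix (A := Module.End K (TwoSite M₁ M₂)) u
      (LinearMap.rTensor (FockChain M₂) (siteOp i fockCreate))
      (LinearMap.rTensor (FockChain M₂) (siteOp i fockAnnihilate))).prod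

/-- `T₂(u) = L⁽²⁾_{M₂}(u) ⋯ L⁽²⁾₀(u)`, acting on the second tensor factor. -/
def monodromy₂ (M₁ M₂ : ℕ) (u : K) : Matrix (Fin 2) (Fin 2) (Module.End K (TwoSite M₁ M₂)) :=
  ((List.finRange (M₂ + 1)).reverse.map fun i =>
    lMatrix (A := Module.End K (TwoSite M₁ M₂)) u
      (LinearMap.lTensor (FockChain M₁) (siteOp i fockCreate))
      (LinearMap.lTensor (FockChain M₁) (siteOp i fockAnnihilate))).prod

/-- `B̃₁(u) = u^{M₁} B₁(u)`, where `B₁(u)` is the upper right entry of `T₁(u)`. -/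
def tildeB₁ (M₁ M₂ : ℕ) (u : K) : Module.End K (TwoSite M₁ M₂) :=
  u ^ M₁ • monodromy₁ M₁ M₂ u 0 1

/-- `B̃₂(u) = u^{M₂} B₂(u)`, where `B₂(u)` is the upper right entry of `T₂(u)`. -/
def tildeB₂ (M₁ M₂ : ℕ) (u : K) : Module.End K (TwoSite M₁ M₂) :=
  u ^ M₂ • monodromy₂ M₁ M₂ u 0 1

/-! ### The map from states to coupled Hall-Littlewood functions -/

/-- The multiset of parts of the partition `1^{n₁} 2^{n₂} ⋯ M^{n_M}`; `n₀` is not used. -/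
def parts {M : ℕ} (n : Fin (M + 1) → ℕ) : Multiset ℕ :=
  ∑ i : Fin M, Multiset.replicate (n i.succ) ((i : ℕ) + 1)

/-- The Young diagram of the partition `1^{n₁} 2^{n₂} ⋯ M^{n_M}`. -/
def stateDiagram {M : ℕ} (n : Fin (M + 1) → ℕ) : YoungDiagram :=
  YoungDiagram.ofRowLens ((parts n).sort (· ≥ ·)) (Multiset.pairwise_sort _ _).sortedGE

/-- The basis of `ℱ` formed by the states `⨂ᵢ |nᵢ⟩ᵢ⁽¹⁾ ⊗ ⨂ᵢ |mᵢ⟩ᵢ⁽²⁾`. -/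
def stateBasis (M₁ M₂ : ℕ) :
    Module.Basis ((Fin (M₁ + 1) → ℕ) × (Fin (M₂ + 1) → ℕ)) K (TwoSite M₁ M₂) :=
  (Basis.piTensorProduct fun _ => Finsupp.basisSingleOne).tensorProduct
    (Basis.piTensorProduct fun _ => Finsupp.basisSingleOne)

theorem stateBasis_apply (M₁ M₂ : ℕ) (n : Fin (M₁ + 1) → ℕ) (m : Fin (M₂ + 1) → ℕ) :
    stateBasis M₁ M₂ (n, m) =
      (⨂ₜ[K] i, Finsupp.single (n i) (1 : K)) ⊗ₜ[K] (⨂ₜ[K] i, Finsupp.single (m i) (1 : K)) := by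
  simp [stateBasis, Module.Basis.tensorProduct_apply]

/-- The linear map `ȷ : ℱ → ℂ(t)[𝐱, 𝐲]` with
`ȷ(⨂ᵢ |nᵢ⟩ᵢ⁽¹⁾ ⊗ ⨂ᵢ |mᵢ⟩ᵢ⁽²⁾) = Q_{[λ,μ]}`, `λ = 1^{n₁} 2^{n₂} ⋯`, `μ = 1^{m₁} 2^{m₂} ⋯`. -/
def jMap (M₁ M₂ : ℕ) : TwoSite M₁ M₂ →ₗ[K] Poly :=
  (stateBasis M₁ M₂).constr K fun s => coupledQ (stateDiagram s.1) (stateDiagram s.2)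

end CoupledHL

end

noncomputable section

namespace CoupledHL

/-! ### The series `∑ qₙ(a) zⁿ` -/

/-! The coupling is a change of variables that carries the two-site statement back to a single
chain. The operators `xOp` and `yOp` all commute with each other, so any polynomial f(𝐱, 𝐲) can be
evaluated at them and applied to 1; call this map `coupling`. The operator q_r(𝐱 - ∂̃_𝐲) applied to
`coupling g` is then `coupling` of q_r(𝐱) g (`coupling_mul`). Moreover Q_{[λ,μ]} is `coupling` of
the ordinary product Q_λ(𝐱) Q_μ(𝐲) (`coupledQ_eq`). The reason is that moving q_r(𝐱 - ∂̃_𝐲) past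
q_n(𝐲) produces exp(-∑ (1-tⁿ)² Zⁿ/n) = (1-Z)(1-t²Z)/(1-tZ)², which is the factor defining the
D-operators.

It remains to multiply Q_λ(𝐱) by q_r(𝐱) modulo partitions with more than M columns. Here Q_λ is an
iterated product of vertex operators Γ applied to 1 (`hallQ_expansion`). The Γ's satisfy quadratic
relations (`vertex_antisymm`, `vertex_straighten`) and a commutation rule with q_r
(`qX_mul_vertex`). Adding the parts of λ from the smallest upwards yields a recursion for a pair of
sequences A, C, where A is the part of the product with at most k columns and C records what is
prefixed by Γ of larger index (`IsPieri`, `pieriPair`). Passing from columns ≤ k to columns ≤ k+1 is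
the action of one L-matrix on the vector of entries 01 and 11 of the monodromy matrix: 1-t^m is the
matrix element of (1-q)B, an extra Γ_{k+1} is B†, and shifting the sequences by one is
multiplication by u². Hence the entry 01 of the monodromy matrix is the generating function of the
A_r (`chainMap_chainMonodromy`), and the error lies in the span of the Q_λ with too many columns
(`qX_mul_hallQ_sub_mem`).

The complement statement follows because the Q_{[λ,μ]} form a basis: they are unitriangular with
respect to the products q_λ(𝐱) q_μ(𝐲). Raising operators keep the degree and increase the sum of
squares of the indices, while the D-operators lower the degree (`couplingTerm_mem_span`). -/

theorem t_pow_ne_one {n : ℕ} (hn : 0 < n) : (1 : K) - t ^ n ≠ 0 := by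
  intro h
  have h1 : (RatFunc.X : RatFunc ℂ) ^ n = 1 := (sub_eq_zero.1 h).symm
  rw [← RatFunc.algebraMap_X, ← map_pow, ← map_one (algebraMap (Polynomial ℂ) (RatFunc ℂ))] at h1
  have h2 := RatFunc.algebraMap_injective ℂ h1
  have h3 := congrArg Polynomial.natDegree h2
  simp at h3
  omega

section Naturality

variable {A B : Type*} [Ring A] [Algebra K A] [Ring B] [Algebra K B]

theorem map_xi (φ : A →ₐ[K] B) (a : ℕ+ → A) :
    PowerSeries.map (φ : A →+* B) (xi a) = xi fun n => φ (a n) := by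
  ext n
  simp only [PowerSeries.coeff_map, xi, PowerSeries.coeff_mk]
  split_ifs <;> simp

theorem map_qFun (φ : A →ₐ[K] B) (a : ℕ+ → A) (n : ℕ) :
    φ (qFun a n) = qFun (fun n => φ (a n)) n := by
  unfold qFun
  rw [map_sum]
  refine Finset.sum_congr rfl fun k _ => ?_
  rw [map_smul, ← map_xi, ← map_pow, PowerSeries.coeff_map]
  rfl

theorem map_qInt (φ : A →ₐ[K] B) (a : ℕ+ → A) (n : ℤ) :
    φ (qInt a n) = qInt (fun n => φ (a n)) n := by
  unfold qInt
  split_ifs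
  · exact map_qFun φ a _
  · simp

theorem qFun_zero (a : ℕ+ → A) : qFun a 0 = 1 := by
  simp [qFun]

theorem qInt_of_neg (a : ℕ+ → A) {n : ℤ} (hn : n < 0) : qInt a n = 0 :=
  if_neg (not_le.2 hn)

theorem qInt_natCast (a : ℕ+ → A) (n : ℕ) : qInt a n = qFun a n := by
  simp [qInt]

end Naturality

section Series

open PowerSeries

variable {A : Type*} [CommRing A] [Algebra K A]

/-- The generating series `∑ qₙ(a) zⁿ`. -/
def qSeries (a : ℕ+ → A) : PowerSeries A := PowerSeries.mk (qFun a)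

theorem coeff_xi_pow_eq_zero (a : ℕ+ → A) {n k : ℕ} (h : n < k) : coeff n (xi a ^ k) = 0 := by
  refine coeff_of_lt_order _ ?_
  have h1 : (1 : ℕ∞) ≤ (xi a).order := by
    refine le_order _ _ fun i hi => ?_
    have : i = 0 := by
      have : i < 1 := by exact_mod_cast hi
      omega
    subst this
    simp [xi]
  have h2 : (k : ℕ∞) ≤ (xi a ^ k).order := by
    refine le_trans ?_ (le_order_pow (φ := xi a) k)
    calc (k : ℕ∞) = k • (1 : ℕ∞) := by simp
      _ ≤ k • (xi a).order := nsmul_le_nsmul_right h1 k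
  exact lt_of_lt_of_le (by exact_mod_cast h) h2

theorem qFun_eq_sum_range (a : ℕ+ → A) {n N : ℕ} (h : n < N) :
    qFun a n = ∑ k ∈ Finset.range N, ((k.factorial : K)⁻¹) • coeff n (xi a ^ k) := by
  unfold qFun
  refine Finset.sum_subset (fun k hk => ?_) fun k _ hk => ?_
  · simp only [Finset.mem_range] at hk ⊢
    omega
  · simp only [Finset.mem_range] at hk
    rw [coeff_xi_pow_eq_zero a (by omega), smul_zero]

/-- The exponential satisfies G' = ξ'G. Since ξ has no constant term, each coefficient involves
finitely many powers of ξ, and the series may be differentiated term by term. -/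
theorem derivative_qSeries (a : ℕ+ → A) :
    d⁄dX A (qSeries a) = d⁄dX A (xi a) * qSeries a := by
  ext n
  have h1 : coeff n (d⁄dX A (qSeries a)) = ∑ k ∈ Finset.range (n + 2),
      ((k.factorial : K)⁻¹) • coeff n (d⁄dX A (xi a ^ k)) := by
    rw [coeff_derivative, qSeries, coeff_mk, qFun, Finset.sum_mul]
    simp only [coeff_derivative, smul_mul_assoc]
  have h2 : ∀ k : ℕ, (((k + 1).factorial : K)⁻¹) • coeff n (d⁄dX A (xi a ^ (k + 1))) =
      ((k.factorial : K)⁻¹) • coeff n (d⁄dX A (xi a) * xi a ^ k) := by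
    intro k
    have h3 : d⁄dX A (xi a ^ (k + 1)) = ((k : K) + 1) • (d⁄dX A (xi a) * xi a ^ k) := by
      rw [derivative_pow, Algebra.smul_def]
      have : algebraMap K (PowerSeries A) ((k : K) + 1) = ((k + 1 : ℕ) : PowerSeries A) := by
        simp
      rw [this, Nat.add_sub_cancel]
      ring
    rw [h3, coeff_smul, smul_smul, Nat.factorial_succ]
    congr 1
    have : (k : K) + 1 ≠ 0 := by exact_mod_cast Nat.succ_ne_zero k
    have : (k.factorial : K) ≠ 0 := by exact_mod_cast Nat.factorial_ne_zero k
    push_cast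
    field_simp
  rw [h1, Finset.sum_range_succ']
  simp only [h2]
  simp only [pow_zero, Nat.factorial_zero, Nat.cast_one, inv_one, one_smul]
  rw [show d⁄dX A (1 : PowerSeries A) = 0 by simp, map_zero, add_zero, coeff_mul]
  simp only [coeff_mul, Finset.smul_sum]
  rw [Finset.sum_comm]
  refine Finset.sum_congr rfl fun p hp => ?_
  have := Finset.HasAntidiagonal.mem_antidiagonal.1 hp
  rw [qSeries, coeff_mk, qFun_eq_sum_range a (show p.2 < n + 1 by omega), Finset.mul_sum]
  simp only [mul_smul_comm]

/-- In characteristic zero the equation G' = ξ'G determines the coefficients recursively from the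
constant term. This uniqueness replaces all manipulation of exponentials and logarithms below. -/
theorem eq_qSeries (a : ℕ+ → A) (G : PowerSeries A) (h0 : constantCoeff G = 1)
    (h : d⁄dX A G = d⁄dX A (xi a) * G) : G = qSeries a := by
  ext n
  induction n using Nat.strong_induction_on with
  | _ n ih =>
    cases n with
    | zero => simpa [qSeries, qFun_zero] using h0
    | succ n =>
      have h1 : coeff n (d⁄dX A G) = coeff n (d⁄dX A (qSeries a)) := by
        rw [h, derivative_qSeries, coeff_mul, coeff_mul]
        refine Finset.sum_congr rfl fun p hp => ?_
        have := Finset.HasAntidiagonal.mem_antidiagonal.1 hp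
        rw [ih p.2 (by omega)]
      rw [coeff_derivative, coeff_derivative] at h1
      have h2 : ∀ x : A, x * ((n : A) + 1) = ((n : K) + 1) • x := by
        intro x
        rw [Algebra.smul_def, mul_comm]
        simp
      rw [h2, h2] at h1
      have h3 : (n : K) + 1 ≠ 0 := by exact_mod_cast Nat.succ_ne_zero n
      have := congrArg (fun x => ((n : K) + 1)⁻¹ • x) h1
      simpa [smul_smul, h3] using this

theorem xi_add (a b : ℕ+ → A) : xi (fun n => a n + b n) = xi a + xi b := by
  ext n
  simp only [xi, coeff_mk, map_add]
  split_ifs <;> simp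

theorem qSeries_add (a b : ℕ+ → A) : qSeries (fun n => a n + b n) = qSeries a * qSeries b := by
  symm
  apply eq_qSeries
  · simp [qSeries, qFun_zero]
  · rw [Derivation.leibniz, derivative_qSeries, derivative_qSeries, xi_add, map_add]
    simp only [smul_eq_mul]
    ring

theorem qFun_add (a b : ℕ+ → A) (n : ℕ) :
    qFun (fun n => a n + b n) n = ∑ p ∈ Finset.HasAntidiagonal.antidiagonal n, qFun a p.1 * qFun b p.2 := by
  have := congrArg (coeff n) (qSeries_add a b)
  simpa [qSeries, coeff_mul] using this

/-- Newton's identity for the `qₙ`. -/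
theorem newton_qFun (a : ℕ+ → A) (n : ℕ) :
    ((n : K) + 1) • qFun a (n + 1) = ∑ p ∈ Finset.HasAntidiagonal.antidiagonal n,
      (((p.1 : K) + 1) * (1 - t ^ (p.1 + 1))) • (a p.1.succPNat * qFun a p.2) := by
  have h := congrArg (coeff n) (derivative_qSeries a)
  rw [coeff_derivative, coeff_mul] at h
  have h2 : ∀ (n : ℕ) (x : A), x * ((n : A) + 1) = ((n : K) + 1) • x := by
    intro n x
    rw [Algebra.smul_def, mul_comm]
    simp
  simp only [qSeries, coeff_mk, h2, coeff_derivative, xi] at h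
  rw [h]
  refine Finset.sum_congr rfl fun p _ => ?_
  rw [dif_pos p.1.succ_pos, smul_smul, smul_mul_assoc]
  rfl

/-! ### Closed forms of the exponentials behind the R- and D-operators -/

omit [Algebra K A] in
theorem mk_pow_mul (c : A) : PowerSeries.mk (fun n => c ^ n) * (1 - C c * X) = 1 := by
  ext n
  rw [mul_sub, mul_one, map_sub, mul_left_comm, coeff_C_mul]
  cases n with
  | zero => simp
  | succ n => simp [coeff_succ_mul_X, coeff_one, pow_succ']

/-- For aₙ = -cⁿ/n the exponent is log(1-cz) - log(1-tcz), so the series is (1-cz)/(1-tcz); the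
denominator is cleared because A is an arbitrary algebra. -/
theorem qSeries_geometric_mul (c : A) :
    qSeries (fun n : ℕ+ => (-((n : ℕ) : K)⁻¹) • c ^ (n : ℕ)) * (1 - C (t • c) * X) =
      1 - C c * X := by
  set P : PowerSeries A := PowerSeries.mk (fun n => c ^ n) with hP
  set H : PowerSeries A := PowerSeries.mk (fun n => (t • c) ^ n) with hH
  have h1 : P * (1 - C c * X) = 1 := mk_pow_mul c
  have h2 : H * (1 - C (t • c) * X) = 1 := mk_pow_mul _
  have hxi : d⁄dX A (xi (fun n : ℕ+ => (-((n : ℕ) : K)⁻¹) • c ^ (n : ℕ))) =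
      - (C c * P) + C (t • c) * H := by
    ext n
    rw [coeff_derivative, xi, coeff_mk, dif_pos n.succ_pos, map_add, map_neg, coeff_C_mul,
      coeff_C_mul, hP, hH, coeff_mk, coeff_mk]
    have h3 : (n : K) + 1 ≠ 0 := by exact_mod_cast Nat.succ_ne_zero n
    have h4 : ((n : A) + 1) = algebraMap K A ((n : K) + 1) := by simp
    rw [h4, mul_comm, ← Algebra.smul_def, ← pow_succ', ← pow_succ', smul_pow, smul_smul, smul_smul,
      PNat.mk_coe]
    have h5 : ((n : K) + 1) * (1 - t ^ (n + 1)) * (-(((n + 1 : ℕ) : K))⁻¹) =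
        -1 + t ^ (n + 1) := by
      push_cast
      field_simp
      ring
    rw [h5, add_smul, neg_one_smul]
  have hH' : d⁄dX A H = C (t • c) * H * H := by
    have h3 := congrArg (d⁄dX A) h2
    rw [Derivation.leibniz] at h3
    simp only [smul_eq_mul, map_sub, Derivation.leibniz, derivative_C, derivative_X] at h3
    simp only [Derivation.map_one_eq_zero, mul_one] at h3
    linear_combination H * h3 - (d⁄dX A H) * h2
  have hG : (1 - C c * X) * H = qSeries (fun n : ℕ+ => (-((n : ℕ) : K)⁻¹) • c ^ (n : ℕ)) := by
    apply eq_qSeries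
    · simp [hH]
    · rw [hxi, Derivation.leibniz, hH']
      simp only [smul_eq_mul, map_sub, Derivation.leibniz, derivative_C, derivative_X]
      simp only [Derivation.map_one_eq_zero, mul_one]
      linear_combination (C c * H) * h1
  rw [← hG, mul_assoc, h2, mul_one]

theorem raisingSeries_mul : raisingSeries * (1 - C t * X) = 1 - X := by
  rw [raisingSeries, mul_assoc, PowerSeries.inv_mul_cancel, mul_one]
  simp

theorem couplingSeries_mul :
    couplingSeries * ((1 - C t * X) * (1 - C t * X)) = (1 - X) * (1 - C (t ^ 2) * X) := by
  have h : (1 - C t * X : PowerSeries K)⁻¹ * (1 - C t * X) = 1 := by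
    apply PowerSeries.inv_mul_cancel
    simp
  rw [couplingSeries]
  linear_combination ((1 - X) * (1 - C (t ^ 2) * X) *
    ((1 - C t * X : PowerSeries K)⁻¹ * (1 - C t * X) + 1)) * h

theorem coeff_zero_raisingSeries : coeff 0 raisingSeries = 1 := by
  simp [raisingSeries]

theorem coeff_zero_couplingSeries : coeff 0 couplingSeries = 1 := by
  simp [couplingSeries]

/-- The series `f(c z)` over a `ℂ(t)`-algebra. -/
def scaled (c : A) : PowerSeries K →+* PowerSeries A :=
  (rescale c).comp (PowerSeries.map (algebraMap K A))

theorem coeff_scaled (c : A) (f : PowerSeries K) (n : ℕ) :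
    coeff n (scaled c f) = coeff n f • c ^ n := by
  simp [scaled, coeff_rescale, Algebra.smul_def, mul_comm]

theorem scaled_one_sub (c : A) (r : K) : scaled c (1 - C r * X) = 1 - C (r • c) * X := by
  ext n
  rw [coeff_scaled]
  simp only [map_sub, coeff_C_mul, coeff_X, coeff_one, sub_smul]
  rcases n with _ | _ | n <;> simp

omit [Algebra K A] in
theorem isUnit_one_sub (c : A) : IsUnit (1 - C c * X : PowerSeries A) :=
  IsUnit.of_mul_eq_one _ ((mul_comm _ _).trans (mk_pow_mul c))

theorem qSeries_raising (c : A) :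
    qSeries (fun n : ℕ+ => (-((n : ℕ) : K)⁻¹) • c ^ (n : ℕ)) = scaled c raisingSeries := by
  apply (isUnit_one_sub (t • c)).mul_right_cancel
  have h := congrArg (scaled c) raisingSeries_mul
  have h1 := scaled_one_sub c 1
  simp only [map_one, one_mul, one_smul] at h1
  rw [map_mul, scaled_one_sub, h1] at h
  rw [qSeries_geometric_mul, h]

/-- The exponent is -∑ (1-tⁿ)² cⁿzⁿ/n. Splitting off one factor 1-tⁿ writes the series as F(c)/F(tc)
with F(c) = (1-cz)/(1-tcz), and this quotient is (1-cz)(1-t²cz)/(1-tcz)². -/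
theorem qSeries_coupling (c : A) :
    qSeries (fun n : ℕ+ => (-((1 - t ^ (n : ℕ)) / ((n : ℕ) : K))) • c ^ (n : ℕ)) =
      scaled c couplingSeries := by
  have h1 : qSeries (fun n : ℕ+ => (-((1 - t ^ (n : ℕ)) / ((n : ℕ) : K))) • c ^ (n : ℕ)) *
      qSeries (fun n : ℕ+ => (-((n : ℕ) : K)⁻¹) • (t • c) ^ (n : ℕ)) =
      qSeries (fun n : ℕ+ => (-((n : ℕ) : K)⁻¹) • c ^ (n : ℕ)) := by
    rw [← qSeries_add]
    congr 1
    ext n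
    rw [smul_pow, smul_smul, ← add_smul]
    congr 1
    ring
  have h2 := qSeries_geometric_mul c
  have h3 := qSeries_geometric_mul (t • c)
  have h := congrArg (scaled c) couplingSeries_mul
  have h4 := scaled_one_sub c 1
  simp only [map_one, one_mul, one_smul] at h4
  rw [map_mul, map_mul, map_mul, scaled_one_sub, scaled_one_sub, h4] at h
  rw [smul_smul, ← sq] at h3
  apply ((isUnit_one_sub (t • c)).mul (isUnit_one_sub (t • c))).mul_right_cancel
  rw [h, ← h2, ← h1]
  linear_combination (-qSeries (fun n : ℕ+ => (-((1 - t ^ (n : ℕ)) / ((n : ℕ) : K))) • c ^ (n : ℕ)) *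
    (1 - C (t • c) * X)) * h3

end Series

/-! ### Vertex operators on `ℂ(t)[𝐱]` -/

section Pairing

open Polynomial

variable {A : Type*} [CommRing A]

/-- The functional `∑ᵢ cᵢ Zⁱ ↦ ∑ᵢ gᵢ cᵢ`. -/
def pair (g : ℕ → A) : A[X] →ₗ[A] A := Polynomial.lsum fun i => g i • LinearMap.id

theorem pair_monomial (g : ℕ → A) (i : ℕ) (c : A) : pair g (monomial i c) = g i * c := by
  rw [pair, lsum_apply, sum_monomial_index]
  · simp
  · simp

theorem pair_C_mul (g : ℕ → A) (a : A) (P : A[X]) : pair g (C a * P) = a * pair g P := by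
  rw [← smul_eq_C_mul, map_smul, smul_eq_mul]

theorem pair_X_mul (g : ℕ → A) (P : A[X]) : pair g (X * P) = pair (fun i => g (i + 1)) P := by
  induction P using Polynomial.induction_on' with
  | add p q hp hq => rw [mul_add, map_add, map_add, hp, hq]
  | monomial n a => rw [X_mul_monomial, pair_monomial, pair_monomial]

theorem pair_eq_sum_range (g : ℕ → A) (P : A[X]) {N : ℕ} (h : ∀ i, N ≤ i → P.coeff i = 0) :
    pair g P = ∑ i ∈ Finset.range N, g i * P.coeff i := by
  have h1 : P = ∑ i ∈ Finset.range N, monomial i (P.coeff i) := by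
    ext j
    simp only [finsetSum_coeff, coeff_monomial, Finset.sum_ite_eq', Finset.mem_range]
    split_ifs with hj
    · rfl
    · exact h j (not_lt.1 hj)
  conv_lhs => rw [h1]
  simp only [map_sum, pair_monomial]

end Pairing

/-- The algebra `ℂ(t)[𝐱]`. -/
abbrev Lam : Type := MvPolynomial ℕ+ K

/-- `qₙ(𝐱)` for integers `n`. -/
def qX (n : ℤ) : Lam := qInt (MvPolynomial.X : ℕ+ → Lam) n

theorem qX_of_neg {n : ℤ} (hn : n < 0) : qX n = 0 := qInt_of_neg _ hn

theorem qX_natCast (n : ℕ) : qX n = qFun (MvPolynomial.X : ℕ+ → Lam) n := qInt_natCast _ n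

section Lowering

open Polynomial

/-- The substitution `xₙ ↦ xₙ - Zⁿ/n`. -/
def lowering : Lam →ₐ[K] Lam[X] :=
  MvPolynomial.aeval fun n : ℕ+ =>
    C (MvPolynomial.X n : Lam) + (-((n : ℕ) : K)⁻¹) • (X : Lam[X]) ^ (n : ℕ)

theorem lowering_X (n : ℕ+) : lowering (MvPolynomial.X n) =
    C (MvPolynomial.X n) + monomial n (MvPolynomial.C (-((n : ℕ) : K)⁻¹)) := by
  rw [lowering, MvPolynomial.aeval_X, ← C_mul_X_pow_eq_monomial, ← smul_eq_C_mul,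
    MvPolynomial.C_eq_smul_one, smul_assoc, one_smul]

theorem lowering_qFun (n : ℕ) : lowering (qFun (MvPolynomial.X : ℕ+ → Lam) n) =
    ∑ p ∈ Finset.HasAntidiagonal.antidiagonal n,
      C (qFun MvPolynomial.X p.1) * (PowerSeries.coeff p.2 raisingSeries • X ^ p.2) := by
  rw [map_qFun]
  simp only [lowering, MvPolynomial.aeval_X]
  rw [qFun_add]
  refine Finset.sum_congr rfl fun p _ => ?_
  have h1 := map_qFun (Polynomial.CAlgHom (R := K) (A := Lam)) MvPolynomial.X p.1
  have h2 := congrArg (PowerSeries.coeff p.2) (qSeries_raising (X : Lam[X]))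
  rw [coeff_scaled, qSeries, PowerSeries.coeff_mk] at h2
  rw [h2]
  congr 1
  exact h1.symm

/-- Clearing the denominator 1 - tZz of the raising series leaves a two-term relation, which is what
makes the commutation rules for `vertex` finite. -/
theorem lowering_qFun_succ (n : ℕ) :
    lowering (qFun (MvPolynomial.X : ℕ+ → Lam) (n + 1)) -
      (t • X) * lowering (qFun (MvPolynomial.X : ℕ+ → Lam) n) =
    C (qFun MvPolynomial.X (n + 1)) - X * C (qFun MvPolynomial.X n) := by
  have h1 : qSeries (fun n : ℕ+ => lowering (MvPolynomial.X n)) *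
      (1 - PowerSeries.C (t • (X : Lam[X])) * PowerSeries.X) =
      qSeries (fun n : ℕ+ => C (MvPolynomial.X n : Lam)) *
        (1 - PowerSeries.C (X : Lam[X]) * PowerSeries.X) := by
    simp only [lowering, MvPolynomial.aeval_X]
    rw [qSeries_add, mul_assoc, qSeries_geometric_mul]
  have h2 := congrArg (PowerSeries.coeff (n + 1)) h1
  have h3 := fun k => map_qFun lowering (MvPolynomial.X : ℕ+ → Lam) k
  have h4 := fun k => map_qFun (Polynomial.CAlgHom (R := K) (A := Lam)) MvPolynomial.X k
  simp only [CAlgHom_apply] at h4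
  simp only [mul_sub, mul_one, map_sub, ← mul_assoc, PowerSeries.coeff_succ_mul_X,
    PowerSeries.coeff_mul_C, qSeries, PowerSeries.coeff_mk] at h2
  rw [← h3, ← h3, ← h4, ← h4] at h2
  rw [mul_comm, h2, mul_comm X]

theorem lowering_qX (r : ℤ) :
    lowering (qX r) - (t • X) * lowering (qX (r - 1)) = C (qX r) - X * C (qX (r - 1)) := by
  rcases lt_trichotomy r 0 with h | h | h
  · simp [qX_of_neg h, qX_of_neg (show r - 1 < 0 by omega)]
  · subst h
    have : qX 0 = 1 := by
      have := qX_natCast 0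
      rwa [qFun_zero] at this
    simp [this, qX_of_neg (show (-1 : ℤ) < 0 by omega)]
  · obtain ⟨n, rfl⟩ : ∃ n : ℕ, r = (n + 1 : ℕ) := ⟨(r - 1).toNat, by omega⟩
    have : (((n + 1 : ℕ) : ℤ) - 1) = (n : ℕ) := by push_cast; ring
    rw [this, qX_natCast, qX_natCast]
    exact lowering_qFun_succ n

theorem coeff_coeff_swap (p : Lam[X][X]) (i j : ℕ) :
    ((Bivariate.swap p).coeff i).coeff j = (p.coeff j).coeff i := by
  induction p using Polynomial.induction_on' with
  | add p q hp hq => simp [hp, hq]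
  | monomial n a =>
    induction a using Polynomial.induction_on' with
    | add p q hp hq => simp only [map_add, coeff_add, hp, hq]
    | monomial m a =>
      rw [Bivariate.swap_monomial_monomial]
      simp only [coeff_monomial]
      split_ifs <;> simp_all [coeff_monomial]

/-- Performing the substitution twice, with parameters Z and W, sends xₙ to xₙ - Zⁿ/n - Wⁿ/n. This
is symmetric in Z and W, so the coefficient operators Dᵢ commute. -/
theorem coeff_lowering_comm (f : Lam) (i j : ℕ) :
    (lowering ((lowering f).coeff j)).coeff i = (lowering ((lowering f).coeff i)).coeff j := by
  have h : (((Bivariate.swap (R := Lam)).toAlgHom.restrictScalars K).comp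
      ((Polynomial.mapAlgHom lowering).comp lowering)) =
      (Polynomial.mapAlgHom lowering).comp lowering := by
    apply MvPolynomial.algHom_ext
    intro n
    have h2 : (Polynomial.mapAlgHom lowering) (lowering (MvPolynomial.X n)) =
        monomial 0 (monomial 0 (MvPolynomial.X n)) +
        monomial 0 (monomial n (MvPolynomial.C (-((n : ℕ) : K)⁻¹))) +
        monomial n (monomial 0 (MvPolynomial.C (-((n : ℕ) : K)⁻¹))) := by
      rw [lowering_X, map_add, ← monomial_zero_left]
      simp only [coe_mapAlgHom, map_monomial, RingHom.coe_coe, lowering_X]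
      rw [← MvPolynomial.algebraMap_eq, AlgHom.commutes,
        IsScalarTower.algebraMap_apply K Lam Lam[X], algebraMap_eq, ← monomial_zero_left, map_add]
      simp only [monomial_zero_left]
    simp only [AlgHom.comp_apply, h2, map_add]
    change Bivariate.swap _ + Bivariate.swap _ + Bivariate.swap _ = _
    simp only [Bivariate.swap_monomial_monomial]
    abel
  have h1 : ∀ g : Lam[X], ∀ i, (Polynomial.mapAlgHom lowering g).coeff i =
      lowering (g.coeff i) := fun g i => by simp
  rw [← h1, ← h1, ← coeff_coeff_swap]
  have h2 := DFunLike.congr_fun h f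
  simp only [AlgHom.comp_apply] at h2
  nth_rw 2 [← h2]
  rfl

end Lowering

/-- The vertex operator `Γₙ f = ∑ᵢ q_{n+i} Dᵢ f`, where `∑ᵢ Zⁱ Dᵢ f = f(xₙ - Zⁿ/n)`. -/
def vertex (n : ℤ) : Module.End K Lam :=
  ((pair fun i => qX (n + i)).restrictScalars K).comp lowering.toLinearMap

theorem vertex_apply (n : ℤ) (f : Lam) : vertex n f = pair (fun i => qX (n + i)) (lowering f) :=
  rfl

/-- A factor Z under the pairing raises the index of Γ by one; the rule is `lowering_qX` multiplied
by `lowering f` and paired. -/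
theorem vertex_qX_mul (n r : ℤ) (f : Lam) :
    vertex n (qX r * f) - t • vertex (n + 1) (qX (r - 1) * f) =
      qX r * vertex n f - qX (r - 1) * vertex (n + 1) f := by
  have h := congrArg (fun P => pair (fun i => qX (n + i)) (P * lowering f)) (lowering_qX r)
  simp only [sub_mul, map_sub, pair_C_mul, mul_assoc, smul_mul_assoc, pair_X_mul] at h
  have h1 : (fun i : ℕ => qX (n + ((i + 1 : ℕ) : ℤ))) = fun i : ℕ => qX (n + 1 + i) := by
    funext i
    congr 1
    push_cast
    ring
  have h2 : ∀ P, pair (fun i => qX (n + i)) (t • P) = t • pair (fun i => qX (n + i)) P :=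
    fun P => ((pair fun i => qX (n + i)).restrictScalars K).map_smul t P
  rw [h2, pair_X_mul, h1] at h
  simp only [vertex_apply, map_mul]
  exact h

/-- By `vertex_qX_mul` the left side is ∑ (q_{n+j} q_{m+i} - q_{n+j-1} q_{m+1+i}) DᵢDⱼ f. Replacing
(m, n) by (n-1, m+1) and exchanging i and j changes its sign, as the Dᵢ commute. -/
theorem vertex_antisymm (m n : ℤ) (f : Lam) :
    vertex m (vertex n f) - t • vertex (m + 1) (vertex (n - 1) f) =
      -(vertex (n - 1) (vertex (m + 1) f) - t • vertex n (vertex m f)) := by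
  obtain ⟨N, hN⟩ : ∃ N, ∀ i, N ≤ i → (lowering f).coeff i = 0 :=
    ⟨(lowering f).natDegree + 1, fun i hi => Polynomial.coeff_eq_zero_of_natDegree_lt (by omega)⟩
  have hN' : ∀ j i, N ≤ i → (lowering ((lowering f).coeff j)).coeff i = 0 := by
    intro j i hi
    rw [coeff_lowering_comm, hN i hi]
    simp
  have key : ∀ m n : ℤ, vertex m (vertex n f) - t • vertex (m + 1) (vertex (n - 1) f) =
      ∑ j ∈ Finset.range N, ∑ i ∈ Finset.range N,
        (qX (n + j) * qX (m + i) - qX (n + j - 1) * qX (m + 1 + i)) *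
          (lowering ((lowering f).coeff j)).coeff i := by
    intro m n
    rw [vertex_apply n f, vertex_apply (n - 1) f, pair_eq_sum_range _ _ hN,
      pair_eq_sum_range _ _ hN, map_sum, map_sum, Finset.smul_sum, ← Finset.sum_sub_distrib]
    refine Finset.sum_congr rfl fun j _ => ?_
    rw [show n - 1 + j = n + j - 1 by ring, vertex_qX_mul, vertex_apply, vertex_apply,
      pair_eq_sum_range _ _ (hN' j), pair_eq_sum_range _ _ (hN' j), Finset.mul_sum, Finset.mul_sum,
      ← Finset.sum_sub_distrib]
    refine Finset.sum_congr rfl fun i _ => ?_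
    ring
  have h2 := key (n - 1) (m + 1)
  rw [sub_add_cancel, add_sub_cancel_right] at h2
  rw [key m n, h2, Finset.sum_comm, ← Finset.sum_neg_distrib]
  refine Finset.sum_congr rfl fun j _ => ?_
  rw [← Finset.sum_neg_distrib]
  refine Finset.sum_congr rfl fun i _ => ?_
  rw [coeff_lowering_comm f i j, show n - 1 + (i : ℤ) = n + i - 1 by ring,
    show m + 1 + (j : ℤ) - 1 = m + j by ring]
  ring

/-- Iterating `vertex_qX_mul` in r eliminates the lower term q_{r-1} Γ_{n+1}; each step contributes
a coefficient 1-t. -/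
theorem qX_mul_vertex (n : ℤ) (r : ℕ) (f : Lam) :
    qX r * vertex n f = vertex n (qX r * f) +
      (1 - t) • ∑ a ∈ Finset.range r, vertex (n + r - a) (qX a * f) := by
  induction r generalizing n with
  | zero =>
    have := vertex_qX_mul n 0 f
    rw [qX_of_neg (show (0 : ℤ) - 1 < 0 by norm_num)] at this
    simp at this
    simp [this]
  | succ r ih =>
    have h := vertex_qX_mul n (r + 1 : ℕ) f
    rw [show ((r + 1 : ℕ) : ℤ) - 1 = r by push_cast; ring, ih (n + 1)] at h
    rw [Finset.sum_range_succ, show n + ((r + 1 : ℕ) : ℤ) - r = n + 1 by push_cast; ring]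
    simp only [show ∀ a : ℕ, n + ((r + 1 : ℕ) : ℤ) - a = n + 1 + r - a by
      intro a; push_cast; ring]
    rw [← sub_eq_iff_eq_add] at *
    rw [eq_comm, sub_eq_iff_eq_add] at h
    rw [h]
    simp only [smul_add, sub_smul, one_smul]
    abel

/-- The straightening relation used in the Pieri rule. -/
theorem vertex_straighten (n : ℤ) (p : ℕ) (f : Lam) :
    vertex n (vertex (n + p + 1) f) +
      (1 - t) • ∑ i ∈ Finset.range p, vertex (n + i + 1) (vertex (n + p - i) f) =
      t • vertex (n + p + 1) (vertex n f) := by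
  -- The antisymmetry relation says S(p-i) = -S(i), so the sum of S over 0 ≤ i ≤ p vanishes. The
  -- products inside the range occur once with coefficient 1 and once with -t, and only the two
  -- extreme ones remain unpaired.
  set S : ℕ → Lam := fun i => vertex (n + i) (vertex (n + (p + 1 - i)) f) -
    t • vertex (n + i + 1) (vertex (n + (p - i)) f) with hS
  have h1 : ∀ i ∈ Finset.range (p + 1), S (p + 1 - 1 - i) = -S i := by
    intro i hi
    have hi' : i ≤ p := by simpa [Nat.lt_succ_iff] using hi
    have h := vertex_antisymm (n + i) (n + (p + 1 - i)) f
    rw [show n + ((p : ℤ) + 1 - i) - 1 = n + (p - i) by ring] at h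
    simp only [hS, Nat.add_sub_cancel, Nat.cast_sub hi']
    rw [h, neg_neg, show n + ((p : ℤ) + 1 - (p - i)) = n + i + 1 by ring,
      show n + ((p : ℤ) - i) + 1 = n + (p + 1 - i) by ring,
      show n + ((p : ℤ) - (p - i)) = n + i by ring]
  have h2 : ∑ i ∈ Finset.range (p + 1), S i = 0 := by
    have h3 := Finset.sum_range_reflect S (p + 1)
    rw [Finset.sum_congr rfl h1, Finset.sum_neg_distrib] at h3
    exact self_eq_neg.1 h3.symm
  simp only [hS] at h2
  rw [Finset.sum_sub_distrib, ← Finset.smul_sum, Finset.sum_range_succ', Finset.sum_range_succ] at h2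
  simp only [Nat.cast_add, Nat.cast_one, Nat.cast_zero, add_zero, sub_zero, sub_self] at h2
  have h4 : ∀ i : ℕ, n + ((p : ℤ) + 1 - (i + 1)) = n + p - i := fun i => by ring
  have h5 : ∀ i : ℕ, n + ((p : ℤ) - i) = n + p - i := fun i => by ring
  simp only [h4, h5, ← add_assoc] at h2
  rw [sub_smul, one_smul, ← sub_eq_zero, ← h2, smul_add]
  abel

/-! ### Hall-Littlewood functions as iterated vertex operators -/

theorem pair_prod {A ι : Type*} [CommRing A] [Fintype ι] [DecidableEq ι] (g : ℕ → A)
    (P : ι → Polynomial A) {N : ℕ} (h : ∀ j i, N ≤ i → (P j).coeff i = 0) :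
    pair g (∏ j, P j) =
      ∑ k : ι → Fin N, g (∑ j, (k j : ℕ)) * ∏ j, (P j).coeff (k j) := by
  have h1 : ∀ j, P j = ∑ i : Fin N, Polynomial.monomial (i : ℕ) ((P j).coeff i) := by
    intro j
    rw [Fin.sum_univ_eq_sum_range (fun i => Polynomial.monomial i ((P j).coeff i))]
    ext i
    simp only [Polynomial.finsetSum_coeff, Polynomial.coeff_monomial, Finset.sum_ite_eq',
      Finset.mem_range]
    split_ifs with hj
    · rfl
    · exact h j i (not_lt.1 hj)
  have h2 : ∀ (s : Finset ι) (k : ι → ℕ) (c : ι → A), ∏ j ∈ s, Polynomial.monomial (k j) (c j) =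
      Polynomial.monomial (∑ j ∈ s, k j) (∏ j ∈ s, c j) := by
    intro s k c
    induction s using Finset.induction_on with
    | empty => simp
    | insert j s hj ih =>
      rw [Finset.prod_insert hj, Finset.sum_insert hj, Finset.prod_insert hj, ih,
        Polynomial.monomial_mul_monomial]
  have h3 : ∏ j, P j = ∑ k : ι → Fin N,
      Polynomial.monomial (∑ j, (k j : ℕ)) (∏ j, (P j).coeff (k j)) := by
    conv_lhs => rw [Finset.prod_congr rfl fun j _ => h1 j, Finset.prod_univ_sum,
      Fintype.piFinset_univ]
    exact Finset.sum_congr rfl fun k _ => h2 _ _ _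
  rw [h3, map_sum]
  exact Finset.sum_congr rfl fun k _ => pair_monomial _ _ _

theorem coeff_lowering_qX (u : ℤ) (k : ℕ) :
    (lowering (qX u)).coeff k = PowerSeries.coeff k raisingSeries • qX (u - k) := by
  rcases lt_or_ge u 0 with h | h
  · rw [qX_of_neg h, qX_of_neg (by omega)]
    simp
  · obtain ⟨n, rfl⟩ := Int.eq_ofNat_of_zero_le h
    rw [qX_natCast, lowering_qFun, Polynomial.finsetSum_coeff]
    simp only [Polynomial.coeff_C_mul, Polynomial.coeff_smul, Polynomial.coeff_X_pow]
    rcases le_or_gt k n with hk | hk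
    · rw [Finset.sum_eq_single (n - k, k)]
      · rw [if_pos rfl, ← Nat.cast_sub hk, qX_natCast]
        simp [mul_comm, Algebra.smul_def]
      · rintro ⟨a, b⟩ hab hne
        rw [if_neg, smul_zero, mul_zero]
        rintro rfl
        apply hne
        have := Finset.HasAntidiagonal.mem_antidiagonal.1 hab
        simp only at this
        rw [← this, Nat.add_sub_cancel]
      · intro hne
        exact absurd (Finset.HasAntidiagonal.mem_antidiagonal.2 (by simp; omega)) hne
    · rw [qX_of_neg (by omega), smul_zero]
      refine Finset.sum_eq_zero fun p hp => ?_
      have := Finset.HasAntidiagonal.mem_antidiagonal.1 hp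
      rw [if_neg (by omega), smul_zero, mul_zero]

/-- Γₙ prepends a row of length n and applies the raising operators between it and all older rows.
If some index is negative both sides vanish; otherwise N has to exceed every index. -/
theorem vertex_prod_qX {l : ℕ} (n : ℤ) (u : Fin l → ℤ) {N : ℕ}
    (h : (∃ i, u i < 0) ∨ ∀ i, u i < N) :
    vertex n (∏ i, qX (u i)) = ∑ k : Fin l → Fin N,
      (∏ i, PowerSeries.coeff (k i : ℕ) raisingSeries) •
        (qX (n + ∑ i, ((k i : ℕ) : ℤ)) * ∏ i, qX (u i - (k i : ℕ))) := by
  rcases h with ⟨i, hi⟩ | h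
  · rw [Finset.prod_eq_zero (Finset.mem_univ i) (qX_of_neg hi), map_zero, Finset.sum_eq_zero]
    intro k _
    rw [Finset.prod_eq_zero (f := fun i => qX (u i - (k i : ℕ))) (Finset.mem_univ i)
      (qX_of_neg (by omega)), mul_zero, smul_zero]
  · rw [vertex_apply, map_prod, pair_prod (N := N)]
    · refine Finset.sum_congr rfl fun k _ => ?_
      simp only [coeff_lowering_qX, Finset.prod_smul, mul_smul_comm]
      push_cast
      rfl
    · intro j i hi
      rw [coeff_lowering_qX, qX_of_neg (by have := h j; omega), smul_zero]

/-- A pair of rows of `l + 1` rows either contains the first one or not. -/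
def rowPairSucc (l : ℕ) : Fin l ⊕ RowPair l ≃ RowPair (l + 1) :=
  Equiv.ofBijective
    (Sum.elim (fun i => ⟨(0, i.succ), i.succ_pos⟩)
      fun p => ⟨(p.1.1.succ, p.1.2.succ), Fin.succ_lt_succ_iff.2 p.2⟩) (by
    constructor
    · rintro (i | ⟨⟨i, j⟩, hi⟩) (i' | ⟨⟨i', j'⟩, hi'⟩) h
      · simp at h; simp [h]
      · simp at h
        exact absurd h.1.symm (Fin.succ_ne_zero _)
      · simp at h
      · simp at h; simp [h]
    · rintro ⟨⟨i, j⟩, hij⟩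
      obtain ⟨j, rfl⟩ := Fin.exists_succ_eq.2 (show j ≠ 0 by rintro rfl; exact absurd hij (Fin.not_lt_zero _))
      rcases Fin.eq_zero_or_eq_succ i with rfl | ⟨i, rfl⟩
      · exact ⟨Sum.inl j, rfl⟩
      · exact ⟨Sum.inr ⟨(i, j), Fin.succ_lt_succ_iff.1 hij⟩, rfl⟩)

theorem rowPairSucc_inl {l : ℕ} (i : Fin l) : (rowPairSucc l (Sum.inl i)).1 = (0, i.succ) := rfl

theorem rowPairSucc_inr {l : ℕ} (p : RowPair l) :
    (rowPairSucc l (Sum.inr p)).1 = (p.1.1.succ, p.1.2.succ) := rfl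

theorem raise_zero {l : ℕ} (a : RowPair (l + 1) → ℕ) (v : Fin (l + 1) → ℤ) :
    raise a v 0 = v 0 + ∑ i, (a (rowPairSucc l (Sum.inl i)) : ℤ) := by
  rw [raise, ← (rowPairSucc l).sum_comp, ← (rowPairSucc l).sum_comp, Fintype.sum_sum_type,
    Fintype.sum_sum_type]
  simp [rowPairSucc_inl, rowPairSucc_inr]

theorem raise_succ {l : ℕ} (a : RowPair (l + 1) → ℕ) (v : Fin (l + 1) → ℤ) (i : Fin l) :
    raise a v i.succ = raise (fun p => a (rowPairSucc l (Sum.inr p))) (fun i => v i.succ) i -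
      a (rowPairSucc l (Sum.inl i)) := by
  rw [raise, raise, ← (rowPairSucc l).sum_comp, ← (rowPairSucc l).sum_comp, Fintype.sum_sum_type,
    Fintype.sum_sum_type]
  simp [rowPairSucc_inl, rowPairSucc_inr, (Fin.succ_ne_zero _).symm]
  ring

/-- `Q_λ(𝐱)`, obtained by applying the vertex operators `Γ_{λᵢ}` to `1`. -/
def hallQ (l : List ℕ) : Lam := l.foldr (fun n f => vertex n f) 1

theorem hallQ_cons (n : ℕ) (l : List ℕ) : hallQ (n :: l) = vertex n (hallQ l) := rfl

/-- Induction on the number of rows, splitting the pairs of rows by whether they contain the first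
one; those that do come from the outermost Γ. -/
theorem hallQ_expansion (l : ℕ) (v : Fin l → ℕ) {N : ℕ} (hN : ∑ i, v i < N) :
    hallQ (List.ofFn v) = ∑ a : RowPair l → Fin N,
      (∏ p, PowerSeries.coeff (a p : ℕ) raisingSeries) •
        ∏ i, qX (raise (fun p => (a p : ℕ)) (fun i => (v i : ℤ)) i) := by
  induction l with
  | zero => simp [hallQ]
  | succ l ih =>
    rw [Fin.sum_univ_succ] at hN
    rw [List.ofFn_succ, hallQ_cons, ih (fun i => v i.succ) (by omega), map_sum]
    simp only [map_smul]
    let e : (RowPair (l + 1) → Fin N) ≃ (Fin l → Fin N) × (RowPair l → Fin N) :=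
      ((rowPairSucc l).arrowCongr (Equiv.refl _)).symm.trans (Equiv.sumArrowEquivProdArrow _ _ _)
    rw [← e.symm.sum_comp, Fintype.sum_prod_type_right]
    refine Finset.sum_congr rfl fun b _ => ?_
    rw [vertex_prod_qX (N := N), Finset.smul_sum]
    · refine Finset.sum_congr rfl fun k _ => ?_
      have e1 : ∀ i, e.symm (k, b) (rowPairSucc l (Sum.inl i)) = k i := fun i => by
        simp [e]
      have e2 : ∀ p, e.symm (k, b) (rowPairSucc l (Sum.inr p)) = b p := fun i => by
        simp [e]
      rw [← (rowPairSucc l).prod_comp, Fintype.prod_sum_type, Fin.prod_univ_succ, raise_zero,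
        smul_smul, mul_comm (∏ p, _) (∏ i, _)]
      simp only [raise_succ, e1, e2]
    -- Raising preserves the total, so if all raised indices are nonnegative each of them is at most
    -- the sum of the vᵢ, hence below N.
    · by_cases h : ∃ i, raise (fun p => (b p : ℕ)) (fun i => (v i.succ : ℤ)) i < 0
      · exact Or.inl h
      · push Not at h
        refine Or.inr fun i => ?_
        have h1 := Finset.single_le_sum (f := raise (fun p => (b p : ℕ)) fun i => (v i.succ : ℤ))
          (fun i _ => h i) (Finset.mem_univ i)
        rw [sum_raise] at h1
        have h2 : ∑ i : Fin l, (v i.succ : ℤ) = ((∑ i : Fin l, v i.succ : ℕ) : ℤ) := by push_cast; rfl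
        omega

/-! ### Substituting commuting operators into polynomials -/

section CommEval

variable {ι A : Type*} [Ring A] [Algebra K A]

theorem isMulCommutative_adjoin_range (c : ι → A) (h : ∀ i j, c i * c j = c j * c i) :
    IsMulCommutative (Algebra.adjoin K (Set.range c)) :=
  Algebra.isMulCommutative_adjoin K (by
    rintro _ ⟨i, rfl⟩ _ ⟨j, rfl⟩
    exact h i j)

open scoped IsMulCommutative in
/-- Evaluation of polynomials at a family of pairwise commuting elements of a noncommutative
algebra. -/
def commEval (c : ι → A) (h : ∀ i j, c i * c j = c j * c i) : MvPolynomial ι K →ₐ[K] A :=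
  haveI := isMulCommutative_adjoin_range c h
  (Algebra.adjoin K (Set.range c)).val.comp
    (MvPolynomial.aeval fun i =>
      (⟨c i, Algebra.subset_adjoin ⟨i, rfl⟩⟩ : Algebra.adjoin K (Set.range c)))

open scoped IsMulCommutative in
theorem commEval_X (c : ι → A) (h : ∀ i j, c i * c j = c j * c i) (i : ι) :
    commEval c h (MvPolynomial.X i) = c i := by
  simp [commEval]

theorem newton_qFun_of_commute (a : ℕ+ → A) (h : ∀ i j, a i * a j = a j * a i) (n : ℕ) :
    ((n : K) + 1) • qFun a (n + 1) = ∑ k ∈ Finset.range (n + 1),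
      (((k : K) + 1) * (1 - t ^ (k + 1))) • (a k.succPNat * qFun a (n - k)) := by
  have h1 := congrArg (commEval a h) (newton_qFun MvPolynomial.X n)
  simp only [map_smul, map_sum, map_mul, map_qFun, commEval_X] at h1
  rw [h1]
  exact Finset.Nat.sum_antidiagonal_eq_sum_range_succ (fun i j =>
    (((i : K) + 1) * (1 - t ^ (i + 1))) • (a i.succPNat * qFun a j)) n

theorem qFun_add_of_commute (a b : ℕ+ → A) (h : ∀ i j, Sum.elim a b i * Sum.elim a b j =
    Sum.elim a b j * Sum.elim a b i) (n : ℕ) :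
    qFun (fun n => a n + b n) n = ∑ p ∈ Finset.HasAntidiagonal.antidiagonal n,
      qFun a p.1 * qFun b p.2 := by
  have h1 := congrArg (commEval (Sum.elim a b) h) (qFun_add (A := MvPolynomial (ℕ+ ⊕ ℕ+) K)
    (fun n => MvPolynomial.X (Sum.inl n)) (fun n => MvPolynomial.X (Sum.inr n)) n)
  rw [map_qFun, map_sum] at h1
  simp only [map_mul, map_add, map_qFun, commEval_X, Sum.elim_inl, Sum.elim_inr] at h1
  exact h1

end CommEval

/-! ### Commutativity of the operators 𝐱 - ∂̃_𝐲 and 𝐲 - ∂̃_𝐱, and the coupling map -/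

theorem pderiv_comm (i j : ℕ+ ⊕ ℕ+) (f : Poly) :
    MvPolynomial.pderiv i (MvPolynomial.pderiv j f) =
      MvPolynomial.pderiv j (MvPolynomial.pderiv i f) := by
  have h : ⁅MvPolynomial.pderiv (R := K) i, MvPolynomial.pderiv (R := K) j⁆ = 0 := by
    apply MvPolynomial.derivation_ext
    intro k
    rw [Derivation.commutator_apply, MvPolynomial.pderiv_X, MvPolynomial.pderiv_X]
    simp only [Pi.single_apply]
    split_ifs <;> simp
  have h1 := DFunLike.congr_fun h f
  rw [Derivation.commutator_apply] at h1
  exact sub_eq_zero.1 h1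

theorem xOp_apply (n : ℕ+) (f : Poly) : xOp n f =
    xVar n * f - ((n : ℕ) : K)⁻¹ • MvPolynomial.pderiv (Sum.inr n) f := rfl

theorem yOp_apply (n : ℕ+) (f : Poly) : yOp n f =
    yVar n * f - ((n : ℕ) : K)⁻¹ • MvPolynomial.pderiv (Sum.inl n) f := rfl

theorem pderiv_inr_xVar_mul (m n : ℕ+) (f : Poly) :
    MvPolynomial.pderiv (Sum.inr m) (xVar n * f) =
      xVar n * MvPolynomial.pderiv (Sum.inr m) f := by
  rw [Derivation.leibniz, xVar, MvPolynomial.pderiv_X_of_ne (by simp)]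
  simp

theorem pderiv_inl_yVar_mul (m n : ℕ+) (f : Poly) :
    MvPolynomial.pderiv (Sum.inl m) (yVar n * f) =
      yVar n * MvPolynomial.pderiv (Sum.inl m) f := by
  rw [Derivation.leibniz, yVar, MvPolynomial.pderiv_X_of_ne (by simp)]
  simp

theorem pderiv_inl_xVar_mul (m n : ℕ+) (f : Poly) :
    MvPolynomial.pderiv (Sum.inl m) (xVar n * f) =
      xVar n * MvPolynomial.pderiv (Sum.inl m) f + if m = n then f else 0 := by
  rw [Derivation.leibniz, xVar, MvPolynomial.pderiv_X, Pi.single_apply]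
  by_cases h : m = n
  · simp [h]
  · simp [h, Ne.symm h]

theorem pderiv_inr_yVar_mul (m n : ℕ+) (f : Poly) :
    MvPolynomial.pderiv (Sum.inr m) (yVar n * f) =
      yVar n * MvPolynomial.pderiv (Sum.inr m) f + if m = n then f else 0 := by
  rw [Derivation.leibniz, yVar, MvPolynomial.pderiv_X, Pi.single_apply]
  by_cases h : m = n
  · simp [h]
  · simp [h, Ne.symm h]

theorem xOp_comm_xOp (m n : ℕ+) : xOp m * xOp n = xOp n * xOp m := by
  refine LinearMap.ext fun f => ?_
  simp only [Module.End.mul_apply, xOp_apply, map_sub, Derivation.map_smul, pderiv_inr_xVar_mul,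
    mul_smul_comm, pderiv_comm (Sum.inr m) (Sum.inr n), mul_left_comm (xVar m),
    smul_smul, mul_comm ((m : ℕ) : K)⁻¹]
  abel

theorem yOp_comm_yOp (m n : ℕ+) : yOp m * yOp n = yOp n * yOp m := by
  refine LinearMap.ext fun f => ?_
  simp only [Module.End.mul_apply, yOp_apply, map_sub, Derivation.map_smul, pderiv_inl_yVar_mul,
    mul_smul_comm, pderiv_comm (Sum.inl m) (Sum.inl n), mul_left_comm (yVar m),
    smul_smul, mul_comm ((m : ℕ) : K)⁻¹]
  abel

/-- For m = n the commutator of xₙ with -(1/n)∂/∂xₙ is 1/n, that of -(1/n)∂/∂yₙ with yₙ is -1/n, and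
they cancel. -/
theorem xOp_comm_yOp (m n : ℕ+) : xOp m * yOp n = yOp n * xOp m := by
  refine LinearMap.ext fun f => ?_
  simp only [Module.End.mul_apply, yOp_apply, xOp_apply, map_sub, Derivation.map_smul,
    pderiv_inr_yVar_mul, pderiv_inl_xVar_mul, mul_smul_comm, pderiv_comm (Sum.inr m) (Sum.inl n), mul_left_comm (xVar m),
    smul_smul, mul_comm ((m : ℕ) : K)⁻¹, smul_add]
  by_cases h : m = n
  · subst h
    simp only [if_true]
    abel
  · rw [if_neg h, if_neg (Ne.symm h)]
    simp only [smul_zero]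
    abel

theorem elim_xOp_yOp_comm (i j : ℕ+ ⊕ ℕ+) :
    Sum.elim xOp yOp i * Sum.elim xOp yOp j = Sum.elim xOp yOp j * Sum.elim xOp yOp i := by
  rcases i with i | i <;> rcases j with j | j
  · exact xOp_comm_xOp i j
  · exact xOp_comm_yOp i j
  · exact (xOp_comm_yOp j i).symm
  · exact yOp_comm_yOp i j

/-- The embedding `f(𝐱) ↦ f(𝐱)` of `ℂ(t)[𝐱]` into `ℂ(t)[𝐱, 𝐲]`. -/
def inX : Lam →ₐ[K] Poly := MvPolynomial.rename Sum.inl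

/-- The embedding `f(𝐱) ↦ f(𝐲)` of `ℂ(t)[𝐱]` into `ℂ(t)[𝐱, 𝐲]`. -/
def inY : Lam →ₐ[K] Poly := MvPolynomial.rename Sum.inr

theorem inX_qX (n : ℤ) : inX (qX n) = qInt xVar n := by
  rw [qX, map_qInt]
  simp only [inX, MvPolynomial.rename_X]
  rfl

theorem inY_qX (n : ℤ) : inY (qX n) = qInt yVar n := by
  rw [qX, map_qInt]
  simp only [inY, MvPolynomial.rename_X]
  rfl

/-- The substitution `f(𝐱, 𝐲) ↦ f(𝐱 - ∂̃_𝐲, 𝐲 - ∂̃_𝐱)`. -/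
def opEval : Poly →ₐ[K] Module.End K Poly := commEval (Sum.elim xOp yOp) elim_xOp_yOp_comm

/-- The linear map `f ↦ f(𝐱 - ∂̃_𝐲, 𝐲 - ∂̃_𝐱) 1`. -/
def coupling : Poly →ₗ[K] Poly := (LinearMap.applyₗ (1 : Poly)).comp opEval.toLinearMap

theorem coupling_apply (f : Poly) : coupling f = opEval f 1 := rfl

/-- Evaluation at commuting operators is multiplicative. Thus `coupling` intertwines multiplication
by q_r(𝐱) with q_r(𝐱 - ∂̃_𝐲), and similarly for 𝐲. -/
theorem coupling_mul (f g : Poly) : coupling (f * g) = opEval f (coupling g) := by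
  rw [coupling_apply, map_mul]
  rfl

theorem opEval_qInt_xVar (n : ℤ) : opEval (qInt xVar n) = qInt xOp n := by
  rw [map_qInt]
  simp only [opEval, xVar, commEval_X, Sum.elim_inl]

theorem opEval_qInt_yVar (n : ℤ) : opEval (qInt yVar n) = qInt yOp n := by
  rw [map_qInt]
  simp only [opEval, yVar, commEval_X, Sum.elim_inr]

theorem pderiv_inl_inY (n : ℕ+) (f : Lam) : MvPolynomial.pderiv (Sum.inl n) (inY f) = 0 := by
  induction f using MvPolynomial.induction_on with
  | C a => simp [inY]
  | add p q hp hq => rw [map_add, map_add, hp, hq, add_zero]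
  | mul_X p m hp =>
    rw [map_mul, Derivation.leibniz, hp]
    simp [inY]

/-- The derivatives ∂/∂xₙ kill every function of 𝐲 alone, so yₙ - ∂̃ acts as multiplication by yₙ.
-/
theorem coupling_inY (f : Lam) : coupling (inY f) = inY f := by
  induction f using MvPolynomial.induction_on with
  | C a =>
    rw [coupling_apply, ← MvPolynomial.algebraMap_eq, AlgHom.commutes, AlgHom.commutes,
      Algebra.algebraMap_eq_smul_one, Algebra.algebraMap_eq_smul_one]
    simp
  | add p q hp hq => rw [map_add, map_add, hp, hq]
  | mul_X p m hp =>
    rw [map_mul, mul_comm, coupling_mul, hp]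
    have : inY (MvPolynomial.X m) = yVar m := by simp [inY, yVar]
    rw [this]
    have h2 : opEval (yVar m) = yOp m := by simp only [opEval, yVar, commEval_X, Sum.elim_inr]
    rw [h2, yOp_apply, pderiv_inl_inY, smul_zero, sub_zero]

/-! ### The action of `qₙ(𝐱 - ∂̃_𝐲)` -/

section Shift

open Polynomial

/-- The substitution `yₙ ↦ yₙ - (1 - tⁿ) Zⁿ/n`. -/
def shiftY : Poly →ₐ[K] Poly[X] :=
  MvPolynomial.aeval (Sum.elim (fun n => C (xVar n)) fun n : ℕ+ =>
    C (yVar n) + (-((1 - t ^ (n : ℕ)) / ((n : ℕ) : K))) • (X : Poly[X]) ^ (n : ℕ))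

theorem shiftY_xVar (n : ℕ+) : shiftY (xVar n) = C (xVar n) := by
  simp [shiftY, xVar]

theorem shiftY_yVar (n : ℕ+) : shiftY (yVar n) =
    C (yVar n) + (-((1 - t ^ (n : ℕ)) / ((n : ℕ) : K))) • (X : Poly[X]) ^ (n : ℕ) := by
  simp [shiftY, yVar]

theorem shiftY_inX (f : Lam) : shiftY (inX f) = C (inX f) := by
  have : shiftY.comp inX = (Polynomial.CAlgHom (R := K)).comp inX := by
    apply MvPolynomial.algHom_ext
    intro n
    simp only [AlgHom.comp_apply, inX, MvPolynomial.rename_X]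
    exact shiftY_xVar n
  exact DFunLike.congr_fun this f

/-- The coefficients of a polynomial, indexed by integers. -/
def coeffInt (P : Poly[X]) (i : ℤ) : Poly := if 0 ≤ i then P.coeff i.toNat else 0

theorem coeffInt_of_neg (P : Poly[X]) {i : ℤ} (hi : i < 0) : coeffInt P i = 0 :=
  if_neg (not_le.2 hi)

theorem coeffInt_natCast (P : Poly[X]) (i : ℕ) : coeffInt P i = P.coeff i := by
  simp [coeffInt]

theorem coeffInt_mul_yVar (P : Poly[X]) (m : ℕ+) (i : ℤ) :
    coeffInt (P * shiftY (yVar m)) i = yVar m * coeffInt P i +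
      (-((1 - t ^ (m : ℕ)) / ((m : ℕ) : K))) • coeffInt P (i - (m : ℕ)) := by
  rw [shiftY_yVar, mul_add, mul_smul_comm]
  rcases lt_or_ge i 0 with h | h
  · rw [coeffInt_of_neg _ h, coeffInt_of_neg _ h, coeffInt_of_neg _ (by omega)]
    simp
  · obtain ⟨n, rfl⟩ := Int.eq_ofNat_of_zero_le h
    rw [coeffInt_natCast, coeffInt_natCast, coeff_add, coeff_smul, coeff_mul_C, coeff_mul_X_pow',
      mul_comm]
    congr 2
    split_ifs with hn
    · rw [← Nat.cast_sub hn, coeffInt_natCast]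
    · rw [coeffInt_of_neg _ (by omega)]

/-- The chain rule for f(yₙ - (1-tⁿ)Zⁿ/n) gives Z d/dZ = -∑ (1-tⁿ) Zⁿ ∂/∂yₙ; this is its coefficient
of Zⁱ. Integer indices and a bound N independent of i allow the induction to use i and i - m with
the same range. -/
theorem coeffInt_shiftY_euler (f : Poly) (N : ℕ) (i : ℤ) (hi : i ≤ N) :
    (i : K) • coeffInt (shiftY f) i = -∑ k ∈ Finset.range N, (1 - t ^ (k + 1)) •
      MvPolynomial.pderiv (Sum.inr k.succPNat) (coeffInt (shiftY f) (i - (k + 1))) := by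
  induction f using MvPolynomial.induction_on generalizing i with
  | C a =>
    have h1 : shiftY (MvPolynomial.C a) = C (MvPolynomial.C a) := by
      rw [← MvPolynomial.algebraMap_eq, AlgHom.commutes]
      rfl
    have h2 : ∀ i, coeffInt (shiftY (MvPolynomial.C a)) i =
        if i = 0 then MvPolynomial.C a else 0 := by
      intro i
      rw [h1, coeffInt, coeff_C]
      split_ifs <;> first | rfl | omega
    simp only [h2]
    rw [Finset.sum_eq_zero]
    · split_ifs with h <;> simp [h]
    · intro k _
      split_ifs <;> simp
  | add p q hp hq =>
    have h1 : ∀ i, coeffInt (shiftY (p + q)) i = coeffInt (shiftY p) i + coeffInt (shiftY q) i := by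
      intro i
      rw [map_add, coeffInt, coeffInt, coeffInt]
      split_ifs <;> simp
    simp only [h1]
    simp only [smul_add, map_add (MvPolynomial.pderiv _), Finset.sum_add_distrib, hp i hi, hq i hi]
    abel
  | mul_X p s hp =>
    rcases s with m | m
    · have h1 : ∀ i, coeffInt (shiftY (p * MvPolynomial.X (Sum.inl m))) i =
          xVar m * coeffInt (shiftY p) i := by
        intro i
        rw [map_mul]
        change coeffInt (shiftY p * shiftY (xVar m)) i = _
        rw [shiftY_xVar, coeffInt, coeffInt, coeff_mul_C, mul_comm]
        split_ifs <;> simp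
      simp only [h1, pderiv_inr_xVar_mul, ← mul_smul_comm, ← Finset.mul_sum, hp i hi, mul_neg]
    · have h1 : ∀ i, coeffInt (shiftY (p * MvPolynomial.X (Sum.inr m))) i = yVar m *
          coeffInt (shiftY p) i +
          (-((1 - t ^ (m : ℕ)) / ((m : ℕ) : K))) • coeffInt (shiftY p) (i - (m : ℕ)) := by
        intro i
        rw [map_mul]
        exact coeffInt_mul_yVar _ _ _
      have hm : ((m : ℕ) : K) ≠ 0 := by exact_mod_cast m.ne_zero
      have h2 : ∑ k ∈ Finset.range N, (1 - t ^ (k + 1)) •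
          (if k.succPNat = m then coeffInt (shiftY p) (i - (k + 1)) else 0) =
          (1 - t ^ (m : ℕ)) • coeffInt (shiftY p) (i - (m : ℕ)) := by
        obtain ⟨m', hm'⟩ : ∃ m' : ℕ, (m : ℕ) = m' + 1 := ⟨m - 1, by have := m.pos; omega⟩
        have h3 : ∀ k : ℕ, (k.succPNat = m) ↔ k = m' := by
          intro k
          rw [← PNat.coe_inj, hm']
          simp
        simp only [h3, smul_ite, smul_zero, Finset.sum_ite_eq', Finset.mem_range, hm']
        split_ifs with h
        · push_cast
          rfl
        · rw [coeffInt_of_neg, smul_zero]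
          push_cast
          omega
      have h4 := hp i hi
      have h5 := hp (i - (m : ℕ)) (by omega)
      have h6 : ∀ k : ℕ, i - (m : ℕ) - ((k : ℤ) + 1) = i - (k + 1) - (m : ℕ) := fun k => by ring
      simp only [h6] at h5
      simp only [h1, map_add, pderiv_inr_yVar_mul, Derivation.map_smul, smul_add,
        Finset.sum_add_distrib, h2, ← mul_smul_comm _ (yVar m), ← Finset.mul_sum, smul_comm _ (-((1 - t ^ (m : ℕ)) / ((m : ℕ) : K))),
        ← Finset.smul_sum]
      rw [← neg_eq_iff_eq_neg] at h4 h5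
      rw [← h4, ← h5]
      have h7 : ((i - (m : ℕ) : ℤ) : K) = (i : K) - ((m : ℕ) : K) := by push_cast; rfl
      have h8 : 1 - t ^ (m : ℕ) = (1 - t ^ (m : ℕ)) / ((m : ℕ) : K) * ((m : ℕ) : K) := by
        field_simp
      rw [h7]
      generalize (1 - t ^ (m : ℕ)) / ((m : ℕ) : K) = c at *
      rw [h8, mul_neg, mul_smul_comm]
      generalize coeffInt (shiftY p) (i - ((m : ℕ) : ℤ)) = z
      generalize yVar m * coeffInt (shiftY p) i = w
      generalize (i : K) = r
      generalize ((m : ℕ) : K) = s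
      simp only [sub_smul, smul_neg, smul_sub, mul_smul, neg_smul]
      abel

end Shift

section Shift

open Polynomial

/-- Multiplication by `xₙ`. -/
def mulX (n : ℕ+) : Module.End K Poly := LinearMap.mulLeft K (xVar n)

/-- The operator `-(1/n) ∂/∂yₙ`. -/
def derY (n : ℕ+) : Module.End K Poly :=
  (-((n : ℕ) : K)⁻¹) • (MvPolynomial.pderiv (Sum.inr n)).toLinearMap

theorem mulX_apply (n : ℕ+) (f : Poly) : mulX n f = xVar n * f := rfl

theorem derY_apply (n : ℕ+) (f : Poly) :
    derY n f = (-((n : ℕ) : K)⁻¹) • MvPolynomial.pderiv (Sum.inr n) f := rfl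

theorem derY_comm (m n : ℕ+) : derY m * derY n = derY n * derY m := by
  refine LinearMap.ext fun f => ?_
  simp only [Module.End.mul_apply, derY_apply, Derivation.map_smul,
    pderiv_comm (Sum.inr m) (Sum.inr n)]
  rw [smul_comm]

theorem elim_mulX_derY_comm (i j : ℕ+ ⊕ ℕ+) :
    Sum.elim mulX derY i * Sum.elim mulX derY j = Sum.elim mulX derY j * Sum.elim mulX derY i := by
  have h : ∀ m n, mulX m * derY n = derY n * mulX m := by
    intro m n
    refine LinearMap.ext fun f => ?_
    simp only [Module.End.mul_apply, derY_apply, mulX_apply, pderiv_inr_xVar_mul, mul_smul_comm]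
  rcases i with i | i <;> rcases j with j | j
  · refine LinearMap.ext fun f => ?_
    simp only [Sum.elim_inl, Module.End.mul_apply, mulX_apply, mul_left_comm]
  · exact h i j
  · exact (h j i).symm
  · exact derY_comm i j

theorem qFun_mulX (n : ℕ) (f : Poly) : qFun mulX n f = qFun xVar n * f := by
  have h := map_qFun (Algebra.lmul K Poly) xVar n
  have h1 : (fun n => Algebra.lmul K Poly (xVar n)) = mulX := rfl
  rw [h1] at h
  rw [← h]
  rfl

/-- The exponential of -∑ (1-tⁿ)(Zⁿ/n) ∂/∂yₙ is the translation `shiftY`, by Taylor's formula. Here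
both sides satisfy one recursion: Newton's identity on the left, `coeffInt_shiftY_euler` on the
right. -/
theorem qFun_derY (n : ℕ) (f : Poly) : qFun derY n f = (shiftY f).coeff n := by
  induction n using Nat.strong_induction_on with
  | _ n ih =>
    cases n with
    | zero =>
      -- At Z = 0 the translation is the identity.
      have h : (Polynomial.constantCoeff : Poly[X] →+* Poly).comp (shiftY : Poly →+* Poly[X]) =
          RingHom.id _ := by
        apply MvPolynomial.ringHom_ext
        · intro r
          have : shiftY (MvPolynomial.C r) = C (MvPolynomial.C r) := by
            rw [← MvPolynomial.algebraMap_eq, AlgHom.commutes]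
            rfl
          simp [this]
        · rintro (m | m)
          · change Polynomial.constantCoeff (shiftY (xVar m)) = xVar m
            simp [shiftY_xVar]
          · change Polynomial.constantCoeff (shiftY (yVar m)) = yVar m
            simp [shiftY_yVar]
            exact fun h => absurd h.symm m.ne_zero
      rw [qFun_zero]
      exact (DFunLike.congr_fun h f).symm
    | succ n =>
      have h1 := LinearMap.congr_fun (newton_qFun_of_commute derY derY_comm n) f
      have h2 := coeffInt_shiftY_euler f (n + 1) ((n + 1 : ℕ) : ℤ) le_rfl
      have h3 : (n : K) + 1 ≠ 0 := by exact_mod_cast Nat.succ_ne_zero n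
      rw [coeffInt_natCast] at h2
      simp only [LinearMap.smul_apply, LinearMap.sum_apply, Module.End.mul_apply] at h1
      have h4 : ((n : K) + 1) • qFun derY (n + 1) f =
          ((n : K) + 1) • (shiftY f).coeff (n + 1) := by
        rw [h1, show ((n : K) + 1) = ((((n + 1 : ℕ) : ℤ)) : K) by push_cast; rfl, h2,
          ← Finset.sum_neg_distrib]
        refine Finset.sum_congr rfl fun k hk => ?_
        have hk' := Finset.mem_range.1 hk
        have h5 : (k : K) + 1 ≠ 0 := by exact_mod_cast Nat.succ_ne_zero k
        rw [ih (n - k) (by omega), derY_apply, smul_smul, Nat.succPNat_coe,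
          show ((n + 1 : ℕ) : ℤ) - (k + 1) = ((n - k : ℕ) : ℤ) by push_cast [show k ≤ n by omega]; ring,
          coeffInt_natCast, ← neg_smul]
        congr 1
        push_cast
        field_simp
      exact (smul_right_injective _ h3) h4

/-- Multiplication by the xₙ commutes with the ∂/∂yₙ, so the exponential factors into multiplication
by ∑ q_k(𝐱) zᵏ and a translation of 𝐲. -/
theorem qInt_xOp_apply (r : ℤ) (f : Poly) :
    qInt xOp r f = pair (fun i => qInt xVar (r - i)) (shiftY f) := by
  have hz : ∀ i : ℕ, r < i → qInt xVar (r - i) = 0 := fun i hi => qInt_of_neg _ (by omega)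
  rcases lt_or_ge r 0 with h | h
  · rw [qInt_of_neg _ h, pair_eq_sum_range _ _ (N := (shiftY f).natDegree + 1)
      (fun i hi => coeff_eq_zero_of_natDegree_lt (by omega)), Finset.sum_eq_zero]
    · rfl
    · intro i _
      rw [hz i (by omega), zero_mul]
  · obtain ⟨n, rfl⟩ := Int.eq_ofNat_of_zero_le h
    have h1 : xOp = fun n => mulX n + derY n := by
      funext n
      refine LinearMap.ext fun f => ?_
      rw [LinearMap.add_apply, xOp_apply, mulX_apply, derY_apply, neg_smul, sub_eq_add_neg]
    rw [qInt_natCast, h1, qFun_add_of_commute _ _ elim_mulX_derY_comm, LinearMap.sum_apply]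
    simp only [Module.End.mul_apply, qFun_mulX, qFun_derY]
    rw [← Finset.Nat.sum_antidiagonal_swap]
    rw [Finset.Nat.sum_antidiagonal_eq_sum_range_succ_mk]
    rw [pair_eq_sum_range _ _ (N := (shiftY f).natDegree + 1 + (n + 1))
      (fun i hi => coeff_eq_zero_of_natDegree_lt (by omega))]
    refine Finset.sum_subset_zero_on_sdiff ?_ ?_ ?_
    · intro i hi
      simp only [Finset.mem_range] at hi ⊢
      omega
    · intro i hi
      simp only [Finset.mem_sdiff, Finset.mem_range] at hi
      rw [hz i (by omega), zero_mul]
    · intro i hi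
      have := Finset.mem_range.1 hi
      simp only [Prod.fst_swap, Prod.snd_swap]
      rw [← Nat.cast_sub (by omega), qInt_natCast]

/-- This is the origin of the D-operators: translating q_u(𝐲) lowers u by k with the coefficient of
Dᵏ, while the pairing in `qInt_xOp_apply` lowers the 𝐱-index by the same k. -/
theorem coeff_shiftY_qInt (u : ℤ) (k : ℕ) :
    (shiftY (qInt yVar u)).coeff k =
      PowerSeries.coeff k couplingSeries • qInt yVar (u - k) := by
  rcases lt_or_ge u 0 with h | h
  · rw [qInt_of_neg _ h, qInt_of_neg _ (by omega)]
    simp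
  · obtain ⟨n, rfl⟩ := Int.eq_ofNat_of_zero_le h
    have h0 : shiftY (qFun yVar n) = ∑ p ∈ Finset.HasAntidiagonal.antidiagonal n,
        C (qFun yVar p.1) * (PowerSeries.coeff p.2 couplingSeries • X ^ p.2) := by
      rw [map_qFun]
      simp only [shiftY_yVar]
      rw [qFun_add]
      refine Finset.sum_congr rfl fun p _ => ?_
      have h1 := map_qFun (Polynomial.CAlgHom (R := K) (A := Poly)) yVar p.1
      have h2 := congrArg (PowerSeries.coeff p.2) (qSeries_coupling (X : Poly[X]))
      rw [coeff_scaled, qSeries, PowerSeries.coeff_mk] at h2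
      rw [h2]
      congr 1
      exact h1.symm
    rw [qInt_natCast, h0, finsetSum_coeff]
    simp only [coeff_C_mul, coeff_smul, coeff_X_pow]
    rcases le_or_gt k n with hk | hk
    · rw [Finset.sum_eq_single (n - k, k)]
      · rw [if_pos rfl, ← Nat.cast_sub hk, qInt_natCast]
        simp [mul_comm, Algebra.smul_def]
      · rintro ⟨a, b⟩ hab hne
        rw [if_neg, smul_zero, mul_zero]
        rintro rfl
        apply hne
        have := Finset.HasAntidiagonal.mem_antidiagonal.1 hab
        simp only at this
        rw [← this, Nat.add_sub_cancel]
      · intro hne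
        exact absurd (Finset.HasAntidiagonal.mem_antidiagonal.2 (by simp; omega)) hne
    · rw [qInt_of_neg _ (by omega), smul_zero]
      refine Finset.sum_eq_zero fun p hp => ?_
      have := Finset.HasAntidiagonal.mem_antidiagonal.1 hp
      rw [if_neg (by omega), smul_zero, mul_zero]

theorem qInt_xOp_prod {m : ℕ} (r : ℤ) (g : Lam) (w : Fin m → ℤ) {N : ℕ} (h : ∀ j, w j < N) :
    qInt xOp r (inX g * ∏ j, qInt yVar (w j)) = ∑ k : Fin m → Fin N,
      (∏ j, PowerSeries.coeff (k j : ℕ) couplingSeries) •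
        (qInt xVar (r - ∑ j, ((k j : ℕ) : ℤ)) * (inX g * ∏ j, qInt yVar (w j - (k j : ℕ)))) := by
  rw [qInt_xOp_apply, map_mul, shiftY_inX, pair_C_mul, map_prod, pair_prod (N := N),
    Finset.mul_sum]
  · refine Finset.sum_congr rfl fun k _ => ?_
    simp only [coeff_shiftY_qInt, Finset.prod_smul, mul_smul_comm]
    push_cast
    rw [mul_left_comm]
  · intro j i hi
    rw [coeff_shiftY_qInt, qInt_of_neg _ (by have := h j; omega), smul_zero]

end Shift

/-! ### Coupled functions as images under the coupling map -/

/-- Induction on the number of 𝐱-factors: the outermost one acts as q(𝐱 - ∂̃_𝐲) on what is already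
expanded, and supplies the D-operators of its own row. The bound N survives because the 𝐲-indices
only decrease. -/
theorem coupling_prod {l m : ℕ} (v : Fin l → ℤ) (w : Fin m → ℤ) {N : ℕ} (h : ∀ j, w j < N) :
    coupling ((∏ i, qInt xVar (v i)) * ∏ j, qInt yVar (w j)) = ∑ d : Fin l → Fin m → Fin N,
      (∏ i, ∏ j, PowerSeries.coeff (d i j : ℕ) couplingSeries) •
        ((∏ i, qInt xVar (v i - ∑ j, ((d i j : ℕ) : ℤ))) *
          ∏ j, qInt yVar (w j - ∑ i, ((d i j : ℕ) : ℤ))) := by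
  induction l with
  | zero =>
    have h1 : ∏ j, qInt yVar (w j) = inY (∏ j, qX (w j)) := by simp only [map_prod, inY_qX]
    simp only [Finset.univ_eq_empty, Finset.prod_empty, Finset.sum_empty, one_mul, sub_zero,
      Finset.univ_unique, Finset.sum_singleton, one_smul]
    rw [h1, coupling_inY]
  | succ l ih =>
    rw [Fin.prod_univ_succ, mul_assoc, coupling_mul, opEval_qInt_xVar, ih, map_sum,
      ← (Fin.consEquiv fun _ => Fin m → Fin N).sum_comp, Fintype.sum_prod_type_right]
    refine Finset.sum_congr rfl fun d _ => ?_
    have h2 : ∏ i : Fin l, qInt xVar (v i.succ - ∑ j, ((d i j : ℕ) : ℤ)) =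
        inX (∏ i : Fin l, qX (v i.succ - ∑ j, ((d i j : ℕ) : ℤ))) := by
      simp only [map_prod, inX_qX]
    rw [map_smul, h2, qInt_xOp_prod _ _ _ (N := N), Finset.smul_sum]
    · refine Finset.sum_congr rfl fun k _ => ?_
      simp only [Fin.consEquiv_apply, Fin.prod_univ_succ, Fin.sum_univ_succ, Fin.cons_zero,
        Fin.cons_succ, ← h2, smul_smul, mul_assoc, sub_sub, add_comm]
      rw [mul_comm (∏ i, _) (∏ j, _)]
    · intro j
      have := h j
      have : 0 ≤ ∑ i, ((d i j : ℕ) : ℤ) := by positivity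
      omega

theorem rowLens_eq_ofFn (lam : YoungDiagram) :
    lam.rowLens = List.ofFn fun i : Fin (lam.colLen 0) => lam.rowLen i := by
  apply List.ext_get
  · simp [YoungDiagram.length_rowLens]
  · intro n h1 h2
    simp [YoungDiagram.get_rowLens]

/-- The coupled Hall-Littlewood function is obtained from the product of Hall-Littlewood
functions in `𝐱` and in `𝐲` by the substitution of operators. -/
theorem coupledQ_eq (lam mu : YoungDiagram) :
    coupledQ lam mu = coupling (inX (hallQ lam.rowLens) * inY (hallQ mu.rowLens)) := by
  set l := lam.colLen 0
  set m := mu.colLen 0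
  set v : Fin l → ℕ := fun i => lam.rowLen i
  set w : Fin m → ℕ := fun j => mu.rowLen j
  have hfin := finite_support_couplingTerm (fun i => (v i : ℤ)) (fun j => (w j : ℤ))
    (fun i => by positivity) (fun j => by positivity)
  -- All sums must run over common finite boxes. B bounds the exponents of the nonzero terms, N₁
  -- also exceeds both sizes as the Hall-Littlewood expansions require, and N₂ also exceeds every
  -- raised index of μ (bounded by C) as `coupling_prod` requires.
  obtain ⟨B, hB⟩ := (hfin.image fun e => ∑ p, e.1 p + ∑ p, e.2.1 p + ∑ p, e.2.2 p).bddAbove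
  have hB' : ∀ e ∈ Function.support (couplingTerm (fun i => (v i : ℤ)) fun j => (w j : ℤ)),
      ∑ p, e.1 p + ∑ p, e.2.1 p + ∑ p, e.2.2 p ≤ B := fun e he => hB ⟨e, he, rfl⟩
  set N₁ := B + ∑ i, v i + ∑ j, w j + 1 with hN₁
  obtain ⟨C, hC⟩ := (Set.finite_range fun x : (RowPair m → Fin N₁) × Fin m =>
    raise (fun p => (x.1 p : ℕ)) (fun j => (w j : ℤ)) x.2).bddAbove
  have hC' : ∀ (b : RowPair m → Fin N₁) j,
    raise (fun p => (b p : ℕ)) (fun j => (w j : ℤ)) j ≤ C := fun b j => hC ⟨(b, j), rfl⟩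
  set N₂ := B + C.toNat + 1 with hN₂
  let g : (RowPair l → Fin N₁) × (RowPair m → Fin N₁) × (Fin l → Fin m → Fin N₂) →
      (RowPair l → ℕ) × (RowPair m → ℕ) × (Fin l × Fin m → ℕ) :=
    fun x => (fun p => x.1 p, fun p => x.2.1 p, fun p => x.2.2 p.1 p.2)
  have hg : Function.Injective g := by
    rintro ⟨a, b, d⟩ ⟨a', b', d'⟩ h
    simp only [g, Prod.mk.injEq, funext_iff, Fin.val_inj, Prod.forall] at h
    obtain ⟨h1, h2, h3⟩ := h
    simp only [Prod.mk.injEq]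
    exact ⟨funext h1, funext h2, funext fun i => funext fun j => h3 i j⟩
  have h1 : coupledQ lam mu = ∑ x, couplingTerm (fun i => (v i : ℤ)) (fun j => (w j : ℤ)) (g x) := by
    have h2 : Function.support (couplingTerm (fun i => (v i : ℤ)) fun j => (w j : ℤ)) ⊆
        ((Finset.univ.map ⟨g, hg⟩ : Finset _) : Set _) := by
      rintro ⟨a, b, d⟩ he
      have h3 := hB' _ he
      simp only at h3
      have ha : ∀ p, a p ≤ ∑ p, a p := fun p => Finset.single_le_sum (fun _ _ => Nat.zero_le _) (Finset.mem_univ p)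
      have hb : ∀ p, b p ≤ ∑ p, b p := fun p => Finset.single_le_sum (fun _ _ => Nat.zero_le _) (Finset.mem_univ p)
      have hd : ∀ p, d p ≤ ∑ p, d p := fun p => Finset.single_le_sum (fun _ _ => Nat.zero_le _) (Finset.mem_univ p)
      simp only [Finset.coe_map, Finset.coe_univ, Set.image_univ, Set.mem_range,
        Function.Embedding.coeFn_mk]
      refine ⟨(fun p => ⟨a p, by have := ha p; omega⟩, fun p => ⟨b p, by have := hb p; omega⟩,
        fun i j => ⟨d (i, j), by have := hd (i, j); omega⟩), rfl⟩
    have h3 := finsum_eq_sum_of_support_subset _ h2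
    rw [Finset.sum_map] at h3
    exact h3
  rw [h1, rowLens_eq_ofFn, rowLens_eq_ofFn, hallQ_expansion l v (N := N₁) (by omega),
    hallQ_expansion m w (N := N₁) (by omega), map_sum, map_sum, Finset.sum_mul_sum, map_sum,
    Fintype.sum_prod_type]
  refine Finset.sum_congr rfl fun a _ => ?_
  rw [map_sum, Fintype.sum_prod_type]
  refine Finset.sum_congr rfl fun b _ => ?_
  simp only [map_smul, map_prod, inX_qX, inY_qX]
  rw [smul_mul_smul_comm, map_smul, coupling_prod (N := N₂)
    (h := fun j => by have := hC' b j; omega), Finset.smul_sum]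
  refine Finset.sum_congr rfl fun d _ => ?_
  simp only [g, couplingTerm, smul_smul, Fintype.prod_prod_type]

/-! ### Unitriangular families -/

section Triangular

variable {ι F V : Type*} [Field F] [AddCommGroup V] [Module F V]

/-- In a vanishing combination take an index of maximal rank: its basis vector occurs in no other
member of the support, since corrections have strictly smaller rank. -/
theorem linearIndependent_of_triangular (b : Module.Basis ι F V) (rk : ι → ℕ) (f : ι → V)
    (h : ∀ i, f i - b i ∈ Submodule.span F (b '' {j | rk j < rk i})) : LinearIndependent F f := by
  classical
  rw [linearIndependent_iff]
  intro c hc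
  by_contra hne
  obtain ⟨i, hi, hmax⟩ := Finset.exists_max_image c.support rk (Finsupp.support_nonempty_iff.2 hne)
  have h1 : ∀ j ∈ c.support, b.repr (f j) i = if j = i then 1 else 0 := by
    intro j hj
    have h2 : f j = b j + (f j - b j) := by abel
    have h3 : b.repr (f j - b j) i = 0 := by
      by_contra h4
      have h5 := (b.mem_span_image.1 (h j)) (Finsupp.mem_support_iff.2 h4)
      exact absurd (hmax j hj) (not_le.2 h5)
    rw [h2, map_add, Finsupp.add_apply, h3, b.repr_self, add_zero, Finsupp.single_apply]
  have h2 := congrArg (fun x => b.repr x i) hc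
  simp only [Finsupp.linearCombination_apply, Finsupp.sum, map_sum, map_smul, map_zero,
    Finsupp.coe_finsetSum, Finset.sum_apply, Finsupp.smul_apply, Finsupp.zero_apply] at h2
  rw [Finset.sum_congr rfl fun j hj => by rw [h1 j hj]] at h2
  simp only [smul_eq_mul, mul_ite, mul_one, mul_zero, Finset.sum_ite_eq', if_pos hi] at h2
  exact Finsupp.mem_support_iff.1 hi h2

theorem span_eq_top_of_triangular (b : Module.Basis ι F V) (rk : ι → ℕ) (f : ι → V)
    (h : ∀ i, f i - b i ∈ Submodule.span F (b '' {j | rk j < rk i})) :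
    Submodule.span F (Set.range f) = ⊤ := by
  have h1 : ∀ n i, rk i = n → b i ∈ Submodule.span F (Set.range f) := by
    intro n
    induction n using Nat.strong_induction_on with
    | _ n ih =>
      intro i hi
      have h2 : Submodule.span F (b '' {j | rk j < rk i}) ≤ Submodule.span F (Set.range f) := by
        rw [Submodule.span_le]
        rintro _ ⟨j, hj, rfl⟩
        exact ih (rk j) (hi ▸ hj) j rfl
      have h3 : b i = f i - (f i - b i) := by abel
      rw [h3]
      exact Submodule.sub_mem _ (Submodule.subset_span ⟨i, rfl⟩) (h2 (h i))
  rw [eq_top_iff, ← b.span_eq, Submodule.span_le]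
  rintro _ ⟨i, rfl⟩
  exact h1 _ i rfl

end Triangular

/-! ### The basis of products of the `qₙ(𝐱)` and `qₙ(𝐲)` -/

/-- The variable `xₙ`, with `x₀ = 1`. -/
def varOrOne (n : ℕ) : Lam := if h : 0 < n then MvPolynomial.X ⟨n, h⟩ else 1

theorem varOrOne_succ (n : ℕ) : varOrOne (n + 1) = MvPolynomial.X n.succPNat :=
  dif_pos n.succ_pos

/-- The polynomial in `q₁, q₂, …` expressing `x_{n+1}`. -/
def varInQ (n : ℕ) : Lam :=
  (((n : K) + 1) * (1 - t ^ (n + 1)))⁻¹ • (((n : K) + 1) • MvPolynomial.X n.succPNat -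
    ∑ k : Fin n, (((k : ℕ) : K) + 1) • (1 - t ^ ((k : ℕ) + 1)) •
      (varInQ k * varOrOne (n - k)))
termination_by n
decreasing_by exact k.2

theorem newton_coeff_ne_zero (n : ℕ) : ((n : K) + 1) * (1 - t ^ (n + 1)) ≠ 0 :=
  mul_ne_zero (by exact_mod_cast Nat.succ_ne_zero n) (t_pow_ne_one n.succ_pos)

/-- Newton's identity with qⱼ read as the variable xⱼ. It can be solved for the last unknown because
(n+1)(1-t^{n+1}) ≠ 0. -/
theorem varInQ_spec (n : ℕ) : ((n : K) + 1) • (MvPolynomial.X n.succPNat : Lam) =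
    ∑ k ∈ Finset.range (n + 1), (((k : K) + 1) * (1 - t ^ (k + 1))) •
      (varInQ k * varOrOne (n - k)) := by
  have h : (((n : K) + 1) * (1 - t ^ (n + 1))) • varInQ n = ((n : K) + 1) •
      (MvPolynomial.X n.succPNat : Lam) - ∑ k ∈ Finset.range n,
        (((k : K) + 1) * (1 - t ^ (k + 1))) • (varInQ k * varOrOne (n - k)) := by
    rw [varInQ, smul_smul, mul_inv_cancel₀ (newton_coeff_ne_zero n), one_smul,
      Fin.sum_univ_eq_sum_range (fun k => ((k : K) + 1) • (1 - t ^ (k + 1)) •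
        (varInQ k * varOrOne (n - k)))]
    simp only [smul_smul]
  rw [Finset.sum_range_succ, Nat.sub_self, show varOrOne 0 = 1 from rfl, mul_one, h]
  abel

theorem qFun_varInQ (n : ℕ) : qFun (fun n : ℕ+ => varInQ n.natPred) n = varOrOne n := by
  induction n using Nat.strong_induction_on with
  | _ n ih =>
    cases n with
    | zero => exact qFun_zero _
    | succ n =>
      have h1 := newton_qFun_of_commute (fun n : ℕ+ => varInQ n.natPred)
        (fun i j => mul_comm _ _) n
      have h2 : (n : K) + 1 ≠ 0 := by exact_mod_cast Nat.succ_ne_zero n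
      apply smul_right_injective _ h2
      simp only
      rw [h1, varOrOne_succ, varInQ_spec]
      refine Finset.sum_congr rfl fun k _ => ?_
      rw [ih (n - k) (by omega), Nat.natPred_succPNat]

/-- The substitution `xₙ ↦ qₙ(𝐱)`. -/
def qSubst : Lam →ₐ[K] Lam := MvPolynomial.aeval fun n : ℕ+ => qX (n : ℕ)

theorem qSubst_varOrOne (n : ℕ) : qSubst (varOrOne n) = qX n := by
  unfold varOrOne
  split_ifs with h
  · exact MvPolynomial.aeval_X _ _
  · have : n = 0 := by omega
    subst this
    rw [map_one, qX_natCast, qFun_zero]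

theorem qSubst_varInQ (n : ℕ) : qSubst (varInQ n) = MvPolynomial.X n.succPNat := by
  induction n using Nat.strong_induction_on with
  | _ n ih =>
    have h1 := congrArg qSubst (varInQ_spec n)
    have h2 := newton_qFun_of_commute (MvPolynomial.X : ℕ+ → Lam) (fun i j => mul_comm _ _) n
    rw [map_smul, ← varOrOne_succ, qSubst_varOrOne, qX_natCast, h2, map_sum,
      Finset.sum_range_succ, Finset.sum_range_succ] at h1
    have h3 : ∀ k ∈ Finset.range n, (((k : K) + 1) * (1 - t ^ (k + 1))) •
        ((MvPolynomial.X k.succPNat : Lam) * qFun MvPolynomial.X (n - k)) =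
        qSubst ((((k : K) + 1) * (1 - t ^ (k + 1))) • (varInQ k * varOrOne (n - k))) := by
      intro k hk
      rw [map_smul, map_mul, ih k (Finset.mem_range.1 hk), qSubst_varOrOne, qX_natCast]
    rw [Finset.sum_congr rfl h3, add_left_cancel_iff, map_smul, map_mul, Nat.sub_self,
      qSubst_varOrOne, qX_natCast, qFun_zero, mul_one, mul_one] at h1
    exact (smul_right_injective _ (newton_coeff_ne_zero n) h1).symm

/-- The automorphism `xₙ ↦ qₙ(𝐱)`, `yₙ ↦ qₙ(𝐲)` of `ℂ(t)[𝐱, 𝐲]`. -/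
def qEquiv : Poly ≃ₐ[K] Poly :=
  AlgEquiv.ofAlgHom
    (MvPolynomial.aeval (Sum.elim (fun n : ℕ+ => inX (qX (n : ℕ))) fun n : ℕ+ => inY (qX (n : ℕ))))
    (MvPolynomial.aeval (Sum.elim (fun n : ℕ+ => inX (varInQ n.natPred))
      fun n : ℕ+ => inY (varInQ n.natPred)))
    (by
      have hx : (MvPolynomial.aeval (R := K) (Sum.elim (fun n : ℕ+ => inX (qX (n : ℕ)))
          fun n : ℕ+ => inY (qX (n : ℕ)))).comp inX = inX.comp qSubst := by
        apply MvPolynomial.algHom_ext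
        intro n
        simp [inX, qSubst]
      have hy : (MvPolynomial.aeval (R := K) (Sum.elim (fun n : ℕ+ => inX (qX (n : ℕ)))
          fun n : ℕ+ => inY (qX (n : ℕ)))).comp inY = inY.comp qSubst := by
        apply MvPolynomial.algHom_ext
        intro n
        simp [inY, qSubst]
      apply MvPolynomial.algHom_ext
      rintro (n | n)
      · have := DFunLike.congr_fun hx (varInQ n.natPred)
        simp only [AlgHom.comp_apply, qSubst_varInQ, PNat.succPNat_natPred] at this
        simp only [AlgHom.comp_apply, MvPolynomial.aeval_X, Sum.elim_inl, this]
        simp [inX]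
      · have := DFunLike.congr_fun hy (varInQ n.natPred)
        simp only [AlgHom.comp_apply, qSubst_varInQ, PNat.succPNat_natPred] at this
        simp only [AlgHom.comp_apply, MvPolynomial.aeval_X, Sum.elim_inr, this]
        simp [inY])
    (by
      have hq : ∀ n : ℕ+, qFun (fun n : ℕ+ => varInQ n.natPred) n = MvPolynomial.X n := by
        intro n
        rw [qFun_varInQ, ← PNat.natPred_add_one, varOrOne_succ, PNat.succPNat_natPred]
      apply MvPolynomial.algHom_ext
      rintro (n | n)
      · simp only [AlgHom.comp_apply, MvPolynomial.aeval_X, Sum.elim_inl, inX_qX, map_qInt, xVar]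
        rw [qInt_natCast, ← map_qFun, hq]
        simp [inX]
      · simp only [AlgHom.comp_apply, MvPolynomial.aeval_X, Sum.elim_inr, inY_qX, map_qInt, yVar]
        rw [qInt_natCast, ← map_qFun, hq]
        simp [inY])

/-- The exponent of the monomial `z_{inj n}`, where the `0`-th variable is `1`. -/
def expo (inj : ℕ+ → ℕ+ ⊕ ℕ+) (n : ℕ) : ℕ+ ⊕ ℕ+ →₀ ℕ :=
  if h : 0 < n then Finsupp.single (inj ⟨n, h⟩) 1 else 0

theorem qEquiv_expo_inl (n : ℕ) :
    qEquiv (MvPolynomial.monomial (expo Sum.inl n) 1) = qInt xVar n := by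
  unfold expo
  split_ifs with h
  · change qEquiv (MvPolynomial.X (Sum.inl ⟨n, h⟩)) = _
    simp [qEquiv, inX_qX]
    rfl
  · have : n = 0 := by omega
    subst this
    rw [MvPolynomial.monomial_zero', map_one, map_one, qInt_natCast, qFun_zero]

theorem qEquiv_expo_inr (n : ℕ) :
    qEquiv (MvPolynomial.monomial (expo Sum.inr n) 1) = qInt yVar n := by
  unfold expo
  split_ifs with h
  · change qEquiv (MvPolynomial.X (Sum.inr ⟨n, h⟩)) = _
    simp [qEquiv, inY_qX]
    rfl
  · have : n = 0 := by omega
    subst this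
    rw [MvPolynomial.monomial_zero', map_one, map_one, qInt_natCast, qFun_zero]

/-- The weight `∑ₙ n` of a monomial. -/
def degWt : (ℕ+ ⊕ ℕ+ →₀ ℕ) →+ ℕ := Finsupp.weight (Sum.elim (fun n : ℕ+ => (n : ℕ)) fun n : ℕ+ => (n : ℕ))

/-- The sum of the squares of the parts of a monomial. -/
def sqWt : (ℕ+ ⊕ ℕ+ →₀ ℕ) →+ ℕ :=
  Finsupp.weight (Sum.elim (fun n : ℕ+ => (n : ℕ) ^ 2) fun n : ℕ+ => (n : ℕ) ^ 2)

theorem sqWt_le (α : ℕ+ ⊕ ℕ+ →₀ ℕ) : sqWt α ≤ degWt α ^ 2 := by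
  induction α using Finsupp.induction_linear with
  | zero => simp
  | add f g hf hg =>
    rw [map_add, map_add]
    nlinarith [Nat.zero_le (degWt f * degWt g)]
  | single s k =>
    rw [sqWt, degWt, Finsupp.weight_single, Finsupp.weight_single]
    have h : k ≤ k ^ 2 := Nat.le_self_pow (by norm_num) k
    rcases s with n | n <;> simp only [Sum.elim_inl, Sum.elim_inr, smul_eq_mul, mul_pow] <;>
      exact Nat.mul_le_mul_right _ h

/-- A rank for which the coupled Hall-Littlewood functions are unitriangular. -/
def rankWt (α : ℕ+ ⊕ ℕ+ →₀ ℕ) : ℕ := (degWt α + 1) ^ 3 - sqWt α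

/-- The sum of squares is at most d² in degree d, and (d+1)³ - d² > d³, so the cube makes the degree
dominate. -/
theorem rankWt_lt_of_degWt_lt {α β : ℕ+ ⊕ ℕ+ →₀ ℕ} (h : degWt β < degWt α) :
    rankWt β < rankWt α := by
  have h1 := sqWt_le α
  have h2 : (degWt β + 1) ^ 3 ≤ degWt α ^ 3 := Nat.pow_le_pow_left h 3
  have h3 : (degWt α + 1) ^ 3 = degWt α ^ 3 + 3 * degWt α ^ 2 + 3 * degWt α + 1 := by ring
  unfold rankWt
  omega

theorem rankWt_lt_of_sqWt_lt {α β : ℕ+ ⊕ ℕ+ →₀ ℕ} (h : degWt β = degWt α)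
    (h' : sqWt α < sqWt β) : rankWt β < rankWt α := by
  have h1 := sqWt_le β
  have h3 : (degWt α + 1) ^ 3 = degWt α ^ 3 + 3 * degWt α ^ 2 + 3 * degWt α + 1 := by ring
  unfold rankWt
  rw [h] at *
  omega

/-- The exponent of `∏ᵢ z_{vᵢ} ∏ⱼ z_{wⱼ}`. -/
def expoVec {l m : ℕ} (v : Fin l → ℕ) (w : Fin m → ℕ) : ℕ+ ⊕ ℕ+ →₀ ℕ :=
  ∑ i, expo Sum.inl (v i) + ∑ j, expo Sum.inr (w j)

theorem degWt_expoVec {l m : ℕ} (v : Fin l → ℕ) (w : Fin m → ℕ) :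
    degWt (expoVec v w) = ∑ i, v i + ∑ j, w j := by
  have h1 : ∀ n, degWt (expo Sum.inl n) = n := fun n => by
    unfold expo
    split_ifs with h
    · simp [degWt, Finsupp.weight_single]
      rfl
    · simp; omega
  have h2 : ∀ n, degWt (expo Sum.inr n) = n := fun n => by
    unfold expo
    split_ifs with h
    · simp [degWt, Finsupp.weight_single]
      rfl
    · simp; omega
  rw [expoVec, map_add, map_sum, map_sum]
  simp only [h1, h2]

theorem sqWt_expoVec {l m : ℕ} (v : Fin l → ℕ) (w : Fin m → ℕ) :
    sqWt (expoVec v w) = ∑ i, v i ^ 2 + ∑ j, w j ^ 2 := by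
  have h1 : ∀ n, sqWt (expo Sum.inl n) = n ^ 2 := fun n => by
    unfold expo
    split_ifs with h
    · simp [sqWt, Finsupp.weight_single]
      rfl
    · have : n = 0 := by omega
      simp [this]
  have h2 : ∀ n, sqWt (expo Sum.inr n) = n ^ 2 := fun n => by
    unfold expo
    split_ifs with h
    · simp [sqWt, Finsupp.weight_single]
      rfl
    · have : n = 0 := by omega
      simp [this]
  rw [expoVec, map_add, map_sum, map_sum]
  simp only [h1, h2]

/-- The basis formed by the products of the `qₙ(𝐱)` and `qₙ(𝐲)`. -/
def qBasis : Module.Basis (ℕ+ ⊕ ℕ+ →₀ ℕ) K Poly :=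
  (MvPolynomial.basisMonomials _ K).map qEquiv.toLinearEquiv

theorem qBasis_expoVec {l m : ℕ} (v : Fin l → ℕ) (w : Fin m → ℕ) :
    qBasis (expoVec v w) = (∏ i, qInt xVar (v i)) * ∏ j, qInt yVar (w j) := by
  have h : ∀ (k : ℕ) (f : Fin k → ℕ+ ⊕ ℕ+ →₀ ℕ),
      (MvPolynomial.monomial (∑ i, f i) 1 : Poly) = ∏ i, MvPolynomial.monomial (f i) 1 := by
    intro k f
    exact MvPolynomial.monomial_sum_one _ _
  rw [qBasis, Module.Basis.map_apply, MvPolynomial.coe_basisMonomials, expoVec]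
  change qEquiv (MvPolynomial.monomial _ (1 : K)) = _
  rw [← mul_one (1 : K), ← MvPolynomial.monomial_mul, h, h, map_mul, map_prod, map_prod]
  simp only [qEquiv_expo_inl, qEquiv_expo_inr]

/-! ### The basis of coupled Hall-Littlewood functions -/

/-- Raising adds δ = ∑ a_{ij}(eᵢ - eⱼ), and ⟨δ, v⟩ = ∑ a_{ij}(vᵢ - vⱼ) ≥ 0 for decreasing v, so
|v+δ|² ≥ |v|² + |δ|². Moreover δ = 0 forces a = 0, by the tail sums in `sum_raise_ge`. -/
theorem sum_sq_le_sum_raise_sq {l : ℕ} (a : RowPair l → ℕ) (v : Fin l → ℤ) (hv : Antitone v) :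
    ∑ k, v k ^ 2 ≤ ∑ k, raise a v k ^ 2 ∧ (a ≠ 0 → ∑ k, v k ^ 2 < ∑ k, raise a v k ^ 2) := by
  set δ : Fin l → ℤ := fun k => raise a v k - v k with hδ
  have h1 : ∑ k, raise a v k ^ 2 = ∑ k, v k ^ 2 + 2 * ∑ k, δ k * v k + ∑ k, δ k ^ 2 := by
    rw [Finset.mul_sum, ← Finset.sum_add_distrib, ← Finset.sum_add_distrib]
    refine Finset.sum_congr rfl fun k _ => ?_
    simp only [hδ]
    ring
  have h2 : 0 ≤ ∑ k, δ k * v k := by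
    have h3 : ∑ k, δ k * v k = ∑ p : RowPair l, (a p : ℤ) * (v p.1.1 - v p.1.2) := by
      have h4 : ∀ k, δ k * v k = ∑ p : RowPair l,
          ((if p.1.1 = k then (a p : ℤ) else 0) * v k - (if p.1.2 = k then (a p : ℤ) else 0) * v k) := by
        intro k
        simp only [hδ, raise]
        rw [Finset.sum_sub_distrib, ← Finset.sum_mul, ← Finset.sum_mul]
        ring
      simp only [h4]
      rw [Finset.sum_comm]
      refine Finset.sum_congr rfl fun p _ => ?_
      simp only [ite_mul, zero_mul, Finset.sum_sub_distrib, Finset.sum_ite_eq, Finset.mem_univ,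
        if_true]
      ring
    rw [h3]
    refine Finset.sum_nonneg fun p _ => mul_nonneg (by positivity) (sub_nonneg.2 (hv p.2.le))
  have h3 : 0 ≤ ∑ k, δ k ^ 2 := Finset.sum_nonneg fun k _ => sq_nonneg _
  refine ⟨by linarith, fun ha => ?_⟩
  have h4 : 0 < ∑ k, δ k ^ 2 := by
    refine lt_of_le_of_ne h3 fun h5 => ha ?_
    have h6 : ∀ k, raise a v k = v k := fun k => by
      have := (Finset.sum_eq_zero_iff_of_nonneg fun k _ => sq_nonneg (δ k)).1 h5.symm k
        (Finset.mem_univ k)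
      have := pow_eq_zero_iff (two_ne_zero) |>.1 this
      simp only [hδ] at this
      linarith
    funext p
    have h7 := sum_raise_ge a v p
    simp only [h6] at h7
    have : (a p : ℤ) ≤ 0 := by linarith
    simp only [Pi.zero_apply]
    omega
  linarith

/-- The exponent belonging to a pair of partitions. -/
def diagramExpo (s : YoungDiagram × YoungDiagram) : ℕ+ ⊕ ℕ+ →₀ ℕ :=
  expoVec (fun i : Fin (s.1.colLen 0) => s.1.rowLen i) fun j : Fin (s.2.colLen 0) => s.2.rowLen j

theorem raise_zero_left {l : ℕ} (v : Fin l → ℤ) : raise 0 v = v := by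
  funext k
  simp [raise]

theorem couplingTerm_zero {l m : ℕ} (v : Fin l → ℤ) (w : Fin m → ℤ) :
    couplingTerm v w 0 = (∏ i, qInt xVar (v i)) * ∏ j, qInt yVar (w j) := by
  have h1 := coeff_zero_raisingSeries
  have h2 := coeff_zero_couplingSeries
  simp only [couplingTerm, Prod.fst_zero, Prod.snd_zero, Pi.zero_apply, h1, h2, raise_zero_left]
  simp

/-- A nonzero term is a multiple of one basis vector, its indices being reorderable. Some D-operator
lowers the degree; without one, a nontrivial raising keeps the degree and increases the sum of
squares. Both lower the rank. -/
theorem couplingTerm_mem_span {l m : ℕ} (v : Fin l → ℕ) (w : Fin m → ℕ) (hv : Antitone v)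
    (hw : Antitone w) (e : (RowPair l → ℕ) × (RowPair m → ℕ) × (Fin l × Fin m → ℕ)) (he : e ≠ 0) :
    couplingTerm (fun i => (v i : ℤ)) (fun j => (w j : ℤ)) e ∈
      Submodule.span K (qBasis '' {β | rankWt β < rankWt (expoVec v w)}) := by
  obtain ⟨a, b, d⟩ := e
  by_cases hx : ∀ i, 0 ≤ raise a (fun i => (v i : ℤ)) i - ∑ j, (d (i, j) : ℤ)
  swap
  · push Not at hx
    obtain ⟨i, hi⟩ := hx
    rw [couplingTerm, Finset.prod_eq_zero (Finset.mem_univ i) (qInt_of_neg _ hi), zero_mul,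
      smul_zero]
    exact Submodule.zero_mem _
  by_cases hy : ∀ j, 0 ≤ raise b (fun j => (w j : ℤ)) j - ∑ i, (d (i, j) : ℤ)
  swap
  · push Not at hy
    obtain ⟨j, hj⟩ := hy
    rw [couplingTerm, Finset.prod_eq_zero (Finset.mem_univ j) (qInt_of_neg _ hj), mul_zero,
      smul_zero]
    exact Submodule.zero_mem _
  choose v' hv' using fun i => Int.eq_ofNat_of_zero_le (hx i)
  choose w' hw' using fun j => Int.eq_ofNat_of_zero_le (hy j)
  rw [couplingTerm]
  simp only [hv', hw']
  rw [← qBasis_expoVec]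
  refine Submodule.smul_mem _ _ (Submodule.subset_span ⟨_, ?_, rfl⟩)
  have hav : Antitone fun i => (v i : ℤ) := fun i j h => Int.ofNat_le.2 (hv h)
  have haw : Antitone fun i => (w i : ℤ) := fun i j h => Int.ofNat_le.2 (hw h)
  have sv : ∑ i, (v' i : ℤ) = ∑ i, (v i : ℤ) - ∑ i, ∑ j, (d (i, j) : ℤ) := by
    rw [← sum_raise a fun i => (v i : ℤ), ← Finset.sum_sub_distrib]
    exact Finset.sum_congr rfl fun i _ => (hv' i).symm
  have sw : ∑ j, (w' j : ℤ) = ∑ j, (w j : ℤ) - ∑ j, ∑ i, (d (i, j) : ℤ) := by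
    rw [← sum_raise b fun j => (w j : ℤ), ← Finset.sum_sub_distrib]
    exact Finset.sum_congr rfl fun i _ => (hw' i).symm
  by_cases hd : d = 0
  · subst hd
    simp only [Pi.zero_apply, Nat.cast_zero, Finset.sum_const_zero, sub_zero] at sv sw hv' hw'
    apply rankWt_lt_of_sqWt_lt
    · rw [degWt_expoVec, degWt_expoVec]
      have h1 : ∑ i, v' i = ∑ i, v i := by exact_mod_cast sv
      have h2 : ∑ i, w' i = ∑ i, w i := by exact_mod_cast sw
      rw [h1, h2]
    · rw [sqWt_expoVec, sqWt_expoVec]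
      obtain ⟨h1, h1'⟩ := sum_sq_le_sum_raise_sq a _ hav
      obtain ⟨h2, h2'⟩ := sum_sq_le_sum_raise_sq b _ haw
      simp only [hv', hw'] at h1 h1' h2 h2'
      have h3 : a ≠ 0 ∨ b ≠ 0 := by
        by_contra h
        push Not at h
        exact he (by rw [h.1, h.2]; rfl)
      norm_cast at h1 h1' h2 h2'
      rcases h3 with h3 | h3
      · have := h1' h3; omega
      · have := h2' h3; omega
  · apply rankWt_lt_of_degWt_lt
    rw [degWt_expoVec, degWt_expoVec]
    have h1 : 0 < ∑ i, ∑ j, (d (i, j) : ℤ) := by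
      obtain ⟨⟨i, j⟩, hij⟩ := Function.ne_iff.1 hd
      refine Finset.sum_pos' (fun _ _ => by positivity) ⟨i, Finset.mem_univ i, ?_⟩
      refine Finset.sum_pos' (fun _ _ => by positivity) ⟨j, Finset.mem_univ j, ?_⟩
      have : d (i, j) ≠ 0 := hij
      omega
    rw [Finset.sum_comm] at sw
    zify
    linarith

theorem coupledQ_sub_mem_span (s : YoungDiagram × YoungDiagram) :
    coupledQ s.1 s.2 - qBasis (diagramExpo s) ∈
      Submodule.span K (qBasis '' {β | rankWt β < rankWt (diagramExpo s)}) := by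
  classical
  have hfin := finite_support_couplingTerm (fun i : Fin (s.1.colLen 0) => (s.1.rowLen i : ℤ))
    (fun j : Fin (s.2.colLen 0) => (s.2.rowLen j : ℤ)) (fun i => by positivity)
    (fun j => by positivity)
  rw [coupledQ, finsum_eq_sum_of_support_subset (s := insert 0 hfin.toFinset) _ (by
    intro e he
    simp only [Finset.coe_insert, Set.Finite.coe_toFinset]
    exact Or.inr he), ← Finset.add_sum_erase _ _ (Finset.mem_insert_self _ _), couplingTerm_zero,
    diagramExpo, qBasis_expoVec, add_sub_cancel_left]
  refine Submodule.sum_mem _ fun e he => ?_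
  exact couplingTerm_mem_span (fun i : Fin (s.1.colLen 0) => s.1.rowLen i)
    (fun j : Fin (s.2.colLen 0) => s.2.rowLen j) (fun i j h => s.1.rowLen_anti _ _ h)
    (fun i j h => s.2.rowLen_anti _ _ h) e (Finset.ne_of_mem_erase he)

theorem sum_expo_apply {inj : ℕ+ → ℕ+ ⊕ ℕ+} (hinj : Function.Injective inj) (l : List ℕ) (n : ℕ+) :
    (l.map (expo inj)).sum (inj n) = l.count (n : ℕ) := by
  induction l with
  | nil => simp
  | cons k l ih =>
    rw [List.map_cons, List.sum_cons, Finsupp.add_apply, ih, List.count_cons, expo, add_comm]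
    congr 1
    have h1 : (k == (n : ℕ)) = decide (k = n) := rfl
    rw [h1]
    split_ifs with h2 h3 h3
    · have : (⟨k, h2⟩ : ℕ+) = n := PNat.eq (by simpa using h3)
      rw [this]
      simp
    · rw [Finsupp.single_apply, if_neg]
      intro h4
      apply h3
      have := congrArg PNat.val (hinj h4)
      simpa using this
    · have := n.pos
      simp at h3
      omega
    · rfl

theorem sum_expo_apply_of_ne {inj : ℕ+ → ℕ+ ⊕ ℕ+} (l : List ℕ) (s : ℕ+ ⊕ ℕ+)
    (h : ∀ n, inj n ≠ s) : (l.map (expo inj)).sum s = 0 := by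
  induction l with
  | nil => simp
  | cons k l ih =>
    rw [List.map_cons, List.sum_cons, Finsupp.add_apply, ih, expo]
    split_ifs
    · exact (add_zero _).trans (Finsupp.single_eq_of_ne (h _).symm)
    · simp

theorem diagramExpo_eq (s : YoungDiagram × YoungDiagram) :
    diagramExpo s = (s.1.rowLens.map (expo Sum.inl)).sum + (s.2.rowLens.map (expo Sum.inr)).sum := by
  rw [rowLens_eq_ofFn, rowLens_eq_ofFn, List.map_ofFn, List.map_ofFn, List.sum_ofFn, List.sum_ofFn]
  rfl

theorem diagramExpo_inl (s : YoungDiagram × YoungDiagram) (n : ℕ+) :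
    diagramExpo s (Sum.inl n) = s.1.rowLens.count (n : ℕ) := by
  rw [diagramExpo_eq, Finsupp.add_apply, sum_expo_apply Sum.inl_injective,
    sum_expo_apply_of_ne _ _ (by simp), add_zero]

theorem diagramExpo_inr (s : YoungDiagram × YoungDiagram) (n : ℕ+) :
    diagramExpo s (Sum.inr n) = s.2.rowLens.count (n : ℕ) := by
  rw [diagramExpo_eq, Finsupp.add_apply, sum_expo_apply Sum.inr_injective,
    sum_expo_apply_of_ne _ _ (by simp), zero_add]

theorem youngDiagram_ext_count {lam mu : YoungDiagram}
    (h : ∀ n : ℕ+, lam.rowLens.count (n : ℕ) = mu.rowLens.count (n : ℕ)) : lam = mu := by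
  have h1 : lam.rowLens.Perm mu.rowLens := by
    rw [List.perm_iff_count]
    intro n
    rcases Nat.eq_zero_or_pos n with rfl | hn
    · rw [List.count_eq_zero_of_not_mem, List.count_eq_zero_of_not_mem]
      · exact fun h => absurd (mu.pos_of_mem_rowLens 0 h) (lt_irrefl 0)
      · exact fun h => absurd (lam.pos_of_mem_rowLens 0 h) (lt_irrefl 0)
    · exact h ⟨n, hn⟩
  have h2 : lam.rowLens = mu.rowLens :=
    h1.eq_of_pairwise' lam.rowLens_sorted.pairwise mu.rowLens_sorted.pairwise
  apply YoungDiagram.equivListRowLens.injective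
  exact Subtype.ext h2

/-- The Young diagram with the given multiset of parts. -/
def diagramOfParts (s : Multiset ℕ) : YoungDiagram :=
  YoungDiagram.ofRowLens (s.sort (· ≥ ·)) (Multiset.pairwise_sort _ _).sortedGE

theorem rowLens_diagramOfParts {s : Multiset ℕ} (h : ∀ n ∈ s, 0 < n) :
    (diagramOfParts s).rowLens = s.sort (· ≥ ·) :=
  YoungDiagram.rowLens_ofRowLens_eq_self fun n hn => h n ((Multiset.mem_sort _).1 hn)

theorem exists_youngDiagram_count (α : ℕ+ →₀ ℕ) :
    ∃ lam : YoungDiagram, ∀ n : ℕ+, lam.rowLens.count (n : ℕ) = α n := by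
  refine ⟨diagramOfParts ((Finsupp.toMultiset α).map PNat.val), fun n => ?_⟩
  rw [rowLens_diagramOfParts, ← Multiset.coe_count, Multiset.sort_eq,
    Multiset.count_map_eq_count' _ _ PNat.coe_injective, Finsupp.count_toMultiset]
  intro k hk
  obtain ⟨m, -, rfl⟩ := Multiset.mem_map.1 hk
  exact m.pos

/-- A partition is determined by the multiplicities of its positive parts, which are exactly the
exponents of a monomial. -/
theorem diagramExpo_bijective : Function.Bijective diagramExpo := by
  constructor
  · rintro ⟨a, b⟩ ⟨a', b'⟩ h
    have h1 : a = a' := youngDiagram_ext_count fun n => by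
      have := DFunLike.congr_fun h (Sum.inl n)
      rwa [diagramExpo_inl, diagramExpo_inl] at this
    have h2 : b = b' := youngDiagram_ext_count fun n => by
      have := DFunLike.congr_fun h (Sum.inr n)
      rwa [diagramExpo_inr, diagramExpo_inr] at this
    rw [h1, h2]
  · intro α
    obtain ⟨a, ha⟩ := exists_youngDiagram_count (α.comapDomain Sum.inl Sum.inl_injective.injOn)
    obtain ⟨b, hb⟩ := exists_youngDiagram_count (α.comapDomain Sum.inr Sum.inr_injective.injOn)
    refine ⟨(a, b), ?_⟩
    ext (n | n)
    · rw [diagramExpo_inl, ha, Finsupp.comapDomain_apply]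
    · rw [diagramExpo_inr, hb, Finsupp.comapDomain_apply]

/-- The basis of the products `q_λ(𝐱) q_μ(𝐲)`. -/
def diagramBasis : Module.Basis (YoungDiagram × YoungDiagram) K Poly :=
  qBasis.reindex (Equiv.ofBijective _ diagramExpo_bijective).symm

theorem coupledQ_triangular (s : YoungDiagram × YoungDiagram) :
    coupledQ s.1 s.2 - diagramBasis s ∈ Submodule.span K
      (diagramBasis '' {s' | rankWt (diagramExpo s') < rankWt (diagramExpo s)}) := by
  have h1 : ∀ s, diagramBasis s = qBasis (diagramExpo s) := fun s => by
    rw [diagramBasis, Module.Basis.reindex_apply]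
    rfl
  have h2 := coupledQ_sub_mem_span s
  rw [h1]
  refine Submodule.span_mono ?_ h2
  rintro _ ⟨β, hβ, rfl⟩
  obtain ⟨s', rfl⟩ := diagramExpo_bijective.2 β
  exact ⟨s', hβ, h1 s'⟩

theorem linearIndependent_coupledQ :
    LinearIndependent K fun s : YoungDiagram × YoungDiagram => coupledQ s.1 s.2 :=
  linearIndependent_of_triangular diagramBasis (fun s => rankWt (diagramExpo s)) _
    coupledQ_triangular

theorem span_coupledQ :
    Submodule.span K (Set.range fun s : YoungDiagram × YoungDiagram => coupledQ s.1 s.2) = ⊤ :=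
  span_eq_top_of_triangular diagramBasis (fun s => rankWt (diagramExpo s)) _
    coupledQ_triangular

theorem isCompl_boxSpace_tailSpace (M₁ M₂ : ℕ) : IsCompl (boxSpace M₁ M₂) (tailSpace M₁ M₂) := by
  set S : Set (YoungDiagram × YoungDiagram) := {s | s.1.rowLen 0 ≤ M₁ ∧ s.2.rowLen 0 ≤ M₂} with hS
  have h1 : boxSpace M₁ M₂ = Submodule.span K ((fun s => coupledQ s.1 s.2) '' S) := by
    rw [boxSpace]
    congr 1
    ext f
    constructor
    · rintro ⟨a, b, h, rfl⟩
      exact ⟨(a, b), h, rfl⟩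
    · rintro ⟨⟨a, b⟩, h, rfl⟩
      exact ⟨a, b, h, rfl⟩
  have h2 : tailSpace M₁ M₂ = Submodule.span K ((fun s => coupledQ s.1 s.2) '' Sᶜ) := by
    rw [tailSpace]
    congr 1
    ext f
    constructor
    · rintro ⟨a, b, h, rfl⟩
      exact ⟨(a, b), h, rfl⟩
    · rintro ⟨⟨a, b⟩, h, rfl⟩
      exact ⟨a, b, h, rfl⟩
  rw [h1, h2]
  constructor
  · exact linearIndependent_coupledQ.disjoint_span_image disjoint_compl_right
  · rw [codisjoint_iff, ← Submodule.span_union, ← Set.image_union, Set.union_compl_self,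
      Set.image_univ, span_coupledQ]

/-! ### The Pieri rule -/

/-- The sequence `0, f₀, f₁, …`. -/
def shiftSeq (f : ℕ → Lam) : ℕ → Lam
  | 0 => 0
  | r + 1 => f r

theorem shiftSeq_succ (f : ℕ → Lam) (r : ℕ) : shiftSeq f (r + 1) = f r := rfl

/-- `q_r f = A_r + ∑_{b ≥ 1} Γ_{k+b} C_{r-b}` for all `r`. -/
def IsPieri (k : ℕ) (f : Lam) (A C : ℕ → Lam) : Prop :=
  ∀ r : ℕ, qX r * f = A r + ∑ b ∈ Finset.range r, vertex (k + (b : ℤ) + 1) (C (r - 1 - b))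

theorem vertex_one (n : ℕ) : vertex n 1 = qX n := by
  rw [vertex_apply, map_one, ← Polynomial.C_1, ← Polynomial.monomial_zero_left, pair_monomial]
  simp

attribute [local irreducible] vertex

/-- For the empty partition q_r = Γ_r 1, so only b = r - 1 contributes when r > 0. -/
theorem isPieri_one : IsPieri 0 1 (fun r => if r = 0 then 1 else 0) fun r => if r = 0 then 1 else 0 := by
  intro r
  rcases r with _ | r
  · simp
    have := qX_natCast 0
    rw [qFun_zero] at this
    exact_mod_cast this
  · rw [Finset.sum_eq_single r]
    · have := vertex_one (r + 1)
      simp only [Nat.add_sub_cancel, Nat.sub_self, if_true, Nat.add_eq_zero_iff, one_ne_zero,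
        and_false, if_false, mul_one, zero_add, Nat.cast_zero]
      rw [← this]
      push_cast
      rfl
    · intro b hb hne
      have := Finset.mem_range.1 hb
      beta_reduce
      rw [if_neg (by omega), map_zero]
    · intro h
      exact absurd (Finset.mem_range.2 r.lt_succ_self) h

theorem IsPieri.congr {k : ℕ} {f f' : Lam} {A A' C C' : ℕ → Lam} (h : IsPieri k f A C)
    (hf : f = f') (hA : ∀ r, A r = A' r) (hC : ∀ r, C r = C' r) : IsPieri k f' A' C' := by
  obtain rfl := hf
  obtain rfl := funext hA
  obtain rfl := funext hC
  exact h

/-- Once column k+1 is allowed, the term b = 0, which is Γ_{k+1} C_{r-1}, moves into A and the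
remaining terms are renumbered. -/
theorem IsPieri.succ {k : ℕ} {f : Lam} {A C : ℕ → Lam} (h : IsPieri k f A C) :
    IsPieri (k + 1) f (fun r => A r + vertex (k + 1 : ℕ) (shiftSeq C r)) (shiftSeq C) := by
  intro r
  rw [h r, add_assoc]
  congr 1
  rcases r with _ | r
  · rw [Finset.sum_range_zero, Finset.sum_range_zero, shiftSeq, map_zero, add_zero]
  · rw [Finset.sum_range_succ', Finset.sum_range_succ, add_comm]
    have h0 : shiftSeq C (r + 1 - 1 - r) = 0 := by
      rw [Nat.add_sub_cancel, Nat.sub_self]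
      rfl
    rw [h0, map_zero, add_zero]
    refine congrArg₂ (· + ·) ?_ ?_
    · rw [shiftSeq_succ, show (k : ℤ) + ((0 : ℕ) : ℤ) + 1 = ((k + 1 : ℕ) : ℤ) by push_cast; ring,
        show r + 1 - 1 - 0 = r by omega]
    · refine Finset.sum_congr rfl fun b hb => ?_
      have := Finset.mem_range.1 hb
      have h1 : r + 1 - 1 - b = (r + 1 - 1 - (b + 1)) + 1 := by omega
      rw [h1, shiftSeq_succ, show (k : ℤ) + ((b + 1 : ℕ) : ℤ) + 1 = ((k + 1 : ℕ) : ℤ) + b + 1 by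
        push_cast; ring]

/-- Commute q_r past Γ_k by `qX_mul_vertex` and expand each q_a f. The A-terms give Γ_k A_r and a
(1-t)-multiple in the tail; the wrongly ordered products Γ_k Γ_{k+p+1} C and their companions
combine by `vertex_straighten` to t Γ_{k+p+1} Γ_k C. -/
theorem IsPieri.cons {k : ℕ} {f : Lam} {A C : ℕ → Lam} (h : IsPieri k f A C) :
    IsPieri k (vertex k f) (fun r => vertex k (A r))
      (fun r => (1 - t) • A r + t • vertex k (C r)) := by
  intro r
  have h1 : ∀ s : ℕ, ∀ n : ℤ, vertex n (qX s * f) = vertex n (A s) +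
      ∑ b ∈ Finset.range s, vertex n (vertex (k + (b : ℤ) + 1) (C (s - 1 - b))) := by
    intro s n
    rw [h s, map_add, map_sum]
  have h2 : ∀ p : ℕ, ∀ g, vertex k (vertex (k + (p : ℤ) + 1) g) + (1 - t) •
      ∑ i ∈ Finset.range p, vertex (k + (i : ℤ) + 1) (vertex (k + (p : ℤ) - i) g) =
      t • vertex (k + (p : ℤ) + 1) (vertex k g) := fun p g => vertex_straighten k p g
  rw [qX_mul_vertex]
  simp only [h1, map_add, map_smul, Finset.sum_add_distrib]
  simp only [← h2]
  simp only [Finset.sum_add_distrib, smul_add, ← Finset.smul_sum]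
  have h3 : ∑ a ∈ Finset.range r, vertex ((k : ℤ) + r - a) (A a) =
      ∑ b ∈ Finset.range r, vertex (k + (b : ℤ) + 1) (A (r - 1 - b)) := by
    rw [← Finset.sum_range_reflect]
    refine Finset.sum_congr rfl fun b hb => ?_
    have := Finset.mem_range.1 hb
    congr 2
    push_cast [show b ≤ r - 1 by omega, show 1 ≤ r by omega]
    ring
  -- Reindexing: p is chosen so that r - 1 - p = a - 1 - b, keeping the argument of C, and i so that
  -- k + i + 1 = k + r - a, keeping the outer vertex operator.
  have h4 : ∑ a ∈ Finset.range r, ∑ b ∈ Finset.range a, vertex ((k : ℤ) + r - a)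
        (vertex (k + (b : ℤ) + 1) (C (a - 1 - b))) =
      ∑ p ∈ Finset.range r, ∑ i ∈ Finset.range p, vertex (k + (i : ℤ) + 1)
        (vertex (k + (p : ℤ) - i) (C (r - 1 - p))) := by
    rw [Finset.sum_sigma', Finset.sum_sigma']
    refine Finset.sum_nbij' (fun x => ⟨r - x.1 + x.2, r - x.1 - 1⟩)
      (fun y => ⟨r - y.2 - 1, y.1 - y.2 - 1⟩) ?_ ?_ ?_ ?_ ?_
    · rintro ⟨a, b⟩ hx
      simp only [Finset.mem_sigma, Finset.mem_range] at hx ⊢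
      omega
    · rintro ⟨a, b⟩ hx
      simp only [Finset.mem_sigma, Finset.mem_range] at hx ⊢
      omega
    · rintro ⟨a, b⟩ hx
      simp only [Finset.mem_sigma, Finset.mem_range] at hx
      simp only [Sigma.mk.injEq, heq_eq_eq]
      omega
    · rintro ⟨a, b⟩ hx
      simp only [Finset.mem_sigma, Finset.mem_range] at hx
      simp only [Sigma.mk.injEq, heq_eq_eq]
      omega
    · rintro ⟨a, b⟩ hx
      simp only [Finset.mem_sigma, Finset.mem_range] at hx
      simp only
      have e1 : r - 1 - (r - a + b) = a - 1 - b := by omega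
      have e2 : (k : ℤ) + ((r - a - 1 : ℕ) : ℤ) + 1 = k + r - a := by omega
      have e3 : (k : ℤ) + ((r - a + b : ℕ) : ℤ) - ((r - a - 1 : ℕ) : ℤ) = k + b + 1 := by omega
      rw [e1, e2, e3]
  rw [h3, h4]
  abel

/-- Adding m parts equal to k at once. The recursion (1-t) + t(1-t^m) = 1 - t^{m+1} produces the
matrix element of (1-q)B, while the coefficient of γ stays 1. -/
theorem IsPieri.block {k : ℕ} {f : Lam} {α γ : ℕ → Lam}
    (h : IsPieri k f (fun r => α r + vertex k (γ r)) γ) (m : ℕ) :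
    IsPieri k ((vertex k ^ m) f)
      (fun r => (vertex k ^ m) (α r) + (vertex k ^ (m + 1)) (γ r))
      (fun r => (1 - t ^ m) • (vertex k ^ (m - 1)) (α r) + (vertex k ^ m) (γ r)) := by
  induction m with
  | zero => simpa using h
  | succ m ih =>
    have h1 := ih.cons
    have e1 : ∀ (j : ℕ) g, vertex k ((vertex k ^ j) g) = (vertex k ^ (j + 1)) g := fun j g => by
      rw [pow_succ']
      rfl
    have e2 : ∀ r, (1 - t) • ((vertex k ^ m) (α r) + (vertex k ^ (m + 1)) (γ r)) +
        t • vertex k ((1 - t ^ m) • (vertex k ^ (m - 1)) (α r) + (vertex k ^ m) (γ r)) =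
        (1 - t ^ (m + 1)) • (vertex k ^ (m + 1 - 1)) (α r) + (vertex k ^ (m + 1)) (γ r) := by
      intro r
      rw [map_add, map_smul, e1, e1, Nat.add_sub_cancel]
      have key : ∀ (c : K) (x y : Lam),
          (1 - t) • (x + y) + t • ((1 - c) • x + y) = (1 - c * t) • x + y := by
        intro c x y
        simp only [sub_smul, smul_add, smul_sub, mul_smul, one_smul, smul_comm c t]
        abel
      -- For m = 0 the truncated exponent m - 1 is harmless, since its coefficient 1 - t⁰ vanishes.
      have hx : (1 - t ^ m) • (vertex k ^ (m - 1 + 1)) (α r) =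
          (1 - t ^ m) • (vertex k ^ m) (α r) := by
        rcases m with _ | m
        · rw [pow_zero t, sub_self, zero_smul, zero_smul]
        · rw [Nat.add_sub_cancel]
      rw [hx, pow_succ t m]
      exact key _ _ _
    exact h1.congr (e1 _ _) (fun r => by rw [map_add, e1, e1]) e2

/-- The coefficients of the Pieri rule for the partition with `n j` parts equal to `j`, for
`1 ≤ j ≤ k`: the first sequence collects the horizontal strips that have no box in column `k + 1`,
the second one those that have, without the row ending there. -/
def pieriPair (n : ℕ → ℕ) : ℕ → (ℕ → Lam) × (ℕ → Lam)
  | 0 => (fun r => if r = 0 then 1 else 0, fun r => if r = 0 then 1 else 0)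
  | k + 1 =>
    (fun r => (vertex (k + 1 : ℕ) ^ n (k + 1)) ((pieriPair n k).1 r) +
        (vertex (k + 1 : ℕ) ^ (n (k + 1) + 1)) (shiftSeq (pieriPair n k).2 r),
      fun r => (1 - t ^ n (k + 1)) •
          (vertex (k + 1 : ℕ) ^ (n (k + 1) - 1)) ((pieriPair n k).1 r) +
        (vertex (k + 1 : ℕ) ^ n (k + 1)) (shiftSeq (pieriPair n k).2 r))

/-- The parts `≤ k` of the partition with `n j` parts equal to `j`. -/
def partList (n : ℕ → ℕ) : ℕ → List ℕ
  | 0 => []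
  | k + 1 => List.replicate (n (k + 1)) (k + 1) ++ partList n k

theorem hallQ_replicate_append (m k : ℕ) (l : List ℕ) :
    hallQ (List.replicate m k ++ l) = (vertex k ^ m) (hallQ l) := by
  induction m with
  | zero => simp
  | succ m ih =>
    rw [List.replicate_succ, List.cons_append, hallQ_cons, ih, pow_succ']
    rfl

theorem hallQ_partList_succ (n : ℕ → ℕ) (k : ℕ) : hallQ (partList n (k + 1)) =
    (vertex (k + 1 : ℕ) ^ n (k + 1)) (hallQ (partList n k)) :=
  hallQ_replicate_append _ _ _

theorem isPieri_partList (n : ℕ → ℕ) (k : ℕ) :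
    IsPieri k (hallQ (partList n k)) (pieriPair n k).1 (pieriPair n k).2 := by
  induction k with
  | zero => exact isPieri_one
  | succ k ih =>
    rw [hallQ_partList_succ]
    exact ih.succ.block _

/-- Each column contributes at most one box of a horizontal strip. Hence truncating generating
functions at degree M loses nothing. -/
theorem pieriPair_eq_zero (n : ℕ → ℕ) (k r : ℕ) (h : k < r) :
    (pieriPair n k).1 r = 0 ∧ (pieriPair n k).2 r = 0 := by
  induction k generalizing r with
  | zero => simp [pieriPair, show r ≠ 0 by omega]
  | succ k ih =>
    obtain ⟨r, rfl⟩ : ∃ r', r = r' + 1 := ⟨r - 1, by omega⟩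
    simp [pieriPair, shiftSeq, (ih (r + 1) (by omega)).1, (ih r (by omega)).2]

/-- The span of the `Q_λ(𝐱)` for which `λ` has at most `k` columns. -/
def hallSpan (k : ℕ) : Submodule K Lam :=
  Submodule.span K {f | ∃ l : List ℕ, l.SortedGE ∧ (∀ x ∈ l, 0 < x ∧ x ≤ k) ∧ f = hallQ l}

theorem hallSpan_mono {k k' : ℕ} (h : k ≤ k') : hallSpan k ≤ hallSpan k' := by
  refine Submodule.span_mono ?_
  rintro _ ⟨l, hl, hp, rfl⟩
  exact ⟨l, hl, fun x hx => ⟨(hp x hx).1, (hp x hx).2.trans h⟩, rfl⟩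

theorem sortedGE_cons {k : ℕ} {l : List ℕ} (hl : l.SortedGE) (h : ∀ x ∈ l, x ≤ k) :
    (k :: l).SortedGE :=
  (List.pairwise_cons.2 ⟨h, hl.pairwise⟩).sortedGE

theorem vertex_mem_hallSpan {k : ℕ} (hk : 0 < k) {f : Lam} (hf : f ∈ hallSpan k) :
    vertex k f ∈ hallSpan k := by
  have : hallSpan k ≤ (hallSpan k).comap (vertex k) := by
    refine Submodule.span_le.2 ?_
    rintro _ ⟨l, hl, hp, rfl⟩
    refine Submodule.subset_span ⟨k :: l, sortedGE_cons hl fun x hx => (hp x hx).2, ?_, rfl⟩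
    intro x hx
    rcases List.mem_cons.1 hx with rfl | hx
    · exact ⟨hk, le_rfl⟩
    · exact hp x hx
  exact this hf

theorem vertex_pow_mem_hallSpan {k : ℕ} (hk : 0 < k) {f : Lam} (hf : f ∈ hallSpan k) (m : ℕ) :
    (vertex k ^ m) f ∈ hallSpan k := by
  induction m with
  | zero => exact hf
  | succ m ih =>
    rw [pow_succ']
    exact vertex_mem_hallSpan hk ih

theorem pieriPair_mem_hallSpan (n : ℕ → ℕ) (k r : ℕ) :
    (pieriPair n k).1 r ∈ hallSpan k ∧ (pieriPair n k).2 r ∈ hallSpan k := by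
  induction k generalizing r with
  | zero =>
    have h : (if r = 0 then (1 : Lam) else 0) ∈ hallSpan 0 := by
      split_ifs
      · exact Submodule.subset_span ⟨[], List.Pairwise.nil.sortedGE, by simp, rfl⟩
      · exact Submodule.zero_mem _
    exact ⟨h, h⟩
  | succ k ih =>
    have h1 := fun r => hallSpan_mono k.le_succ (ih r).1
    have h2 : ∀ r, shiftSeq (pieriPair n k).2 r ∈ hallSpan (k + 1) := by
      rintro (_ | r)
      · exact Submodule.zero_mem _
      · exact hallSpan_mono k.le_succ (ih r).2
    exact ⟨Submodule.add_mem _ (vertex_pow_mem_hallSpan k.succ_pos (h1 r) _)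
        (vertex_pow_mem_hallSpan k.succ_pos (h2 r) _),
      Submodule.add_mem _ (Submodule.smul_mem _ _ (vertex_pow_mem_hallSpan k.succ_pos (h1 r) _))
        (vertex_pow_mem_hallSpan k.succ_pos (h2 r) _)⟩

/-- The span of the `Q_λ(𝐱)` for which `λ` has more than `k` columns. -/
def hallTail (k : ℕ) : Submodule K Lam :=
  Submodule.span K {f | ∃ l : List ℕ, l.SortedGE ∧ (∀ x ∈ l, 0 < x) ∧ (∃ x ∈ l, k < x) ∧ f = hallQ l}

/-- The new part k + b + 1 exceeds all existing ones, so prepending it gives a genuine partition and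
no straightening is needed. -/
theorem vertex_mem_hallTail (k b : ℕ) {f : Lam} (hf : f ∈ hallSpan k) :
    vertex (k + (b : ℤ) + 1) f ∈ hallTail k := by
  have : hallSpan k ≤ (hallTail k).comap (vertex (k + (b : ℤ) + 1)) := by
    refine Submodule.span_le.2 ?_
    rintro _ ⟨l, hl, hp, rfl⟩
    refine Submodule.subset_span ⟨(k + b + 1) :: l, sortedGE_cons hl fun x hx => ?_, ?_, ?_, ?_⟩
    · have := (hp x hx).2
      omega
    · intro x hx
      rcases List.mem_cons.1 hx with rfl | hx
      · omega
      · exact (hp x hx).1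
    · exact ⟨k + b + 1, List.mem_cons_self, by omega⟩
    · rw [hallQ_cons]
      push_cast
      rfl
  exact this hf

/-- The Pieri rule, up to functions `Q_λ` for which `λ` has more than `k` columns. -/
theorem qX_mul_hallQ_sub_mem (n : ℕ → ℕ) (k r : ℕ) :
    qX r * hallQ (partList n k) - (pieriPair n k).1 r ∈ hallTail k := by
  rw [isPieri_partList n k r, add_sub_cancel_left]
  exact Submodule.sum_mem _ fun b _ => vertex_mem_hallTail k b (pieriPair_mem_hallSpan n k _).2

/-! ### The monodromy matrix of a single chain -/

/-- The basis of states `⨂ᵢ |nᵢ⟩ᵢ` of a chain. -/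
def chainBasis (M : ℕ) : Module.Basis (Fin (M + 1) → ℕ) K (FockChain M) :=
  Basis.piTensorProduct fun _ => Finsupp.basisSingleOne

theorem chainBasis_apply {M : ℕ} (n : Fin (M + 1) → ℕ) :
    chainBasis M n = ⨂ₜ[K] i, Finsupp.single (n i) (1 : K) := by
  simp [chainBasis]

theorem siteOp_chainBasis {M : ℕ} (i : Fin (M + 1)) (f : Module.End K Fock) (n : Fin (M + 1) → ℕ)
    (c : K) (k : ℕ) (h : f (Finsupp.single (n i) 1) = c • Finsupp.single k 1) :
    siteOp i f (chainBasis M n) = c • chainBasis M (Function.update n i k) := by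
  rw [chainBasis_apply, chainBasis_apply, siteOp, PiTensorProduct.map_tprod]
  have h1 : (fun j => (Function.update (fun _ => LinearMap.id) i f : Fin (M + 1) → Module.End K Fock) j
      (Finsupp.single (n j) 1)) = Function.update (fun j => Finsupp.single (n j) (1 : K)) i
        (c • Finsupp.single k 1) := by
    funext j
    by_cases hj : j = i
    · subst hj
      simp only [Function.update_self, h]
    · simp only [Function.update_of_ne hj, LinearMap.id_apply]
  have h2 : (fun j => Finsupp.single (Function.update n i k j) (1 : K)) =
      Function.update (fun j => Finsupp.single (n j) (1 : K)) i (Finsupp.single k 1) := by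
    funext j
    by_cases hj : j = i
    · subst hj
      simp only [Function.update_self]
    · simp only [Function.update_of_ne hj]
  rw [h1, h2, MultilinearMap.map_update_smul]

theorem siteOp_create {M : ℕ} (i : Fin (M + 1)) (n : Fin (M + 1) → ℕ) :
    siteOp i fockCreate (chainBasis M n) = chainBasis M (Function.update n i (n i + 1)) := by
  rw [siteOp_chainBasis i fockCreate n 1 (n i + 1), one_smul]
  simp [fockCreate]

theorem siteOp_annihilate {M : ℕ} (i : Fin (M + 1)) (n : Fin (M + 1) → ℕ) :
    siteOp i fockAnnihilate (chainBasis M n) =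
      ((1 - t ^ n i) / (1 - t)) • chainBasis M (Function.update n i (n i - 1)) := by
  apply siteOp_chainBasis
  simp [fockAnnihilate]

/-- The occupation numbers of a state, extended by `0`. -/
def occ {M : ℕ} (n : Fin (M + 1) → ℕ) (j : ℕ) : ℕ := if h : j < M + 1 then n ⟨j, h⟩ else 0

theorem occ_val {M : ℕ} (n : Fin (M + 1) → ℕ) (i : Fin (M + 1)) : occ n i = n i := dif_pos i.2

theorem partList_congr {n n' : ℕ → ℕ} {k : ℕ} (h : ∀ j ≤ k, n j = n' j) :
    partList n k = partList n' k := by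
  induction k with
  | zero => rfl
  | succ k ih =>
    rw [partList, partList, h _ le_rfl, ih fun j hj => h j (hj.trans k.le_succ)]

/-- The linear map sending a state of the chain to the Hall-Littlewood function `Q_λ(𝐱)`, where
`λ = 1^{n₁} ⋯ k^{n_k}`. -/
def chainMap (M k : ℕ) : FockChain M →ₗ[K] Lam :=
  (chainBasis M).constr K fun n => hallQ (partList (occ n) k)

theorem chainMap_chainBasis {M : ℕ} (k : ℕ) (n : Fin (M + 1) → ℕ) :
    chainMap M k (chainBasis M n) = hallQ (partList (occ n) k) :=
  (chainBasis M).constr_basis K _ n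

theorem chainMap_succ_chainBasis {M k : ℕ} (i : Fin (M + 1)) (hi : (i : ℕ) = k + 1)
    (n : Fin (M + 1) → ℕ) (m : ℕ) : chainMap M (k + 1) (chainBasis M (Function.update n i m)) =
      (vertex (k + 1 : ℕ) ^ m) (chainMap M k (chainBasis M n)) := by
  rw [chainMap_chainBasis, chainMap_chainBasis, hallQ_partList_succ, ← hi, occ_val,
    Function.update_self]
  congr 2
  apply partList_congr
  intro j hj
  unfold occ
  split_ifs with h
  · rw [Function.update_of_ne]
    intro h1
    rw [← h1] at hi
    simp only at hi
    omega
  · rfl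

/-- The span of the states that agree with `n` at the sites beyond `k`. -/
def agreeSpan {M : ℕ} (n : Fin (M + 1) → ℕ) (k : ℕ) : Submodule K (FockChain M) :=
  Submodule.span K (chainBasis M '' {n' | ∀ j : Fin (M + 1), k < j → n' j = n j})

section AgreeSpan

variable {M k : ℕ} {n : Fin (M + 1) → ℕ} {x : FockChain M}

theorem agreeSpan_mono {k' : ℕ} (h : k ≤ k') : agreeSpan n k ≤ agreeSpan n k' :=
  Submodule.span_mono (Set.image_mono fun _ hn j hj => hn j (h.trans_lt hj))

theorem chainBasis_mem_agreeSpan : chainBasis M n ∈ agreeSpan n k :=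
  Submodule.subset_span ⟨n, fun _ _ => rfl, rfl⟩

theorem update_mem_agreeSpan {n' : Fin (M + 1) → ℕ} (i : Fin (M + 1)) (hi : (i : ℕ) ≤ k) (m : ℕ)
    (h : ∀ j : Fin (M + 1), k < j → n' j = n j) :
    chainBasis M (Function.update n' i m) ∈ agreeSpan n k := by
  refine Submodule.subset_span ⟨_, fun j hj => ?_, rfl⟩
  rw [Function.update_of_ne, h j hj]
  rintro rfl
  omega

theorem create_mem_agreeSpan (i : Fin (M + 1)) (hi : (i : ℕ) ≤ k) (hx : x ∈ agreeSpan n k) :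
    siteOp i fockCreate x ∈ agreeSpan n k := by
  have : agreeSpan n k ≤ (agreeSpan n k).comap (siteOp i fockCreate) := by
    refine Submodule.span_le.2 ?_
    rintro _ ⟨n', hn', rfl⟩
    rw [SetLike.mem_coe, Submodule.mem_comap, siteOp_create]
    exact update_mem_agreeSpan i hi _ hn'
  exact this hx

theorem annihilate_mem_agreeSpan (i : Fin (M + 1)) (hi : (i : ℕ) ≤ k) (hx : x ∈ agreeSpan n k) :
    siteOp i fockAnnihilate x ∈ agreeSpan n k := by
  have : agreeSpan n k ≤ (agreeSpan n k).comap (siteOp i fockAnnihilate) := by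
    refine Submodule.span_le.2 ?_
    rintro _ ⟨n', hn', rfl⟩
    rw [SetLike.mem_coe, Submodule.mem_comap, siteOp_annihilate]
    exact Submodule.smul_mem _ _ (update_mem_agreeSpan i hi _ hn')
  exact this hx

variable (i : Fin (M + 1)) (hi : (i : ℕ) = k + 1)

include hi

/-- On states frozen beyond site k, site k+1 enters only through the power of Γ_{k+1} given by its
occupation number. This turns site operators into operations on vertex operators. -/
theorem chainMap_succ (hx : x ∈ agreeSpan n k) :
    chainMap M (k + 1) x = (vertex (k + 1 : ℕ) ^ n i) (chainMap M k x) := by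
  refine LinearMap.eqOn_span (f := chainMap M (k + 1))
    (g := (vertex (k + 1 : ℕ) ^ n i).comp (chainMap M k)) ?_ hx
  rintro _ ⟨n', hn', rfl⟩
  rw [LinearMap.comp_apply, ← chainMap_succ_chainBasis i hi, ← hn' i (by omega),
    Function.update_eq_self]

theorem chainMap_create (hx : x ∈ agreeSpan n k) :
    chainMap M (k + 1) (siteOp i fockCreate x) =
      (vertex (k + 1 : ℕ) ^ (n i + 1)) (chainMap M k x) := by
  refine LinearMap.eqOn_span (f := (chainMap M (k + 1)).comp (siteOp i fockCreate))
    (g := (vertex (k + 1 : ℕ) ^ (n i + 1)).comp (chainMap M k)) ?_ hx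
  rintro _ ⟨n', hn', rfl⟩
  rw [LinearMap.comp_apply, LinearMap.comp_apply, siteOp_create, chainMap_succ_chainBasis i hi,
    hn' i (by omega)]

theorem chainMap_annihilate (hx : x ∈ agreeSpan n k) :
    chainMap M (k + 1) (siteOp i fockAnnihilate x) =
      ((1 - t ^ n i) / (1 - t)) • (vertex (k + 1 : ℕ) ^ (n i - 1)) (chainMap M k x) := by
  refine LinearMap.eqOn_span (f := (chainMap M (k + 1)).comp (siteOp i fockAnnihilate))
    (g := ((1 - t ^ n i) / (1 - t)) • (vertex (k + 1 : ℕ) ^ (n i - 1)).comp (chainMap M k)) ?_ hx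
  rintro _ ⟨n', hn', rfl⟩
  rw [LinearMap.comp_apply, LinearMap.smul_apply, LinearMap.comp_apply, siteOp_annihilate, map_smul,
    chainMap_succ_chainBasis i hi, hn' i (by omega)]

end AgreeSpan

/-- The `L`-matrix at site `i`. -/
def chainL {M : ℕ} (u : K) (i : Fin (M + 1)) : Matrix (Fin 2) (Fin 2) (Module.End K (FockChain M)) :=
  lMatrix u (siteOp i fockCreate) (siteOp i fockAnnihilate)

/-- The product of the `L`-matrices at the sites `k - 1, …, 0`. -/
def chainMonodromy (M : ℕ) (u : K) (k : ℕ) :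
    Matrix (Fin 2) (Fin 2) (Module.End K (FockChain M)) :=
  (((List.finRange (M + 1)).take k).reverse.map (chainL u)).prod

theorem chainMonodromy_succ {M k : ℕ} (u : K) (hk : k < M + 1) :
    chainMonodromy M u (k + 1) = chainL u ⟨k, hk⟩ * chainMonodromy M u k := by
  have h : k < (List.finRange (M + 1)).length := by simpa using hk
  rw [chainMonodromy, chainMonodromy, List.take_succ_eq_append_getElem h, List.reverse_append]
  simp

theorem chainL_mul_zero_one {M : ℕ} (u : K) (i : Fin (M + 1))
    (T : Matrix (Fin 2) (Fin 2) (Module.End K (FockChain M))) (x : FockChain M) :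
    (chainL u i * T) 0 1 x = u⁻¹ • T 0 1 x + siteOp i fockCreate (T 1 1 x) := by
  rw [Matrix.mul_apply, Fin.sum_univ_two]
  simp [chainL, lMatrix, Module.algebraMap_end_apply]

theorem chainL_mul_one_one {M : ℕ} (u : K) (i : Fin (M + 1))
    (T : Matrix (Fin 2) (Fin 2) (Module.End K (FockChain M))) (x : FockChain M) :
    (chainL u i * T) 1 1 x = (1 - t) • siteOp i fockAnnihilate (T 0 1 x) + u • T 1 1 x := by
  rw [Matrix.mul_apply, Fin.sum_univ_two]
  simp [chainL, lMatrix, Module.algebraMap_end_apply]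

theorem chainMonodromy_mem {M : ℕ} (u : K) (n : Fin (M + 1) → ℕ) {k : ℕ} (hk : k < M + 1) :
    chainMonodromy M u (k + 1) 0 1 (chainBasis M n) ∈ agreeSpan n k ∧
      chainMonodromy M u (k + 1) 1 1 (chainBasis M n) ∈ agreeSpan n k := by
  induction k with
  | zero =>
    rw [chainMonodromy_succ u hk, chainL_mul_zero_one, chainL_mul_one_one]
    have h0 : chainMonodromy M u 0 = 1 := by simp [chainMonodromy]
    simp only [h0, Matrix.one_apply_eq, Matrix.one_apply_ne (show (0 : Fin 2) ≠ 1 by decide),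
      LinearMap.zero_apply, smul_zero, zero_add, map_zero, Module.End.one_apply]
    exact ⟨create_mem_agreeSpan _ le_rfl chainBasis_mem_agreeSpan,
      Submodule.smul_mem _ _ chainBasis_mem_agreeSpan⟩
  | succ k ih =>
    obtain ⟨h1, h2⟩ := ih (by omega)
    have h1' := agreeSpan_mono k.le_succ h1
    have h2' := agreeSpan_mono k.le_succ h2
    rw [chainMonodromy_succ u hk, chainL_mul_zero_one, chainL_mul_one_one]
    exact ⟨Submodule.add_mem _ (Submodule.smul_mem _ _ h1') (create_mem_agreeSpan _ le_rfl h2'),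
      Submodule.add_mem _ (Submodule.smul_mem _ _ (annihilate_mem_agreeSpan _ le_rfl h1'))
        (Submodule.smul_mem _ _ h2')⟩

/-- The truncated value `∑_{r ≤ M} wʳ f_r`. -/
def evalSeq (M : ℕ) (w : K) : (ℕ → Lam) →ₗ[K] Lam :=
  ∑ r ∈ Finset.range (M + 1), w ^ r • LinearMap.proj r

theorem evalSeq_apply (M : ℕ) (w : K) (f : ℕ → Lam) :
    evalSeq M w f = ∑ r ∈ Finset.range (M + 1), w ^ r • f r := by
  simp [evalSeq]

/-- The shift would push the entry at M out of the truncation, hence the vanishing hypothesis. -/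
theorem evalSeq_shiftSeq (M : ℕ) (w : K) (f : ℕ → Lam) (h : f M = 0) :
    evalSeq M w (shiftSeq f) = w • evalSeq M w f := by
  rw [evalSeq_apply, evalSeq_apply, Finset.sum_range_succ', Finset.sum_range_succ, h]
  simp only [shiftSeq, smul_zero, add_zero, Finset.smul_sum, smul_smul, pow_succ']

theorem evalSeq_map (M : ℕ) (w : K) (φ : Module.End K Lam) (f : ℕ → Lam) :
    evalSeq M w (fun r => φ (f r)) = φ (evalSeq M w f) := by
  rw [evalSeq_apply, evalSeq_apply, map_sum]
  simp only [map_smul]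

/-- Induction on sites: left multiplication by the L-matrix reproduces the recursion of `pieriPair`.
Site 0 starts it with the second column of its L-matrix, whose image is (1, u) because n₀ is
forgotten. -/
theorem chainMap_chainMonodromy {M : ℕ} (u : K) (hu : u ≠ 0) (n : Fin (M + 1) → ℕ) {k : ℕ}
    (hk : k < M + 1) :
    u ^ k • chainMap M k (chainMonodromy M u (k + 1) 0 1 (chainBasis M n)) =
        evalSeq M (u ^ 2) (pieriPair (occ n) k).1 ∧
      u ^ k • chainMap M k (chainMonodromy M u (k + 1) 1 1 (chainBasis M n)) =
        u • evalSeq M (u ^ 2) (pieriPair (occ n) k).2 := by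
  induction k with
  | zero =>
    have h0 : chainMonodromy M u 0 = 1 := by simp [chainMonodromy]
    have h1 : ∀ n, chainMap M 0 (chainBasis M n) = 1 := fun n => chainMap_chainBasis 0 n
    have h2 : evalSeq M (u ^ 2) (fun r => if r = 0 then 1 else 0) = 1 := by
      rw [evalSeq_apply, Finset.sum_eq_single 0]
      · simp
      · intro r _ hr
        rw [if_neg hr, smul_zero]
      · simp
    rw [chainMonodromy_succ u hk, chainL_mul_zero_one, chainL_mul_one_one, pieriPair]
    simp only [h0, Matrix.one_apply_eq, Matrix.one_apply_ne (show (0 : Fin 2) ≠ 1 by decide),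
      LinearMap.zero_apply, smul_zero, zero_add, map_zero, Module.End.one_apply, siteOp_create,
      map_smul, h1, h2, pow_zero, one_smul]
    exact ⟨trivial, trivial⟩
  | succ k ih =>
    obtain ⟨h1, h2⟩ := ih (by omega)
    obtain ⟨m1, m2⟩ := chainMonodromy_mem u n (show k < M + 1 by omega)
    have hi : ((⟨k + 1, hk⟩ : Fin (M + 1)) : ℕ) = k + 1 := rfl
    have ho : occ n (k + 1) = n ⟨k + 1, hk⟩ := dif_pos hk
    have hs := evalSeq_shiftSeq M (u ^ 2) (pieriPair (occ n) k).2
      (pieriPair_eq_zero _ k M (by omega)).2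
    -- The factor (1 - q) of the L-matrix cancels the denominator of [n] and leaves 1 - tⁿ.
    have ht : (1 - t : K) ≠ 0 := by simpa using t_pow_ne_one one_pos
    rw [chainMonodromy_succ u hk, chainL_mul_zero_one, chainL_mul_one_one, pieriPair]
    simp only [map_add, map_smul, chainMap_succ _ hi m1, chainMap_succ _ hi m2,
      chainMap_create _ hi m2, chainMap_annihilate _ hi m1, ho]
    have hA : evalSeq M (u ^ 2) (fun r =>
        (vertex (k + 1 : ℕ) ^ n ⟨k + 1, hk⟩) ((pieriPair (occ n) k).1 r) +
        (vertex (k + 1 : ℕ) ^ (n ⟨k + 1, hk⟩ + 1)) (shiftSeq (pieriPair (occ n) k).2 r)) =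
        (vertex (k + 1 : ℕ) ^ n ⟨k + 1, hk⟩) (evalSeq M (u ^ 2) (pieriPair (occ n) k).1) +
        (u ^ 2) • (vertex (k + 1 : ℕ) ^ (n ⟨k + 1, hk⟩ + 1))
          (evalSeq M (u ^ 2) (pieriPair (occ n) k).2) := by
      rw [← map_smul, ← hs, ← evalSeq_map, ← evalSeq_map, ← map_add]
      rfl
    have hC : evalSeq M (u ^ 2) (fun r => (1 - t ^ n ⟨k + 1, hk⟩) •
        (vertex (k + 1 : ℕ) ^ (n ⟨k + 1, hk⟩ - 1)) ((pieriPair (occ n) k).1 r) +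
        (vertex (k + 1 : ℕ) ^ n ⟨k + 1, hk⟩) (shiftSeq (pieriPair (occ n) k).2 r)) =
        (1 - t ^ n ⟨k + 1, hk⟩) • (vertex (k + 1 : ℕ) ^ (n ⟨k + 1, hk⟩ - 1))
          (evalSeq M (u ^ 2) (pieriPair (occ n) k).1) +
        (u ^ 2) • (vertex (k + 1 : ℕ) ^ n ⟨k + 1, hk⟩)
          (evalSeq M (u ^ 2) (pieriPair (occ n) k).2) := by
      rw [← map_smul _ (u ^ 2), ← hs, ← evalSeq_map, ← evalSeq_map, ← map_smul, ← map_add]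
      rfl
    rw [hA, hC, ← h1]
    generalize chainMap M k (chainMonodromy M u (k + 1) 0 1 (chainBasis M n)) = b at *
    generalize chainMap M k (chainMonodromy M u (k + 1) 1 1 (chainBasis M n)) = d at *
    -- One factor u² from the shift is shared between the prefactor u in the induction hypothesis
    -- for the entry 11 and the growth of u^k to u^{k+1}.
    have h3 : (u ^ 2) • evalSeq M (u ^ 2) (pieriPair (occ n) k).2 = u ^ (k + 1) • d := by
      rw [pow_succ' u k, mul_smul u, h2, smul_smul, ← sq]
    rw [← map_smul _ (u ^ 2), h3, ← map_smul _ (u ^ 2), h3]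
    simp only [map_smul, smul_add, smul_smul]
    constructor
    · congr 2
      rw [pow_succ, mul_assoc, mul_inv_cancel₀ hu, mul_one]
    · congr 2
      · field_simp
        ring
      · ring

/-! ### The two-site model -/

theorem mapMatrix_lMatrix {A B : Type*} [Semiring A] [Algebra K A] [Semiring B] [Algebra K B]
    (φ : A →ₐ[K] B) (u : K) (a b : A) : φ.mapMatrix (lMatrix u a b) = lMatrix u (φ a) (φ b) := by
  ext i j
  fin_cases i <;> fin_cases j <;> simp [lMatrix]

theorem chainMonodromy_full {M : ℕ} (u : K) :
    chainMonodromy M u (M + 1) = ((List.finRange (M + 1)).reverse.map (chainL u)).prod := by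
  rw [chainMonodromy, List.take_of_length_le (by simp)]

theorem monodromy₁_eq (M₁ M₂ : ℕ) (u : K) : monodromy₁ M₁ M₂ u =
    (Module.End.rTensorAlgHom K (FockChain M₁) (FockChain M₂)).mapMatrix
      (chainMonodromy M₁ u (M₁ + 1)) := by
  rw [chainMonodromy_full, map_list_prod, List.map_map, monodromy₁]
  congr 2
  funext i
  exact (mapMatrix_lMatrix (Module.End.rTensorAlgHom K (FockChain M₁) (FockChain M₂)) u _ _).symm

theorem monodromy₂_eq (M₁ M₂ : ℕ) (u : K) : monodromy₂ M₁ M₂ u =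
    (Module.End.lTensorAlgHom K (FockChain M₂) (FockChain M₁)).mapMatrix
      (chainMonodromy M₂ u (M₂ + 1)) := by
  rw [chainMonodromy_full, map_list_prod, List.map_map, monodromy₂]
  congr 2
  funext i
  exact (mapMatrix_lMatrix (Module.End.lTensorAlgHom K (FockChain M₂) (FockChain M₁)) u _ _).symm

theorem tildeB₁_tmul {M₁ M₂ : ℕ} (u : K) (x : FockChain M₁) (y : FockChain M₂) :
    tildeB₁ M₁ M₂ u (x ⊗ₜ y) = (u ^ M₁ • chainMonodromy M₁ u (M₁ + 1) 0 1 x) ⊗ₜ y := by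
  rw [tildeB₁, monodromy₁_eq, ← TensorProduct.smul_tmul']
  rfl

theorem tildeB₂_tmul {M₁ M₂ : ℕ} (u : K) (x : FockChain M₁) (y : FockChain M₂) :
    tildeB₂ M₁ M₂ u (x ⊗ₜ y) = x ⊗ₜ (u ^ M₂ • chainMonodromy M₂ u (M₂ + 1) 0 1 y) := by
  rw [tildeB₂, monodromy₂_eq, TensorProduct.tmul_smul]
  rfl

theorem coe_partList (n : ℕ → ℕ) (k : ℕ) : (partList n k : Multiset ℕ) =
    ∑ i ∈ Finset.range k, Multiset.replicate (n (i + 1)) (i + 1) := by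
  induction k with
  | zero => rfl
  | succ k ih =>
    rw [partList, ← Multiset.coe_add, ih, Finset.sum_range_succ, add_comm, Multiset.coe_replicate]

theorem mem_partList {n : ℕ → ℕ} {k x : ℕ} (hx : x ∈ partList n k) : 0 < x ∧ x ≤ k := by
  induction k with
  | zero => simp [partList] at hx
  | succ k ih =>
    rw [partList, List.mem_append] at hx
    rcases hx with hx | hx
    · rw [List.eq_of_mem_replicate hx]
      omega
    · have := ih hx
      omega

theorem pairwise_partList (n : ℕ → ℕ) (k : ℕ) : (partList n k).Pairwise (· ≥ ·) := by
  induction k with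
  | zero => exact List.Pairwise.nil
  | succ k ih =>
    rw [partList, List.pairwise_append]
    refine ⟨List.pairwise_replicate.2 (Or.inr le_rfl), ih, fun x hx y hy => ?_⟩
    rw [List.eq_of_mem_replicate hx]
    exact (mem_partList hy).2.trans k.le_succ

theorem parts_eq_partList {M : ℕ} (n : Fin (M + 1) → ℕ) : parts n = partList (occ n) M := by
  rw [coe_partList, Finset.sum_range, parts]
  refine Finset.sum_congr rfl fun i _ => ?_
  rw [← occ_val n i.succ, Fin.val_succ]

theorem rowLens_stateDiagram {M : ℕ} (n : Fin (M + 1) → ℕ) :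
    (stateDiagram n).rowLens = partList (occ n) M := by
  have h1 : (stateDiagram n).rowLens = (parts n).sort (· ≥ ·) := rowLens_diagramOfParts fun x hx => by
    rw [parts_eq_partList, Multiset.mem_coe] at hx
    exact (mem_partList hx).1
  rw [h1]
  refine List.Perm.eq_of_pairwise' (Multiset.pairwise_sort _ _) (pairwise_partList _ _)
    (Multiset.coe_eq_coe.1 ?_)
  rw [Multiset.sort_eq, parts_eq_partList]

theorem chainMap_chainBasis_eq {M : ℕ} (n : Fin (M + 1) → ℕ) :
    chainMap M M (chainBasis M n) = hallQ (stateDiagram n).rowLens := by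
  rw [chainMap_chainBasis, rowLens_stateDiagram]

theorem stateBasis_eq (M₁ M₂ : ℕ) (n : Fin (M₁ + 1) → ℕ) (m : Fin (M₂ + 1) → ℕ) :
    stateBasis M₁ M₂ (n, m) = chainBasis M₁ n ⊗ₜ chainBasis M₂ m := by
  rw [stateBasis_apply, chainBasis_apply, chainBasis_apply]

theorem jMap_stateBasis (M₁ M₂ : ℕ) (s : (Fin (M₁ + 1) → ℕ) × (Fin (M₂ + 1) → ℕ)) :
    jMap M₁ M₂ (stateBasis M₁ M₂ s) = coupledQ (stateDiagram s.1) (stateDiagram s.2) :=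
  (stateBasis M₁ M₂).constr_basis K _ s

/-- Before coupling, the two chains are independent, so the single-chain result can be applied in
either tensor factor. -/
theorem jMap_tmul {M₁ M₂ : ℕ} (x : FockChain M₁) (y : FockChain M₂) :
    jMap M₁ M₂ (x ⊗ₜ y) = coupling (inX (chainMap M₁ M₁ x) * inY (chainMap M₂ M₂ y)) := by
  have h : jMap M₁ M₂ = coupling.comp ((LinearMap.mul' K Poly).comp (TensorProduct.map
      (inX.toLinearMap.comp (chainMap M₁ M₁)) (inY.toLinearMap.comp (chainMap M₂ M₂)))) := by
    refine (stateBasis M₁ M₂).ext fun ⟨n, m⟩ => ?_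
    rw [jMap_stateBasis, stateBasis_eq, coupledQ_eq, ← chainMap_chainBasis_eq,
      ← chainMap_chainBasis_eq]
    rfl
  rw [h]
  rfl

/-! ### The image of the map from states -/

theorem rowLen_zero_le_iff (lam : YoungDiagram) (M : ℕ) :
    lam.rowLen 0 ≤ M ↔ ∀ x ∈ lam.rowLens, x ≤ M := by
  constructor
  · intro h x hx
    obtain ⟨i, -, rfl⟩ := List.mem_map.1 hx
    exact (lam.rowLen_anti _ _ (Nat.zero_le i)).trans h
  · intro h
    rcases Nat.eq_zero_or_pos (lam.rowLen 0) with h0 | h0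
    · omega
    · refine h _ (List.mem_map.2 ⟨0, List.mem_range.2 ?_, rfl⟩)
      rw [← YoungDiagram.mem_iff_lt_colLen]
      exact YoungDiagram.mem_iff_lt_rowLen.2 h0

theorem rowLen_stateDiagram_le {M : ℕ} (n : Fin (M + 1) → ℕ) : (stateDiagram n).rowLen 0 ≤ M := by
  rw [rowLen_zero_le_iff, rowLens_stateDiagram]
  exact fun x hx => (mem_partList hx).2

theorem count_partList (n : ℕ → ℕ) (k c : ℕ) :
    (partList n k).count c = if 0 < c ∧ c ≤ k then n c else 0 := by
  induction k with
  | zero => rw [if_neg (by omega)]; rfl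
  | succ k ih =>
    rw [partList, List.count_append, ih, List.count_replicate]
    simp only [beq_iff_eq]
    split_ifs <;> first | omega | (subst_vars; omega)

theorem exists_stateDiagram_eq {M : ℕ} (lam : YoungDiagram) (h : lam.rowLen 0 ≤ M) :
    ∃ n : Fin (M + 1) → ℕ, stateDiagram n = lam := by
  -- The occupation numbers are the multiplicities of the parts; the value at site 0 plays no role
  -- in the diagram.
  refine ⟨fun i => lam.rowLens.count (i : ℕ), youngDiagram_ext_count fun c => ?_⟩
  rw [rowLens_stateDiagram, count_partList]
  split_ifs with hc
  · exact dif_pos (Nat.lt_succ_of_le hc.2)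
  · rw [List.count_eq_zero_of_not_mem]
    intro hm
    exact hc ⟨c.pos, (rowLen_zero_le_iff lam M).1 h _ hm⟩

theorem range_jMap (M₁ M₂ : ℕ) : LinearMap.range (jMap M₁ M₂) = boxSpace M₁ M₂ := by
  rw [LinearMap.range_eq_map, ← (stateBasis M₁ M₂).span_eq, Submodule.map_span, boxSpace]
  congr 1
  ext f
  constructor
  · rintro ⟨_, ⟨s, rfl⟩, rfl⟩
    exact ⟨_, _, ⟨rowLen_stateDiagram_le s.1, rowLen_stateDiagram_le s.2⟩, jMap_stateBasis M₁ M₂ s⟩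
  · rintro ⟨lam, mu, ⟨h1, h2⟩, rfl⟩
    obtain ⟨n, rfl⟩ := exists_stateDiagram_eq lam h1
    obtain ⟨m, rfl⟩ := exists_stateDiagram_eq mu h2
    exact ⟨_, ⟨(n, m), rfl⟩, jMap_stateBasis M₁ M₂ (n, m)⟩

/-! ### The truncated generating functions -/

theorem exists_rowLens_eq {l : List ℕ} (hl : l.SortedGE) (hp : ∀ x ∈ l, 0 < x) :
    ∃ lam : YoungDiagram, lam.rowLens = l :=
  ⟨YoungDiagram.ofRowLens l hl, YoungDiagram.rowLens_ofRowLens_eq_self fun x hx => hp x hx⟩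

/-- A first partition that is too wide already excludes the pair from the box, whatever μ is, so
errors of the single-chain Pieri rule remain errors after coupling. -/
theorem coupling_mem_tailSpace_left {M₁ : ℕ} (M₂ : ℕ) {f : Lam} (hf : f ∈ hallTail M₁)
    (mu : YoungDiagram) : coupling (inX f * inY (hallQ mu.rowLens)) ∈ tailSpace M₁ M₂ := by
  have : hallTail M₁ ≤ (tailSpace M₁ M₂).comap (coupling.comp
      ((LinearMap.mulRight K (inY (hallQ mu.rowLens))).comp inX.toLinearMap)) := by
    refine Submodule.span_le.2 ?_
    rintro _ ⟨l, hl, hp, ⟨x, hx, hM⟩, rfl⟩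
    obtain ⟨lam, rfl⟩ := exists_rowLens_eq hl hp
    refine Submodule.subset_span ⟨lam, mu, fun h => ?_, (coupledQ_eq lam mu).symm⟩
    exact absurd ((rowLen_zero_le_iff lam M₁).1 h.1 x hx) (not_le.2 hM)
  exact this hf

theorem coupling_mem_tailSpace_right (M₁ : ℕ) {M₂ : ℕ} {f : Lam} (hf : f ∈ hallTail M₂)
    (lam : YoungDiagram) : coupling (inX (hallQ lam.rowLens) * inY f) ∈ tailSpace M₁ M₂ := by
  have : hallTail M₂ ≤ (tailSpace M₁ M₂).comap (coupling.comp
      ((LinearMap.mulLeft K (inX (hallQ lam.rowLens))).comp inY.toLinearMap)) := by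
    refine Submodule.span_le.2 ?_
    rintro _ ⟨l, hl, hp, ⟨x, hx, hM⟩, rfl⟩
    obtain ⟨mu, rfl⟩ := exists_rowLens_eq hl hp
    refine Submodule.subset_span ⟨lam, mu, fun h => ?_, (coupledQ_eq lam mu).symm⟩
    exact absurd ((rowLen_zero_le_iff mu M₂).1 h.2 x hx) (not_le.2 hM)
  exact this hf

theorem hTrunc_xOp (M : ℕ) (w : K) :
    hTrunc M xOp w = opEval (inX (evalSeq M w fun r => qX r)) := by
  rw [evalSeq_apply, map_sum, map_sum, hTrunc]
  refine Finset.sum_congr rfl fun r _ => ?_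
  rw [map_smul, map_smul, inX_qX, opEval_qInt_xVar, qInt_natCast]

theorem hTrunc_yOp (M : ℕ) (w : K) :
    hTrunc M yOp w = opEval (inY (evalSeq M w fun r => qX r)) := by
  rw [evalSeq_apply, map_sum, map_sum, hTrunc]
  refine Finset.sum_congr rfl fun r _ => ?_
  rw [map_smul, map_smul, inY_qX, opEval_qInt_yVar, qInt_natCast]

/-- The single-chain form of the theorem: the entry 01 is ∑ u^{2r} A_r, and each A_r is q_r Q_λ up
to `hallTail`. -/
theorem evalSeq_mul_chainMap_sub_mem {M : ℕ} (u : K) (hu : u ≠ 0) (n : Fin (M + 1) → ℕ) :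
    (evalSeq M (u ^ 2) fun r => qX r) * chainMap M M (chainBasis M n) -
      chainMap M M (u ^ M • chainMonodromy M u (M + 1) 0 1 (chainBasis M n)) ∈ hallTail M := by
  rw [map_smul, (chainMap_chainMonodromy u hu n (Nat.lt_succ_self M)).1, evalSeq_apply,
    evalSeq_apply, Finset.sum_mul, ← Finset.sum_sub_distrib, chainMap_chainBasis]
  refine Submodule.sum_mem _ fun r _ => ?_
  rw [smul_mul_assoc, ← smul_sub]
  exact Submodule.smul_mem _ _ (qX_mul_hallQ_sub_mem _ _ _)

/-- On a basis state the truncated operator passes inside `coupling` as multiplication by ∑ u^{2r}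
q_r(𝐱), which reduces the claim to the first chain. -/
theorem hTrunc_jMap_sub_mem₁ {M₁ M₂ : ℕ} (u : K) (hu : u ≠ 0) (v : TwoSite M₁ M₂) :
    hTrunc M₁ xOp (u ^ 2) (jMap M₁ M₂ v) - jMap M₁ M₂ (tildeB₁ M₁ M₂ u v) ∈ tailSpace M₁ M₂ := by
  have : ⊤ ≤ (tailSpace M₁ M₂).comap ((hTrunc M₁ xOp (u ^ 2)).comp (jMap M₁ M₂) -
      (jMap M₁ M₂).comp (tildeB₁ M₁ M₂ u)) := by
    rw [← (stateBasis M₁ M₂).span_eq, Submodule.span_le]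
    rintro _ ⟨⟨n, m⟩, rfl⟩
    rw [SetLike.mem_coe, Submodule.mem_comap, LinearMap.sub_apply, LinearMap.comp_apply,
      LinearMap.comp_apply, stateBasis_eq, tildeB₁_tmul, jMap_tmul, jMap_tmul, hTrunc_xOp,
      ← coupling_mul, ← mul_assoc, ← map_mul, ← map_sub, ← sub_mul, ← map_sub,
      chainMap_chainBasis_eq m]
    exact coupling_mem_tailSpace_left M₂ (evalSeq_mul_chainMap_sub_mem u hu n) _
  exact this trivial

theorem hTrunc_jMap_sub_mem₂ {M₁ M₂ : ℕ} (u : K) (hu : u ≠ 0) (v : TwoSite M₁ M₂) :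
    hTrunc M₂ yOp (u ^ 2) (jMap M₁ M₂ v) - jMap M₁ M₂ (tildeB₂ M₁ M₂ u v) ∈ tailSpace M₁ M₂ := by
  have : ⊤ ≤ (tailSpace M₁ M₂).comap ((hTrunc M₂ yOp (u ^ 2)).comp (jMap M₁ M₂) -
      (jMap M₁ M₂).comp (tildeB₂ M₁ M₂ u)) := by
    rw [← (stateBasis M₁ M₂).span_eq, Submodule.span_le]
    rintro _ ⟨⟨n, m⟩, rfl⟩
    rw [SetLike.mem_coe, Submodule.mem_comap, LinearMap.sub_apply, LinearMap.comp_apply,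
      LinearMap.comp_apply, stateBasis_eq, tildeB₂_tmul, jMap_tmul, jMap_tmul, hTrunc_yOp,
      ← coupling_mul, mul_left_comm, ← map_mul, ← map_sub, ← mul_sub, ← map_sub,
      chainMap_chainBasis_eq n]
    exact coupling_mem_tailSpace_right M₁ (evalSeq_mul_chainMap_sub_mem u hu m) _
  exact this trivial

theorem projection_eq_of_sub_mem {V : Type*} [AddCommGroup V] [Module K V] {p q : Submodule K V}
    (h : IsCompl p q) {x y : V} (hy : y ∈ p) (hxy : x - y ∈ q) : p.projection q h x = y := by
  rw [← sub_add_cancel x y, map_add, (Submodule.projection_apply_eq_zero_iff h).2 hxy,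
    Submodule.projection_apply_of_mem_left h hy, zero_add]

end CoupledHL

end

open CoupledHL in
theorem mainTheorem5 (M₁ M₂ : ℕ) (hM₁ : 0 < M₁) (hM₂ : 0 < M₂) :
    LinearMap.range (jMap M₁ M₂) = boxSpace M₁ M₂ ∧
    ∃ h : IsCompl (boxSpace M₁ M₂) (tailSpace M₁ M₂),
      ∀ u : K, u ≠ 0 →
        (∀ v : TwoSite M₁ M₂,
          jMap M₁ M₂ (tildeB₁ M₁ M₂ u v) =
            (boxSpace M₁ M₂).projection (tailSpace M₁ M₂) h
              (hTrunc M₁ xOp (u ^ 2) (jMap M₁ M₂ v))) ∧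
        (∀ v : TwoSite M₁ M₂,
          jMap M₁ M₂ (tildeB₂ M₁ M₂ u v) =
            (boxSpace M₁ M₂).projection (tailSpace M₁ M₂) h
              (hTrunc M₂ yOp (u ^ 2) (jMap M₁ M₂ v))) := by
  have hmem : ∀ v, jMap M₁ M₂ v ∈ boxSpace M₁ M₂ := fun v => range_jMap M₁ M₂ ▸ ⟨v, rfl⟩
  exact ⟨range_jMap M₁ M₂, isCompl_boxSpace_tailSpace M₁ M₂, fun u hu =>
    ⟨fun v => (projection_eq_of_sub_mem _ (hmem _) (hTrunc_jMap_sub_mem₁ u hu v)).symm,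
      fun v => (projection_eq_of_sub_mem _ (hmem _) (hTrunc_jMap_sub_mem₂ u hu v)).symm⟩⟩
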